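/- Let $1\le a<b$ be coprime integers, $A=(a,b)$, $\beta\in\mathbb C$, and let $\mathcal M_A(\beta)$ be the hypergeometric system in the variables $(x_1,x_2)\in\mathbb C^2$ given by the equations $(a x_1\partial_1+b x_2\partial_2-\beta)F=0$ and $(\partial_1^{u_1}\partial_2^{u_2}-\partial_1^{v_1}\partial_2^{v_2})F=0$ for all $u,v\in\mathbb N^2$ with $au_1+bu_2=av_1+bv_2$. For $s\in\mathbb R$ and $p\in\mathbb C$, let $G_{s,p}$ be the space of germs at $(p,0)$ of formal series $\varphi=\sum_{m\ge0}f_m(x_1)x_2^m$, with $f_m$ holomorphic in a common neighbourhood of $p$, that are Gevrey of order at most $s$ along $x_2=0$ (i.e. $\sum_m f_m(x_1)\,(m!)^{1-s}x_2^m$ is a germ of holomorphic function at $(p,0)$) and are solutions of $\mathcal M_A(\beta)$. For open sectors $S_1,S_2\subset\mathbb C^*$, a holomorphic function $F$ on $S_1\times S_2$ admits the asymptotic expansion $\varphi$ if there are holomorphic functions $c_k$ on $S_1$, with germ $f_k$ at $p\in S_1$, such that for every $N$, locally uniformly in $x_1\in S_1$, $F(x_1,x_2)-\sum_{k<N}c_k(x_1)x_2^k=O(|x_2|^N)$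 as $x_2\to0$ in $S_2$. A rapid decay cycle (for $S_1\times S_2$) is a finite complex linear combination of paths in the universal covering of $\mathbb C^*$ that come from infinity along a half line of argument $\theta_1$, turn around the origin on a circular arc from argument $\theta_1$ to argument $\theta_2$, and go to infinity along the half line of argument $\theta_2$, where $\theta_1,\theta_2\in\mathbb R$ are such that $\operatorname{Re}(x_1e^{ia\theta_i})<0$ and $\operatorname{Re}(x_2e^{ib\theta_i})<0$ for all $(x_1,x_2)\in S_1\times S_2$ (so there is rapid decay both for $e^{x_1t^a+x_2t^b}$ and for $e^{x_1t^a}$). For $1\le p'\le b$ let $C_{p'}$ be the path with $\theta_1=0$, $\theta_2=2\pi p'/b$. For a cycle $\gamma$ put $I_\gamma(x_1,x_2)=\int_\gamma t^{-\beta-1}\exp(x_1t^a+x_2t^b)\,dt$. Then there are open sectors $S_1,S_2$, each centred on and containing the negative real axis, such that for all real $s\ge b/a$ and all $p\in S_1$: 1. Every $\varphi\in G_{s,p}$ is the asymptotic expansion of a holomorphic solution of $\mathcal M_A(\beta)$ on $S_1\times S_2$. 2. If $\beta\notin\mathbb Z\setminus(\mathbb Na+\mathbb Nb)$, every $\varphi\in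 G_{s,p}$ is the asymptotic expansion of an integral $I_\gamma$ that is a holomorphic solution on $S_1\times S_2$, where $\gamma$ is a rapid decay cycle; moreover $\gamma$ can be taken to be a linear combination of rotated cycles $e^{i\theta}C_{p'}$, $1\le p'\le b$, $|\theta|<\pi/(2b)$. 3. If $\beta\in\mathbb Z\setminus(\mathbb Na+\mathbb Nb)$, the asymptotic expansions of the solutions $I_\gamma$, $\gamma$ a rapid decay cycle, form a subspace $W$ of codimension one of $G_{s,p}$ (and combinations of the rotated cycles $e^{i\theta}C_{p'}$ as above suffice to obtain $W$). The integral $$J_\beta(x_1,x_2)=\int_0^{+\infty}t^{-\beta-1}\bigl(e^{x_1t^a+x_2t^b}-P_\beta(x_1,x_2,t)\bigr)\,dt,\qquad P_\beta=\sum_{\ell_1a+\ell_2b\le\beta}\frac{x_1^{\ell_1}x_2^{\ell_2}t^{\ell_1a+\ell_2b}}{\ell_1!\,\ell_2!},$$ converges on $S_1\times S_2$, is a holomorphic solution of $\mathcal M_A(\beta)$ there, and has an asymptotic expansion $\psi\ne0$ such that $G_{s,p}=W\oplus\mathbb C\psi$. -/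

import Mathlib

open Filter Topology Set

noncomputable section

namespace GevreyHyp

/-! ### The hypergeometric system of the matrix `(a, b)` on holomorphic functions -/

/-- Partial derivative with respect to the first variable. -/
def partial₁ (F : ℂ × ℂ → ℂ) : ℂ × ℂ → ℂ := fun x => deriv (fun z => F (z, x.2)) x.1

/-- Partial derivative with respect to the second variable. -/
def partial₂ (F : ℂ × ℂ → ℂ) : ℂ × ℂ → ℂ := fun x => deriv (fun z => F (x.1, z)) x.2

/-- `F` is a holomorphic solution on `U` of the hypergeometric system with matrix `(a, b)` and
parameter `β`: it is annihilated by the Euler operator minus `β` and by all the toric operators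
`∂ ^ u - ∂ ^ v` with `A u = A v`. -/
structure IsHolomorphicSolution (a b : ℕ) (β : ℂ) (U : Set (ℂ × ℂ)) (F : ℂ × ℂ → ℂ) : Prop where
  holomorphic : DifferentiableOn ℂ F U
  euler : ∀ x ∈ U, (a : ℂ) * x.1 * partial₁ F x + (b : ℂ) * x.2 * partial₂ F x = β * F x
  toric : ∀ u v : ℕ × ℕ, a * u.1 + b * u.2 = a * v.1 + b * v.2 → ∀ x ∈ U,
    (partial₁^[u.1] (partial₂^[u.2] F)) x = (partial₁^[v.1] (partial₂^[v.2] F)) x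

/-! ### Gevrey series along `x₂ = 0` and formal solutions -/

/-- The coefficient of `x₂ ^ m` in `∂₁ ^ u₁ ∂₂ ^ u₂` applied to the series `∑ f m (x₁) x₂ ^ m`;
note that `(m + k).descFactorial k = (m + k)! / m!`. -/
def formalPartial (u : ℕ × ℕ) (f : ℕ → ℂ → ℂ) (m : ℕ) (z : ℂ) : ℂ :=
  ((m + u.2).descFactorial u.2 : ℂ) * iteratedDeriv u.1 (f (m + u.2)) z

/-- The series `∑ f m (x₁) x₂ ^ m` represents a germ at `(p, 0)` of Gevrey series of order at most
`s` along `x₂ = 0` (its coefficients are holomorphic in a common neighbourhood of `p`, and the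
series `∑ f m (x₁) / (m!) ^ (s - 1) * x₂ ^ m` is a germ of a holomorphic function at `(p, 0)`)
which is a solution of the hypergeometric system with matrix `(a, b)` and parameter `β`. -/
structure IsGevreySolution (a b : ℕ) (β : ℂ) (s : ℝ) (p : ℂ) (f : ℕ → ℂ → ℂ) : Prop where
  holomorphic : ∀ᶠ z in 𝓝 p, ∀ m, DifferentiableAt ℂ (f m) z
  gevrey : ∃ g : ℂ × ℂ → ℂ, AnalyticAt ℂ g (p, 0) ∧ ∀ᶠ x in 𝓝 ((p, 0) : ℂ × ℂ),
    HasSum (fun m : ℕ => f m x.1 / (((m.factorial : ℝ) ^ (s - 1) : ℝ) : ℂ) * x.2 ^ m) (g x)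
  euler : ∀ᶠ z in 𝓝 p, ∀ m : ℕ,
    (a : ℂ) * z * deriv (f m) z + (b : ℂ) * (m : ℂ) * f m z = β * f m z
  toric : ∀ᶠ z in 𝓝 p, ∀ u v : ℕ × ℕ, a * u.1 + b * u.2 = a * v.1 + b * v.2 → ∀ m : ℕ,
    formalPartial u f m z = formalPartial v f m z

/-- The sequence of germs at `p` of the coefficients of the series `∑ f m (x₁) x₂ ^ m`. -/
def germAt (p : ℂ) (f : ℕ → ℂ → ℂ) : ℕ → Germ (𝓝 p) ℂ := fun m => (f m : Germ (𝓝 p) ℂ)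

theorem contDiffAt_of_holomorphic {p : ℂ} {f : ℕ → ℂ → ℂ}
    (h : ∀ᶠ z in 𝓝 p, ∀ m, DifferentiableAt ℂ (f m) z) :
    ∀ᶠ z in 𝓝 p, ∀ m (k : ℕ), ContDiffAt ℂ k (f m) z := by
  filter_upwards [eventually_eventually_nhds.2 h] with z hz m k
  have : AnalyticAt ℂ (f m) z :=
    Complex.analyticAt_iff_eventually_differentiableAt.2 (hz.mono fun w hw => hw m)
  exact this.contDiffAt

theorem IsGevreySolution.add {a b : ℕ} {β : ℂ} {s : ℝ} {p : ℂ} {f g : ℕ → ℂ → ℂ}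
    (hf : IsGevreySolution a b β s p f) (hg : IsGevreySolution a b β s p g) :
    IsGevreySolution a b β s p (f + g) where
  holomorphic := by
    filter_upwards [hf.holomorphic, hg.holomorphic] with z h1 h2 m
    exact (h1 m).add (h2 m)
  gevrey := by
    obtain ⟨F, hF, hF'⟩ := hf.gevrey
    obtain ⟨G, hG, hG'⟩ := hg.gevrey
    refine ⟨fun x => F x + G x, hF.add hG, ?_⟩
    filter_upwards [hF', hG'] with x h1 h2
    convert h1.add h2 using 2
    simp only [Pi.add_apply]
    ring
  euler := by
    filter_upwards [hf.holomorphic, hg.holomorphic, hf.euler, hg.euler] with z h1 h2 h3 h4 m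
    simp only [Pi.add_apply]
    rw [deriv_add (h1 m) (h2 m)]
    linear_combination h3 m + h4 m
  toric := by
    filter_upwards [contDiffAt_of_holomorphic hf.holomorphic,
      contDiffAt_of_holomorphic hg.holomorphic, hf.toric, hg.toric] with z h1 h2 h3 h4 u v huv m
    have key : ∀ w : ℕ × ℕ, formalPartial w (f + g) m z
        = formalPartial w f m z + formalPartial w g m z := by
      intro w
      simp only [formalPartial, Pi.add_apply]
      rw [iteratedDeriv_add (h1 _ _) (h2 _ _)]
      ring
    rw [key, key, h3 u v huv m, h4 u v huv m]

theorem IsGevreySolution.smul {a b : ℕ} {β : ℂ} {s : ℝ} {p : ℂ} {f : ℕ → ℂ → ℂ} (c : ℂ)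
    (hf : IsGevreySolution a b β s p f) : IsGevreySolution a b β s p (c • f) where
  holomorphic := by
    filter_upwards [hf.holomorphic] with z h1 m
    exact (h1 m).const_smul c
  gevrey := by
    obtain ⟨F, hF, hF'⟩ := hf.gevrey
    refine ⟨fun x => c * F x, analyticAt_const.mul hF, ?_⟩
    filter_upwards [hF'] with x h1
    have h2 := h1.mul_left c
    have h3 : (fun m : ℕ => (c • f) m x.1 / (((m.factorial : ℝ) ^ (s - 1) : ℝ) : ℂ) * x.2 ^ m) =
        fun m : ℕ => c * (f m x.1 / (((m.factorial : ℝ) ^ (s - 1) : ℝ) : ℂ) * x.2 ^ m) := by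
      funext m
      rw [Pi.smul_apply, Pi.smul_apply, smul_eq_mul]
      ring
    rw [h3]
    exact h2
  euler := by
    filter_upwards [hf.holomorphic, hf.euler] with z h1 h3 m
    rw [Pi.smul_apply, deriv_const_smul c (h1 m), Pi.smul_apply, smul_eq_mul, smul_eq_mul]
    linear_combination c * h3 m
  toric := by
    filter_upwards [contDiffAt_of_holomorphic hf.holomorphic, hf.toric] with z h1 h3 u v huv m
    have key : ∀ w : ℕ × ℕ, formalPartial w (c • f) m z = c * formalPartial w f m z := by
      intro w
      simp only [formalPartial, Pi.smul_apply]
      rw [iteratedDeriv_const_smul (h1 _ _) c, smul_eq_mul]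
      ring
    rw [key, key, h3 u v huv m]

theorem IsGevreySolution.zero {a b : ℕ} {β : ℂ} {s : ℝ} {p : ℂ} :
    IsGevreySolution a b β s p 0 where
  holomorphic := Eventually.of_forall fun z m => differentiableAt_const (0 : ℂ)
  gevrey := ⟨fun _ => 0, analyticAt_const, Eventually.of_forall fun x => by
    simp⟩
  euler := Eventually.of_forall fun z m => by simp
  toric := Eventually.of_forall fun z u v _ m => by
    have h0 : ∀ k : ℕ, iteratedDeriv k (0 : ℂ → ℂ) z = 0 := by
      intro k
      rw [iteratedDeriv_eq_iterate]
      have : deriv^[k] (0 : ℂ → ℂ) = 0 := by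
        induction k with
        | zero => rfl
        | succ k ih =>
          rw [Function.iterate_succ_apply', ih]
          exact deriv_zero
      rw [this]
      rfl
    simp [formalPartial, h0]

/-- The stalk at `(p, 0)` of the space of solutions of the hypergeometric system with values in the
Gevrey series of order at most `s` along `x₂ = 0`. -/
def gevreySolutions (a b : ℕ) (β : ℂ) (s : ℝ) (p : ℂ) : Submodule ℂ (ℕ → Germ (𝓝 p) ℂ) where
  carrier := {φ | ∃ f : ℕ → ℂ → ℂ, germAt p f = φ ∧ IsGevreySolution a b β s p f}
  add_mem' := by
    rintro _ _ ⟨f, rfl, hf⟩ ⟨g, rfl, hg⟩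
    exact ⟨f + g, rfl, hf.add hg⟩
  zero_mem' := ⟨0, rfl, IsGevreySolution.zero⟩
  smul_mem' := by
    rintro c _ ⟨f, rfl, hf⟩
    exact ⟨c • f, rfl, hf.smul c⟩

/-! ### Sectors and asymptotic expansions -/

/-- The open sector of half-opening `δ` around the negative real axis. -/
def negSector (δ : ℝ) : Set ℂ := {z | z ≠ 0 ∧ |Complex.arg (-z)| < δ}

/-- `F` admits the asymptotic expansion `∑ c k (x₁) x₂ ^ k` on `S₁ × S₂` for `x₂` tending to zero
in `S₂`, locally uniformly with respect to `x₁ ∈ S₁`; the coefficients are holomorphic on `S₁`. -/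
structure HasAsymptoticExpansion (S₁ S₂ : Set ℂ) (F : ℂ × ℂ → ℂ) (c : ℕ → ℂ → ℂ) : Prop where
  holomorphic : ∀ k, DifferentiableOn ℂ (c k) S₁
  remainder : ∀ K ⊆ S₁, IsCompact K → ∀ N : ℕ, ∃ C : ℝ, ∃ r > (0 : ℝ),
    ∀ x₁ ∈ K, ∀ x₂ ∈ S₂, ‖x₂‖ < r →
      ‖F (x₁, x₂) - ∑ k ∈ Finset.range N, c k x₁ * x₂ ^ k‖ ≤ C * ‖x₂‖ ^ N

/-- `F` is a holomorphic solution on the product of the sectors of half-openings `δ₁` and `δ₂`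
around the negative real axes, and it has there an asymptotic expansion whose germ at `(p, 0)`
is `φ`. -/
def IsSolutionWithExpansion (a b : ℕ) (β : ℂ) (δ₁ δ₂ : ℝ) (p : ℂ) (F : ℂ × ℂ → ℂ)
    (φ : ℕ → Germ (𝓝 p) ℂ) : Prop :=
  IsHolomorphicSolution a b β (negSector δ₁ ×ˢ negSector δ₂) F ∧
    ∃ c : ℕ → ℂ → ℂ, HasAsymptoticExpansion (negSector δ₁) (negSector δ₂) F c ∧ germAt p c = φ

/-! ### Rapid decay cycles and integrals along them -/

/-- The function `t ^ (-β - 1) * exp (x₁ t ^ a + x₂ t ^ b)` at `t = exp w`, where the determination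
of `log t` is `w`. -/
def integrand (a b : ℕ) (β : ℂ) (x : ℂ × ℂ) (w : ℂ) : ℂ :=
  Complex.exp ((-β - 1) * w) * Complex.exp (x.1 * Complex.exp w ^ a + x.2 * Complex.exp w ^ b)

/-- Integral of `t ^ (-β - 1) * exp (x₁ t ^ a + x₂ t ^ b) dt` along the half line `r * exp (i θ)`,
`1 ≤ r`, with the determination `log t = log r + i θ`. -/
def rayIntegral (a b : ℕ) (β : ℂ) (x : ℂ × ℂ) (θ : ℝ) : ℂ :=
  ∫ r in Ioi (1 : ℝ), integrand a b β x ((Real.log r : ℂ) + (θ : ℂ) * Complex.I) *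
    Complex.exp ((θ : ℂ) * Complex.I)

/-- Integral of `t ^ (-β - 1) * exp (x₁ t ^ a + x₂ t ^ b) dt` along the arc `exp (i θ)`, `θ` going
from `θ₁` to `θ₂`, with the determination `log t = i θ`. -/
def arcIntegral (a b : ℕ) (β : ℂ) (x : ℂ × ℂ) (θ₁ θ₂ : ℝ) : ℂ :=
  ∫ θ in θ₁..θ₂, integrand a b β x ((θ : ℂ) * Complex.I) *
    (Complex.I * Complex.exp ((θ : ℂ) * Complex.I))

/-- Integral along the path that comes from infinity in the direction of argument `γ.1`, turns
around the origin along the unit circle and goes to infinity in the direction of argument `γ.2`.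
The arguments are real numbers, not classes modulo `2 π`: the path is a path in the universal
covering of `ℂ \ {0}`, that is, it carries a determination of `log t`. -/
def pathIntegral (a b : ℕ) (β : ℂ) (x : ℂ × ℂ) (γ : ℝ × ℝ) : ℂ :=
  -rayIntegral a b β x γ.1 + arcIntegral a b β x γ.1 γ.2 + rayIntegral a b β x γ.2

/-- Formal complex linear combinations of the paths of `pathIntegral`. -/
abbrev Chain := (ℝ × ℝ) →₀ ℂ

/-- Integral of `t ^ (-β - 1) * exp (x₁ t ^ a + x₂ t ^ b) dt` along a chain. -/
def chainIntegral (a b : ℕ) (β : ℂ) (Γ : Chain) (x : ℂ × ℂ) : ℂ :=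
  Γ.sum fun γ c => c * pathIntegral a b β x γ

/-- On the ray of argument `θ`, both `x₁ t ^ a` and `x₂ t ^ b` have negative real part, for all
`(x₁, x₂)` in the product of sectors. -/
def IsDecayDirection (a b : ℕ) (δ₁ δ₂ θ : ℝ) : Prop :=
  (∀ x₁ ∈ negSector δ₁, (x₁ * Complex.exp ((θ : ℂ) * Complex.I) ^ a).re < 0) ∧
    ∀ x₂ ∈ negSector δ₂, (x₂ * Complex.exp ((θ : ℂ) * Complex.I) ^ b).re < 0

/-- The chain is a rapid decay cycle, for the exponentials of both polynomials
`x₁ t ^ a + x₂ t ^ b` and `x₁ t ^ a`, for all `(x₁, x₂)` in the product of sectors. -/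
def IsRapidDecayCycle (a b : ℕ) (δ₁ δ₂ : ℝ) (Γ : Chain) : Prop :=
  ∀ γ ∈ Γ.support, IsDecayDirection a b δ₁ δ₂ γ.1 ∧ IsDecayDirection a b δ₁ δ₂ γ.2

/-- The chain is a linear combination of rotated cycles `exp (i θ) C_p`, `1 ≤ p ≤ b`,
`|θ| < π / (2 b)`, where `C_p` comes from infinity along the positive real axis, turns around the
origin through the angle `2 π p / b` and goes to infinity in the direction `exp (2 π i p / b)`. -/
def IsCombinationOfC (b : ℕ) (Γ : Chain) : Prop :=
  ∀ γ ∈ Γ.support, |γ.1| < Real.pi / (2 * b) ∧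
    ∃ p : ℕ, 1 ≤ p ∧ p ≤ b ∧ γ.2 = γ.1 + 2 * Real.pi * p / b

/-! ### The corrected integral along the positive real axis -/

/-- The set of integers that do not belong to the semigroup `ℕ a + ℕ b`. -/
def exceptionalIntegers (a b : ℕ) : Set ℤ := {n | ∀ i j : ℕ, n ≠ i * a + j * b}

/-- Taylor polynomial at `t = 0`, of degree at most `n`, of `exp (x₁ t ^ a + x₂ t ^ b)`
(zero if `n < 0`). -/
def taylorPoly (a b : ℕ) (n : ℤ) (x : ℂ × ℂ) (t : ℂ) : ℂ :=
  ∑ l ∈ (Finset.range (n.toNat + 1) ×ˢ Finset.range (n.toNat + 1)).filter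
      (fun l : ℕ × ℕ => (l.1 * a + l.2 * b : ℤ) ≤ n),
    x.1 ^ l.1 * x.2 ^ l.2 * t ^ (l.1 * a + l.2 * b) / ((l.1.factorial : ℂ) * (l.2.factorial : ℂ))

/-- The function `t ^ (-n - 1) * (exp (x₁ t ^ a + x₂ t ^ b) - P)`, with `P` the Taylor
polynomial. -/
def correctedIntegrand (a b : ℕ) (n : ℤ) (x : ℂ × ℂ) (t : ℝ) : ℂ :=
  (t : ℂ) ^ (-n - 1) *
    (Complex.exp (x.1 * (t : ℂ) ^ a + x.2 * (t : ℂ) ^ b) - taylorPoly a b n x (t : ℂ))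

/-- The Taylor-corrected integral along `[0, +∞[`. -/
def correctedIntegral (a b : ℕ) (n : ℤ) (x : ℂ × ℂ) : ℂ :=
  ∫ t in Ioi (0 : ℝ), correctedIntegrand a b n x t

end GevreyHyp

end

noncomputable section

namespace GevreyHyp

/-! ### Families of functions closed under the partial derivatives -/

/-! A Gevrey solution is rigid. The Euler equation forces f_m to be a multiple of z^((β - bm)/a),
and ∂₂^a = ∂₁^b recovers f_{m+a} from f_m, so the a numbers f_0(p), …, f_{a-1}(p) determine
everything (`eq_of_value_eq`). It suffices to find integrals that realize prescribed values.

Consider all the parameters β - k together: under the integral sign ∂₁ and ∂₂ replace β by β - a and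
β - b. For such a `ShiftFamily` the toric equations hold for free, and Taylor's formula at x₂ = 0
gives the expansion ∑ F_{bm}(x₁, 0) x₂^m / m!. The Euler equation comes from integration by parts;
at x₂ = 0 it bounds the growth of F_{bm}, which yields Gevrey order b/a without estimating any
integral. Only the values at (p, 0) for the parameters β - bm, m < a, remain to be studied.

At x₂ = 0 the rotation by 2π/a multiplies an integral by ζ_m = exp(-2πi(β - bm)/a). A path from a
direction near 0 to one near 2πq/a thus has the value (1 + ζ_m + ⋯ + ζ_m^(q-1)) K_m, where K_m is
the integral along the path of angle 2π/a. By coprimality the ζ_m are distinct, and a Vandermonde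
determinant shows that combinations of the paths q = 1, …, a reach every vector of values that
vanishes wherever K_m does (`exists_chain_values`). These paths can be taken of the form e^{iθ}C_r,
with r the integer nearest to qb/a (`exists_rotated_cycle`).

K_m vanishes only if β - bm ∈ {-a, -2a, …} (`pathIntegral_full_ne_zero`). The exceptional integers
are exactly the numbers b m₀ - k a with m₀ < a and k ≥ 1, and m₀ is unique. For other parameters all
Gevrey solutions are reached. For an exceptional one, the coefficient of index m₀ vanishes for every
rapid decay cycle, and W is the hyperplane where it does. The corrected integral is a ray integral
plus an entire series regularizing the integral over [0, 1]; its coefficient of index m₀ is, up to a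
nonzero factor, Γ(k), so it spans a complement of W. -/

/-- A sequence of functions on `S₁ × (S₂ ∪ {0})` on which `∂₁` acts as the shift by `a` and `∂₂` as
the shift by `b`, with locally bounded members that are continuous at `x₂ = 0`. -/
structure ShiftFamily (a b : ℕ) (S₁ S₂ : Set ℂ) (F : ℕ → ℂ × ℂ → ℂ) : Prop where
  deriv_fst : ∀ k, ∀ z ∈ S₁, ∀ y ∈ insert 0 S₂,
    HasDerivAt (fun w => F k (w, y)) (F (k + a) (z, y)) z
  deriv_snd : ∀ k, ∀ z ∈ S₁, ∀ y ∈ S₂, HasDerivAt (fun w => F k (z, w)) (F (k + b) (z, y)) y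
  tendsto_zero : ∀ k, ∀ z ∈ S₁, Tendsto (fun y => F k (z, y)) (𝓝[S₂] 0) (𝓝 (F k (z, 0)))
  bounded : ∀ k, ∀ K ⊆ S₁, IsCompact K → ∀ R : ℝ, ∃ C : ℝ,
    ∀ z ∈ K, ∀ y ∈ insert 0 S₂, ‖y‖ ≤ R → ‖F k (z, y)‖ ≤ C

/-- The Euler equation with parameter `β - k` for the `k`-th member, for `k ∈ ℕ a + ℕ b`. -/
def EulerRelation (a b : ℕ) (β : ℂ) (S₁ S₂ : Set ℂ) (F : ℕ → ℂ × ℂ → ℂ) : Prop :=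
  ∀ i j : ℕ, ∀ z ∈ S₁, ∀ y ∈ insert 0 S₂,
    (a : ℂ) * z * F (a * i + b * j + a) (z, y) + (b : ℂ) * y * F (a * i + b * j + b) (z, y) =
      (β - (a * i + b * j : ℕ)) * F (a * i + b * j) (z, y)

section Linear

variable {a b : ℕ} {β : ℂ} {S₁ S₂ : Set ℂ} {F G : ℕ → ℂ × ℂ → ℂ}

theorem ShiftFamily.zero : ShiftFamily a b S₁ S₂ 0 where
  deriv_fst _ _ _ _ _ := hasDerivAt_const _ _
  deriv_snd _ _ _ _ _ := hasDerivAt_const _ _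
  tendsto_zero _ _ _ := tendsto_const_nhds
  bounded _ _ _ _ _ := ⟨0, fun _ _ _ _ _ => by simp⟩

theorem ShiftFamily.add (hF : ShiftFamily a b S₁ S₂ F) (hG : ShiftFamily a b S₁ S₂ G) :
    ShiftFamily a b S₁ S₂ (F + G) where
  deriv_fst k z hz y hy := (hF.deriv_fst k z hz y hy).add (hG.deriv_fst k z hz y hy)
  deriv_snd k z hz y hy := (hF.deriv_snd k z hz y hy).add (hG.deriv_snd k z hz y hy)
  tendsto_zero k z hz := (hF.tendsto_zero k z hz).add (hG.tendsto_zero k z hz)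
  bounded k K hK hc R := by
    obtain ⟨C, hC⟩ := hF.bounded k K hK hc R
    obtain ⟨D, hD⟩ := hG.bounded k K hK hc R
    exact ⟨C + D, fun z hz y hy hR =>
      (norm_add_le _ _).trans (add_le_add (hC z hz y hy hR) (hD z hz y hy hR))⟩

theorem ShiftFamily.smul (c : ℂ) (hF : ShiftFamily a b S₁ S₂ F) :
    ShiftFamily a b S₁ S₂ (c • F) where
  deriv_fst k z hz y hy := (hF.deriv_fst k z hz y hy).const_mul c
  deriv_snd k z hz y hy := (hF.deriv_snd k z hz y hy).const_mul c
  tendsto_zero k z hz := (hF.tendsto_zero k z hz).const_mul c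
  bounded k K hK hc R := by
    obtain ⟨C, hC⟩ := hF.bounded k K hK hc R
    refine ⟨‖c‖ * C, fun z hz y hy hR => ?_⟩
    simp only [Pi.smul_apply, smul_eq_mul, norm_mul]
    exact mul_le_mul_of_nonneg_left (hC z hz y hy hR) (norm_nonneg c)

theorem EulerRelation.zero : EulerRelation a b β S₁ S₂ 0 := fun _ _ _ _ _ _ => by simp

theorem EulerRelation.add (hF : EulerRelation a b β S₁ S₂ F) (hG : EulerRelation a b β S₁ S₂ G) :
    EulerRelation a b β S₁ S₂ (F + G) := fun i j z hz y hy => by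
  simp only [Pi.add_apply]
  linear_combination hF i j z hz y hy + hG i j z hz y hy

theorem EulerRelation.smul (c : ℂ) (hF : EulerRelation a b β S₁ S₂ F) :
    EulerRelation a b β S₁ S₂ (c • F) := fun i j z hz y hy => by
  simp only [Pi.smul_apply, smul_eq_mul]
  linear_combination c * hF i j z hz y hy

end Linear

/-! ### Holomorphic solutions and asymptotic expansions attached to a shift family. -/

section Solution

variable {a b : ℕ} {β : ℂ} {S₁ S₂ : Set ℂ} {F : ℕ → ℂ × ℂ → ℂ}

/-- The local bound on the `k + a`-th member makes `F k` Lipschitz in `x₁`, uniformly in `x₂`;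
together with continuity in `x₂` alone this gives joint continuity. Applied to the two partial
derivatives, it yields holomorphy in both variables. -/
theorem ShiftFamily.continuousAt (h : ShiftFamily a b S₁ S₂ F) (h₁ : IsOpen S₁) (h₂ : IsOpen S₂)
    (k : ℕ) {x : ℂ × ℂ} (hx : x ∈ S₁ ×ˢ S₂) : ContinuousAt (F k) x := by
  obtain ⟨z, y⟩ := x
  obtain ⟨hz, hy⟩ := hx
  obtain ⟨r, hr, hrS⟩ := Metric.nhds_basis_closedBall.mem_iff.1 (h₁.mem_nhds hz)
  obtain ⟨r', hr', hrS'⟩ := Metric.nhds_basis_closedBall.mem_iff.1 (h₂.mem_nhds hy)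
  obtain ⟨C, hC⟩ := h.bounded (k + a) _ hrS (isCompact_closedBall z r) (‖y‖ + r')
  have key : ∀ᶠ v : ℂ × ℂ in 𝓝 (z, y), ‖F k v - F k (z, y)‖ ≤
      C * ‖v.1 - z‖ + ‖F k (z, v.2) - F k (z, y)‖ := by
    filter_upwards [prod_mem_nhds (Metric.closedBall_mem_nhds z hr)
      (Metric.closedBall_mem_nhds y hr')] with v hv
    have hy' : v.2 ∈ insert 0 S₂ := mem_insert_of_mem _ (hrS' hv.2)
    have hn : ‖v.2‖ ≤ ‖y‖ + r' := by
      have := norm_sub_norm_le v.2 y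
      have h2 : ‖v.2 - y‖ ≤ r' := by simpa [dist_eq_norm] using hv.2
      linarith
    have := Convex.norm_image_sub_le_of_norm_hasDerivWithin_le (C := C)
      (fun w hw => (h.deriv_fst k w (hrS hw) v.2 hy').hasDerivWithinAt)
      (fun w hw => hC w hw v.2 hy' hn) (convex_closedBall z r)
      (Metric.mem_closedBall_self hr.le) hv.1
    calc ‖F k v - F k (z, y)‖ = ‖(F k v - F k (z, v.2)) + (F k (z, v.2) - F k (z, y))‖ := by
          congr 1; ring
      _ ≤ _ := (norm_add_le _ _).trans (add_le_add_left this _)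
  rw [ContinuousAt, tendsto_iff_norm_sub_tendsto_zero]
  refine squeeze_zero' (Eventually.of_forall fun _ => norm_nonneg _) key ?_
  have t1 : Tendsto (fun v : ℂ × ℂ => C * ‖v.1 - z‖) (𝓝 (z, y)) (𝓝 (C * ‖z - z‖)) :=
    (Continuous.tendsto (by fun_prop) (z, y))
  have t2 : Tendsto (fun v : ℂ × ℂ => ‖F k (z, v.2) - F k (z, y)‖) (𝓝 (z, y)) (𝓝 0) := by
    have := (h.deriv_snd k z hz y hy).continuousAt
    rw [← tendsto_iff_norm_sub_tendsto_zero]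
    exact this.tendsto.comp (continuous_snd.tendsto (z, y))
  simpa using t1.add t2

theorem ShiftFamily.differentiableAt (h : ShiftFamily a b S₁ S₂ F) (h₁ : IsOpen S₁)
    (h₂ : IsOpen S₂) (k : ℕ) {x : ℂ × ℂ} (hx : x ∈ S₁ ×ˢ S₂) :
    DifferentiableAt ℂ (F k) x := by
  have hU : ∀ᶠ v in 𝓝 x, v ∈ S₁ ×ˢ S₂ := (h₁.prod h₂).mem_nhds hx
  have := hasStrictFDerivAt_uncurry_coprod (𝕜 := ℂ) (u := x) (f := fun z y => F k (z, y))
    (f₁ := fun z y => ContinuousLinearMap.toSpanSingleton ℂ (F (k + a) (z, y)))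
    (f₂ := fun z y => ContinuousLinearMap.toSpanSingleton ℂ (F (k + b) (z, y)))
    (hU.mono fun v hv => (h.deriv_fst k v.1 hv.1 v.2 (mem_insert_of_mem _ hv.2)).hasFDerivAt)
    (hU.mono fun v hv => (h.deriv_snd k v.1 hv.1 v.2 hv.2).hasFDerivAt)
    ((ContinuousLinearMap.toSpanSingletonLE ℂ ℂ
      ℂ).toLinearMap.continuous_of_finiteDimensional.continuousAt.comp
      (h.continuousAt h₁ h₂ (k + a) hx))
    ((ContinuousLinearMap.toSpanSingletonLE ℂ ℂ
      ℂ).toLinearMap.continuous_of_finiteDimensional.continuousAt.comp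
      (h.continuousAt h₁ h₂ (k + b) hx))
  exact this.hasFDerivAt.differentiableAt

theorem ShiftFamily.partial₁_eqOn (h : ShiftFamily a b S₁ S₂ F) (h₁ : IsOpen S₁) {k : ℕ}
    {G : ℂ × ℂ → ℂ} (hG : EqOn G (F k) (S₁ ×ˢ S₂)) :
    EqOn (partial₁ G) (F (k + a)) (S₁ ×ˢ S₂) := by
  rintro ⟨z, y⟩ ⟨hz, hy⟩
  have e : (fun w => G (w, y)) =ᶠ[𝓝 z] fun w => F k (w, y) :=
    Filter.mem_of_superset (h₁.mem_nhds hz) fun w hw => hG ⟨hw, hy⟩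
  exact e.deriv_eq.trans (h.deriv_fst k z hz y (mem_insert_of_mem _ hy)).deriv

theorem ShiftFamily.partial₂_eqOn (h : ShiftFamily a b S₁ S₂ F) (h₂ : IsOpen S₂) {k : ℕ}
    {G : ℂ × ℂ → ℂ} (hG : EqOn G (F k) (S₁ ×ˢ S₂)) :
    EqOn (partial₂ G) (F (k + b)) (S₁ ×ˢ S₂) := by
  rintro ⟨z, y⟩ ⟨hz, hy⟩
  have e : (fun w => G (z, w)) =ᶠ[𝓝 y] fun w => F k (z, w) :=
    Filter.mem_of_superset (h₂.mem_nhds hy) fun w hw => hG ⟨hz, hw⟩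
  exact e.deriv_eq.trans (h.deriv_snd k z hz y hy).deriv

/-- The toric equations become trivial: a mixed derivative depends on the exponents only through `a
* i + b * j`. -/
theorem ShiftFamily.iterate_partial_eqOn (h : ShiftFamily a b S₁ S₂ F) (h₁ : IsOpen S₁)
    (h₂ : IsOpen S₂) {G : ℂ × ℂ → ℂ} (hG : EqOn G (F 0) (S₁ ×ˢ S₂)) (i j : ℕ) :
    EqOn (partial₁^[i] (partial₂^[j] G)) (F (a * i + b * j)) (S₁ ×ˢ S₂) := by
  have h2 : EqOn (partial₂^[j] G) (F (b * j)) (S₁ ×ˢ S₂) := by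
    induction j with
    | zero => simpa using hG
    | succ j ih =>
      rw [Function.iterate_succ_apply', mul_add, mul_one]
      exact h.partial₂_eqOn h₂ ih
  induction i with
  | zero => simpa using h2
  | succ i ih =>
    rw [Function.iterate_succ_apply', show a * (i + 1) + b * j = a * i + b * j + a by ring]
    exact h.partial₁_eqOn h₁ ih

theorem ShiftFamily.isHolomorphicSolution (h : ShiftFamily a b S₁ S₂ F)
    (hE : EulerRelation a b β S₁ S₂ F) (h₁ : IsOpen S₁) (h₂ : IsOpen S₂) {G : ℂ × ℂ → ℂ}
    (hG : EqOn G (F 0) (S₁ ×ˢ S₂)) : IsHolomorphicSolution a b β (S₁ ×ˢ S₂) G where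
  holomorphic x hx :=
    ((h.differentiableAt h₁ h₂ 0 hx).differentiableWithinAt).congr hG (hG hx)
  euler := by
    rintro ⟨z, y⟩ hx
    rw [h.partial₁_eqOn h₁ hG hx, h.partial₂_eqOn h₂ hG hx, hG hx]
    simpa using hE 0 0 z hx.1 y (mem_insert_of_mem _ hx.2)
  toric u v huv x hx := by
    rw [h.iterate_partial_eqOn h₁ h₂ hG _ _ hx, h.iterate_partial_eqOn h₁ h₂ hG _ _ hx, huv]

/-- The coefficients of the asymptotic expansion at `x₂ = 0` of the first member of a shift
family. -/
def taylorCoeff (b : ℕ) (F : ℕ → ℂ × ℂ → ℂ) (m : ℕ) (z : ℂ) : ℂ :=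
  F (b * m) (z, 0) / (m.factorial : ℂ)

/-- The remainder of order `N` of the asymptotic expansion of the `k`-th member of a shift
family. -/
def taylorRemainder (b : ℕ) (F : ℕ → ℂ × ℂ → ℂ) (k N : ℕ) (z y : ℂ) : ℂ :=
  F k (z, y) - ∑ m ∈ Finset.range N, F (k + b * m) (z, 0) / (m.factorial : ℂ) * y ^ m

theorem ShiftFamily.hasDerivAt_taylorRemainder (h : ShiftFamily a b S₁ S₂ F) (k N : ℕ) {z y : ℂ}
    (hz : z ∈ S₁) (hy : y ∈ S₂) :
    HasDerivAt (taylorRemainder b F k (N + 1) z) (taylorRemainder b F (k + b) N z y) y := by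
  have e : (fun w : ℂ => ∑ m ∈ Finset.range (N + 1),
      F (k + b * m) (z, 0) / (m.factorial : ℂ) * w ^ m) = fun w => F k (z, 0) +
      ∑ m ∈ Finset.range N, F (k + b * (m + 1)) (z, 0) / ((m + 1).factorial : ℂ) * w ^ (m + 1) := by
    funext w
    rw [Finset.sum_range_succ']
    simp [add_comm]
  have d : HasDerivAt (fun w : ℂ => ∑ m ∈ Finset.range (N + 1),
      F (k + b * m) (z, 0) / (m.factorial : ℂ) * w ^ m)
      (∑ m ∈ Finset.range N, F (k + b + b * m) (z, 0) / (m.factorial : ℂ) * y ^ m) y := by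
    rw [e]
    refine HasDerivAt.const_add _ (HasDerivAt.fun_sum fun m _ => ?_)
    have := (hasDerivAt_pow (m + 1) y).const_mul
      (F (k + b * (m + 1)) (z, 0) / ((m + 1).factorial : ℂ))
    refine this.congr_deriv ?_
    rw [show k + b * (m + 1) = k + b + b * m by ring, Nat.factorial_succ]
    have h1 : (m.factorial : ℂ) ≠ 0 := by exact_mod_cast m.factorial_ne_zero
    have h2 : ((m : ℂ) + 1) ≠ 0 := by exact_mod_cast m.succ_ne_zero
    push_cast
    field_simp
  exact (h.deriv_snd k z hz y hy).sub d

theorem ShiftFamily.tendsto_taylorRemainder (h : ShiftFamily a b S₁ S₂ F) (k N : ℕ) {z : ℂ}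
    (hz : z ∈ S₁) : Tendsto (taylorRemainder b F k (N + 1) z) (𝓝[S₂] 0) (𝓝 0) := by
  have t : Tendsto (fun w : ℂ => ∑ m ∈ Finset.range (N + 1),
      F (k + b * m) (z, 0) / (m.factorial : ℂ) * w ^ m) (𝓝[S₂] 0) (𝓝 (F k (z, 0))) := by
    have : Continuous (fun w : ℂ => ∑ m ∈ Finset.range (N + 1),
      F (k + b * m) (z, 0) / (m.factorial : ℂ) * w ^ m) := by fun_prop
    have t := (this.tendsto 0).mono_left (nhdsWithin_le_nhds (s := S₂))
    rw [Finset.sum_range_succ'] at t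
    simpa using t
  simpa [taylorRemainder] using! (h.tendsto_zero k z hz).sub t

/-- Induction on the order: the `x₂`-derivative of the remainder of order `N + 1` is the remainder
of order `N` of the member shifted by `b`, and the remainder tends to zero at the vertex. The
segment from the vertex to `y` stays in the cone `S₂`, so the mean value inequality applies. -/
theorem ShiftFamily.norm_taylorRemainder_le (h : ShiftFamily a b S₁ S₂ F)
    (hS : ∀ y ∈ S₂, ∀ t : ℝ, 0 < t → (t : ℂ) * y ∈ S₂) (N : ℕ) :
    ∀ k {z : ℂ}, z ∈ S₁ → ∀ {C R : ℝ}, 0 ≤ C →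
      (∀ y ∈ S₂, ‖y‖ ≤ R → ‖F (k + b * N) (z, y)‖ ≤ C) →
      ∀ y ∈ S₂, ‖y‖ ≤ R → ‖taylorRemainder b F k N z y‖ ≤ C * ‖y‖ ^ N := by
  induction N with
  | zero =>
    intro k z hz C R _ hC y hy hR
    simpa [taylorRemainder] using hC y hy hR
  | succ N ih =>
    intro k z hz C R hC0 hC y hy hR
    have ih' := ih (k + b) hz hC0 (R := R) (by
      intro y hy hR
      rw [show k + b + b * N = k + b * (N + 1) by ring]
      exact hC y hy hR)
    -- The vertex need not lie in `S₂`: the increment is estimated from `ε * y` to `y`, and then `ε`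
    -- tends to zero.
    have step : ∀ ε ∈ Ioc (0 : ℝ) 1, ‖taylorRemainder b F k (N + 1) z y -
        taylorRemainder b F k (N + 1) z (ε * y)‖ ≤ C * ‖y‖ ^ (N + 1) := by
      intro ε hε
      have := Convex.norm_image_sub_le_of_norm_hasDerivWithin_le (𝕜 := ℝ) (C := C * ‖y‖ ^ (N + 1))
        (f := fun t : ℝ => taylorRemainder b F k (N + 1) z (t * y)) (s := Ioc (0 : ℝ) 1)
        (f' := fun t : ℝ => taylorRemainder b F (k + b) N z (t * y) * y)
        (x := ε) (y := 1) (fun t ht => ?_) (fun t ht => ?_) (convex_Ioc 0 1) hε ⟨one_pos, le_rfl⟩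
      · simp only [Complex.ofReal_one, one_mul] at this
        refine this.trans ?_
        have h1 : ‖(1 : ℝ) - ε‖ ≤ 1 := by
          rw [Real.norm_eq_abs, abs_le]
          constructor <;> linarith [hε.1, hε.2]
        exact mul_le_of_le_one_right (by positivity) h1
      · have d := h.hasDerivAt_taylorRemainder k N hz (hS y hy t ht.1)
        have d2 : HasDerivAt (fun w : ℂ => w * y) y (t : ℂ) := by
          simpa using (hasDerivAt_id (t : ℂ)).mul_const y
        exact ((d.comp (t : ℂ) d2).comp_ofReal).hasDerivWithinAt
      · have hn : ‖(t : ℂ) * y‖ ≤ ‖y‖ := by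
          rw [norm_mul, Complex.norm_real, Real.norm_eq_abs, abs_of_pos ht.1]
          exact mul_le_of_le_one_left (norm_nonneg y) ht.2
        have := ih' _ (hS y hy t ht.1) (hn.trans hR)
        rw [norm_mul, pow_succ, ← mul_assoc]
        refine mul_le_mul_of_nonneg_right (this.trans ?_) (norm_nonneg y)
        gcongr
    have t0 : Tendsto (fun ε : ℝ => (ε : ℂ) * y) (𝓝[>] 0) (𝓝[S₂] 0) := by
      refine tendsto_nhdsWithin_iff.2 ⟨?_, ?_⟩
      · have : Continuous fun ε : ℝ => (ε : ℂ) * y := by fun_prop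
        simpa using (this.tendsto 0).mono_left nhdsWithin_le_nhds
      · filter_upwards [self_mem_nhdsWithin] with ε hε using hS y hy ε hε
    have t1 := (h.tendsto_taylorRemainder k N hz).comp t0
    have t2 := (tendsto_const_nhds (x := taylorRemainder b F k (N + 1) z y)).sub t1
    rw [sub_zero] at t2
    refine le_of_tendsto t2.norm ?_
    filter_upwards [Ioc_mem_nhdsGT (zero_lt_one' ℝ)] with ε hε using step ε hε

theorem ShiftFamily.hasAsymptoticExpansion (h : ShiftFamily a b S₁ S₂ F)
    (hS : ∀ y ∈ S₂, ∀ t : ℝ, 0 < t → (t : ℂ) * y ∈ S₂) {G : ℂ × ℂ → ℂ}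
    (hG : EqOn G (F 0) (S₁ ×ˢ S₂)) : HasAsymptoticExpansion S₁ S₂ G (taylorCoeff b F) where
  holomorphic k z hz := ((h.deriv_fst (b * k) z hz 0 (mem_insert 0 S₂)).div_const
    _).differentiableAt.differentiableWithinAt
  remainder K hK hc N := by
    obtain ⟨C, hC⟩ := h.bounded (0 + b * N) K hK hc 1
    refine ⟨max C 0, 1, one_pos, fun z hz y hy hlt => ?_⟩
    have := h.norm_taylorRemainder_le hS N 0 (hK hz) (C := max C 0) (R := 1) (le_max_right _ _)
      (fun y hy hR => (hC z hz y (mem_insert_of_mem _ hy) hR).trans (le_max_left _ _)) y hy hlt.le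
    rw [hG ⟨hK hz, hy⟩]
    simpa [taylorRemainder, taylorCoeff] using this

theorem ShiftFamily.iteratedDeriv_taylorCoeff (h : ShiftFamily a b S₁ S₂ F) (h₁ : IsOpen S₁)
    (m i : ℕ) : ∀ z ∈ S₁, iteratedDeriv i (taylorCoeff b F m) z =
      F (b * m + a * i) (z, 0) / (m.factorial : ℂ) := by
  induction i with
  | zero => intro z _; simp [taylorCoeff]
  | succ i ih =>
    intro z hz
    rw [iteratedDeriv_succ]
    have e : iteratedDeriv i (taylorCoeff b F m) =ᶠ[𝓝 z]
        fun w => F (b * m + a * i) (w, 0) / (m.factorial : ℂ) :=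
      Filter.mem_of_superset (h₁.mem_nhds hz) fun w hw => ih w hw
    rw [e.deriv_eq, show b * m + a * (i + 1) = b * m + a * i + a by ring]
    exact ((h.deriv_fst _ z hz 0 (mem_insert 0 S₂)).div_const _).deriv

/-- The formal operators act on the expansion by the same index shift as the true derivatives, so
the expansion inherits the toric equations. -/
theorem ShiftFamily.formalPartial_taylorCoeff (h : ShiftFamily a b S₁ S₂ F) (h₁ : IsOpen S₁)
    (u : ℕ × ℕ) (m : ℕ) {z : ℂ} (hz : z ∈ S₁) : formalPartial u (taylorCoeff b F) m z =
      F (b * m + (a * u.1 + b * u.2)) (z, 0) / (m.factorial : ℂ) := by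
  rw [formalPartial, h.iteratedDeriv_taylorCoeff h₁ _ _ z hz,
    show b * (m + u.2) + a * u.1 = b * m + (a * u.1 + b * u.2) by ring]
  have h1 : (m.factorial : ℂ) ≠ 0 := by exact_mod_cast m.factorial_ne_zero
  have h2 : ((m + u.2).factorial : ℂ) ≠ 0 := by exact_mod_cast (m + u.2).factorial_ne_zero
  have h3 := Nat.factorial_mul_descFactorial (Nat.le_add_left u.2 m)
  rw [Nat.add_sub_cancel] at h3
  have h4 : (m.factorial : ℂ) * ((m + u.2).descFactorial u.2 : ℂ) = ((m + u.2).factorial : ℂ) := by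
    exact_mod_cast h3
  rw [← mul_div_assoc, div_eq_div_iff h2 h1, ← h4]
  ring

/-- Asymptotic expansions are unique. -/
theorem HasAsymptoticExpansion.unique {G : ℂ × ℂ → ℂ} {c d : ℕ → ℂ → ℂ}
    (hS : ∀ y ∈ S₂, ∀ t : ℝ, 0 < t → (t : ℂ) * y ∈ S₂) {y₀ : ℂ} (hy₀ : y₀ ∈ S₂) (hy₀' : y₀ ≠ 0)
    (hc : HasAsymptoticExpansion S₁ S₂ G c) (hd : HasAsymptoticExpansion S₁ S₂ G d) {z : ℂ}
    (hz : z ∈ S₁) (m : ℕ) : c m z = d m z := by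
  induction m using Nat.strong_induction_on with
  | _ m ih =>
    obtain ⟨C, r, hr, hC⟩ := hc.remainder {z} (by simpa using hz) isCompact_singleton (m + 1)
    obtain ⟨D, r', hr', hD⟩ := hd.remainder {z} (by simpa using hz) isCompact_singleton (m + 1)
    have t0 : Tendsto (fun ε : ℝ => (C + D) * ‖(ε : ℂ) * y₀‖) (𝓝[>] 0) (𝓝 0) := by
      have : Continuous fun ε : ℝ => (C + D) * ‖(ε : ℂ) * y₀‖ := by fun_prop
      simpa using (this.tendsto 0).mono_left (nhdsWithin_le_nhds (s := Ioi (0 : ℝ)))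
    have t1 : Tendsto (fun ε : ℝ => ‖(ε : ℂ) * y₀‖) (𝓝[>] 0) (𝓝 0) := by
      have : Continuous fun ε : ℝ => ‖(ε : ℂ) * y₀‖ := by fun_prop
      simpa using (this.tendsto 0).mono_left (nhdsWithin_le_nhds (s := Ioi (0 : ℝ)))
    have : ‖c m z - d m z‖ ≤ 0 := by
      refine ge_of_tendsto t0 ?_
      filter_upwards [self_mem_nhdsWithin, t1.eventually_lt_const hr, t1.eventually_lt_const hr']
        with ε hε h1 h2
      have hy := hS y₀ hy₀ ε hε
      set y := (ε : ℂ) * y₀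
      have hy0 : 0 < ‖y‖ := norm_pos_iff.2 (mul_ne_zero (by exact_mod_cast ne_of_gt hε) hy₀')
      have e1 := hC z rfl y hy h1
      have e2 := hD z rfl y hy h2
      rw [Finset.sum_range_succ] at e1 e2
      rw [Finset.sum_congr rfl fun k hk => by rw [ih k (Finset.mem_range.1 hk)]] at e1
      have e3 := norm_sub_le_of_le e2 e1
      have e4 : ‖c m z - d m z‖ * ‖y‖ ^ m ≤ ((C + D) * ‖y‖) * ‖y‖ ^ m := by
        rw [← norm_pow, ← norm_mul]
        convert e3 using 1
        · congr 1; ring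
        · rw [norm_pow]; ring
      exact le_of_mul_le_mul_right e4 (pow_pos hy0 m)
    simpa [sub_eq_zero] using this

end Solution

/-! ### The germs of Gevrey solutions -/

/-- The solutions of `a z f' = c f` are multiples of a power of `z`. -/
theorem eq_mul_cpow_of_euler {a : ℕ} (ha : a ≠ 0) {c p : ℂ} {U : Set ℂ} (hU : IsOpen U)
    (hU' : IsPreconnected U) (hp : p ∈ U) (hp0 : p ≠ 0)
    (hs : ∀ z ∈ U, z / p ∈ Complex.slitPlane) {f : ℂ → ℂ}
    (hf : ∀ z ∈ U, DifferentiableAt ℂ f z) (he : ∀ z ∈ U, (a : ℂ) * z * deriv f z = c * f z) :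
    ∀ z ∈ U, f z = f p * (z / p) ^ (c / a) := by
  have ha' : (a : ℂ) ≠ 0 := by exact_mod_cast ha
  -- Dividing by the expected power gives a function of zero derivative. The power is taken of `z /
  -- p`, which equals 1 at the base point and avoids the branch cut.
  have d : ∀ z ∈ U, HasDerivAt (fun z => f z * (z / p) ^ (-(c / a))) 0 z := by
    intro z hz
    have hz0 : z / p ≠ 0 := Complex.slitPlane_ne_zero (hs z hz)
    have hz0' : z ≠ 0 := fun h => hz0 (by simp [h])
    have h1 := ((hasDerivAt_id z).div_const p).cpow_const (c := -(c / a)) (hs z hz)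
    refine ((hf z hz).hasDerivAt.mul h1).congr_deriv ?_
    simp only [id]
    rw [Complex.cpow_sub _ _ hz0, Complex.cpow_one]
    have h2 : deriv f z = c * f z / (a * z) := by
      rw [eq_div_iff (mul_ne_zero ha' hz0'), ← he z hz]; ring
    rw [h2]
    field_simp
    ring
  intro z hz
  have hz0 : z / p ≠ 0 := Complex.slitPlane_ne_zero (hs z hz)
  have := hU.is_const_of_deriv_eq_zero hU'
    (fun w hw => (d w hw).differentiableAt.differentiableWithinAt)
    (fun w hw => (d w hw).deriv) hz hp
  simp only [div_self hp0, Complex.one_cpow, inv_one, mul_one, Complex.cpow_neg] at this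
  have hne : (z / p) ^ (c / a) ≠ 0 := by simp [Complex.cpow_eq_zero_iff, hz0]
  rw [← this, mul_assoc, inv_mul_cancel₀ hne, mul_one]

/-- One ball serves for all `m` at once; this uniformity is needed to sum the Gevrey series near
`(p, 0)`. -/
theorem eventually_eq_mul_cpow {a b : ℕ} (ha : a ≠ 0) {β p : ℂ} (hp0 : p ≠ 0) {f : ℕ → ℂ → ℂ}
    (hf : ∀ᶠ z in 𝓝 p, ∀ m, DifferentiableAt ℂ (f m) z)
    (he : ∀ᶠ z in 𝓝 p, ∀ m : ℕ, (a : ℂ) * z * deriv (f m) z + (b : ℂ) * (m : ℂ) * f m z =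
      β * f m z) :
    ∀ᶠ z in 𝓝 p, ∀ m : ℕ, f m z = f m p * (z / p) ^ ((β - b * m) / a) := by
  have hs : ∀ᶠ z in 𝓝 p, z / p ∈ Complex.slitPlane := by
    have : ContinuousAt (fun z => z / p) p := by fun_prop
    refine this.eventually_mem (Complex.isOpen_slitPlane.mem_nhds ?_)
    simp [div_self hp0]
  obtain ⟨ε, hε, h⟩ := Metric.eventually_nhds_iff_ball.1 (hs.and (hf.and he))
  filter_upwards [Metric.ball_mem_nhds p hε] with z hz m
  refine eq_mul_cpow_of_euler ha Metric.isOpen_ball (convex_ball p ε).isPreconnected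
    (Metric.mem_ball_self hε) hp0 (fun w hw => (h w hw).1) (fun w hw => (h w hw).2.1 m)
    (fun w hw => ?_) z hz
  linear_combination (h w hw).2.2 m

/-- A Gevrey solution is determined by the values at `p` of its first `a` coefficients. -/
theorem eq_of_value_eq {a b : ℕ} (ha : a ≠ 0) {β : ℂ} {s : ℝ} {p : ℂ} (hp0 : p ≠ 0)
    {φ ψ : ℕ → Germ (𝓝 p) ℂ} (hφ : φ ∈ gevreySolutions a b β s p)
    (hψ : ψ ∈ gevreySolutions a b β s p) (h : ∀ m < a, (φ m).value = (ψ m).value) : φ = ψ := by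
  obtain ⟨f, rfl, hf⟩ := hφ
  obtain ⟨g, rfl, hg⟩ := hψ
  have h' : ∀ m < a, f m p = g m p := h
  have key : ∀ m, f m =ᶠ[𝓝 p] g m := by
    intro m
    induction m using Nat.strong_induction_on with
    | _ m ih =>
      rcases lt_or_ge m a with hm | hm
      · filter_upwards [eventually_eq_mul_cpow ha hp0 hf.holomorphic hf.euler,
          eventually_eq_mul_cpow ha hp0 hg.holomorphic hg.euler] with z h1 h2
        rw [h1, h2, h' m hm]
      · obtain ⟨k, rfl⟩ := Nat.exists_eq_add_of_le' hm
        filter_upwards [hf.toric, hg.toric, (ih k (by omega)).eventuallyEq_nhds] with z h1 h2 h3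
        -- The toric equation ∂₂^a = ∂₁^b gives `f (k + a)` as the `b`-th derivative of `f k`, up to
        -- the nonzero factor (k + a)! / k!.
        have e1 := h1 (0, a) (b, 0) (by ring) k
        have e2 := h2 (0, a) (b, 0) (by ring) k
        simp only [formalPartial, iteratedDeriv_zero, Nat.descFactorial_zero, add_zero] at e1 e2
        rw [h3.iteratedDeriv_eq, ← e2] at e1
        refine mul_left_cancel₀ ?_ e1
        rw [Nat.cast_ne_zero, Ne, Nat.descFactorial_eq_zero_iff_lt]
        omega
  funext m
  exact Germ.coe_eq.2 (key m)

/-- Raising (k + 1)^a k! ≤ (k + a)! to the power b/a shows that each step of length `a` multiplies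
(k!)^(b/a) by at least (k + 1)^b. The constant `D ^ b` is absorbed by the geometric factor. -/
theorem factorial_rpow_growth {a b : ℕ} (ha : a ≠ 0) {v : ℕ → ℂ} {D : ℝ} (hD : 0 ≤ D)
    (h : ∀ m : ℕ, ‖v (m + a)‖ ≤ (D * (m + 1)) ^ b * ‖v m‖) :
    ∃ C E : ℝ, 0 ≤ C ∧ 1 ≤ E ∧ ∀ m : ℕ, ‖v m‖ ≤ C * E ^ m * (m.factorial : ℝ) ^ ((b : ℝ) / a) := by
  refine ⟨∑ k ∈ Finset.range a, ‖v k‖, max 1 (D ^ b), Finset.sum_nonneg fun _ _ => norm_nonneg _,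
    le_max_left _ _, fun m => ?_⟩
  set C := ∑ k ∈ Finset.range a, ‖v k‖
  set E := max 1 (D ^ b)
  have hC : 0 ≤ C := Finset.sum_nonneg fun _ _ => norm_nonneg _
  have hE : 1 ≤ E := le_max_left _ _
  have hba : (0 : ℝ) ≤ (b : ℝ) / a := by positivity
  induction m using Nat.strong_induction_on with
  | _ m ih =>
    rcases lt_or_ge m a with hm | hm
    · have h1 : ‖v m‖ ≤ C := Finset.single_le_sum (f := fun k => ‖v k‖)
        (fun _ _ => norm_nonneg _) (Finset.mem_range.2 hm)
      have h2 : 1 ≤ (m.factorial : ℝ) ^ ((b : ℝ) / a) :=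
        Real.one_le_rpow (by exact_mod_cast m.factorial_pos) hba
      calc ‖v m‖ ≤ C * 1 * 1 := by simpa using h1
        _ ≤ _ := by gcongr; exact one_le_pow₀ hE
    · obtain ⟨k, rfl⟩ := Nat.exists_eq_add_of_le' hm
      have h1 : ((k : ℝ) + 1) ^ b * (k.factorial : ℝ) ^ ((b : ℝ) / a) ≤
          ((k + a).factorial : ℝ) ^ ((b : ℝ) / a) := by
        have e : ((k : ℝ) + 1) ^ b = (((k : ℝ) + 1) ^ a) ^ ((b : ℝ) / a) := by
          rw [← Real.rpow_natCast, ← Real.rpow_natCast, ← Real.rpow_mul (by positivity)]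
          congr 1
          field_simp
        rw [e, ← Real.mul_rpow (by positivity) (by positivity)]
        refine Real.rpow_le_rpow (by positivity) ?_ hba
        rw [mul_comm]
        exact_mod_cast Nat.factorial_mul_pow_le_factorial
      have h2 : D ^ b ≤ E ^ a := (le_max_right 1 _).trans (le_self_pow₀ hE ha)
      calc ‖v (k + a)‖ ≤ (D * (k + 1)) ^ b * (C * E ^ k * (k.factorial : ℝ) ^ ((b : ℝ) / a)) :=
            (h k).trans (mul_le_mul_of_nonneg_left (ih k (by omega)) (by positivity))
        _ = C * (E ^ k * D ^ b) * (((k : ℝ) + 1) ^ b * (k.factorial : ℝ) ^ ((b : ℝ) / a)) := by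
            rw [mul_pow]; ring
        _ ≤ C * (E ^ k * E ^ a) * ((k + a).factorial : ℝ) ^ ((b : ℝ) / a) := by gcongr
        _ = _ := by rw [pow_add]

/-- At x₂ = 0 the Euler equation is a first order recursion with step `a`. Since b(m + a) = bm + ab,
it takes `b` of these steps, each costing a factor at most `D * (m + 1)`. -/
theorem ShiftFamily.norm_shift_le {a b : ℕ} (ha : a ≠ 0) {β : ℂ} {S₁ S₂ : Set ℂ}
    {F : ℕ → ℂ × ℂ → ℂ} (hE : EulerRelation a b β S₁ S₂ F) {p : ℂ} (hp : p ∈ S₁) (hp0 : p ≠ 0) :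
    ∃ D : ℝ, 0 ≤ D ∧ ∀ m : ℕ,
      ‖F (b * (m + a)) (p, 0)‖ ≤ (D * (m + 1)) ^ b * ‖F (b * m) (p, 0)‖ := by
  have hap : 0 < ‖(a : ℂ) * p‖ := norm_pos_iff.2 (mul_ne_zero (by exact_mod_cast ha) hp0)
  refine ⟨(‖β‖ + a * b + b) / ‖(a : ℂ) * p‖, by positivity, fun m => ?_⟩
  set D := (‖β‖ + a * b + b) / ‖(a : ℂ) * p‖
  have key : ∀ j ≤ b, ‖F (a * j + b * m) (p, 0)‖ ≤ (D * (m + 1)) ^ j * ‖F (b * m) (p, 0)‖ := by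
    intro j
    induction j with
    | zero => intro _; simp
    | succ j ih =>
      intro hj
      have e := hE j m p hp 0 (mem_insert 0 S₂)
      rw [mul_zero, zero_mul, add_zero] at e
      have e' : ‖(a : ℂ) * p‖ * ‖F (a * j + b * m + a) (p, 0)‖ =
          ‖β - (a * j + b * m : ℕ)‖ * ‖F (a * j + b * m) (p, 0)‖ := by
        rw [← norm_mul, ← norm_mul, e]
      have hn : ‖β - (a * j + b * m : ℕ)‖ ≤ (‖β‖ + a * b + b) * (m + 1) := by
        refine (norm_sub_le _ _).trans ?_
        rw [Complex.norm_natCast]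
        push_cast
        have h1 : (j : ℝ) ≤ b := by exact_mod_cast (Nat.le_of_succ_le hj)
        have h2 : (a : ℝ) * j ≤ a * b := by gcongr
        have h3 : 0 ≤ (‖β‖ + a * b) * m := by positivity
        have h4 : (0 : ℝ) ≤ b := by positivity
        nlinarith
      rw [show a * (j + 1) + b * m = a * j + b * m + a by ring]
      calc ‖F (a * j + b * m + a) (p, 0)‖
          = ‖β - (a * j + b * m : ℕ)‖ * ‖F (a * j + b * m) (p, 0)‖ / ‖(a : ℂ) * p‖ := by
            rw [← e']; field_simp
        _ ≤ ((‖β‖ + a * b + b) * (m + 1)) * ((D * (m + 1)) ^ j * ‖F (b * m) (p, 0)‖) /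
            ‖(a : ℂ) * p‖ := by
            gcongr
            exact ih (Nat.le_of_succ_le hj)
        _ = _ := by simp only [D]; ring
  have := key b le_rfl
  rwa [show a * b + b * m = b * (m + a) by ring] at this

/-- A sequence with controlled growth, together with the homogeneity of the coefficients, gives a
germ of Gevrey series. -/
theorem exists_gevrey_sum {a b : ℕ} {β : ℂ} {s : ℝ} {p : ℂ} (hp0 : p ≠ 0) {f : ℕ → ℂ → ℂ}
    (hf : ∀ᶠ z in 𝓝 p, ∀ m : ℕ, f m z = f m p * (z / p) ^ ((β - b * m) / a)) {C E : ℝ}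
    (hE : 1 ≤ E) (hC : ∀ m, ‖f m p‖ ≤ C * E ^ m * (m.factorial : ℝ) ^ (s - 1)) :
    ∃ g : ℂ × ℂ → ℂ, AnalyticAt ℂ g (p, 0) ∧ ∀ᶠ x in 𝓝 ((p, 0) : ℂ × ℂ),
      HasSum (fun m : ℕ => f m x.1 / (((m.factorial : ℝ) ^ (s - 1) : ℝ) : ℂ) * x.2 ^ m) (g x) := by
  set c : ℕ → ℂ := fun m => f m p / (((m.factorial : ℝ) ^ (s - 1) : ℝ) : ℂ)
  have hc : ∀ m, ‖c m‖ ≤ C * E ^ m := by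
    intro m
    have h0 : 0 < (m.factorial : ℝ) ^ (s - 1) := by positivity
    rw [norm_div, Complex.norm_real, Real.norm_eq_abs, abs_of_pos h0, div_le_iff₀ h0]
    exact hC m
  have hE0 : 0 < E := by linarith
  set r : ℝ := (2 * E)⁻¹
  have hr : 0 < r := by positivity
  have hbd : ∀ m, ∀ w ∈ Metric.ball (0 : ℂ) r, ‖c m * w ^ m‖ ≤ C * (1 / 2) ^ m := by
    intro m w hw
    have hw' : ‖w‖ ≤ (2 * E)⁻¹ := (mem_ball_zero_iff.1 hw).le
    have hCE : 0 ≤ C * E ^ m := (norm_nonneg _).trans (hc m)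
    rw [norm_mul, norm_pow]
    calc ‖c m‖ * ‖w‖ ^ m ≤ (C * E ^ m) * ((2 * E)⁻¹) ^ m := by gcongr; exact hc m
      _ = C * (1 / 2) ^ m := by
        rw [mul_assoc, ← mul_pow]; congr 2; field_simp
  have hsum : Summable fun m : ℕ => C * (1 / 2 : ℝ) ^ m :=
    (summable_geometric_two).mul_left C
  have hdiff : DifferentiableOn ℂ (fun w => ∑' m, c m * w ^ m) (Metric.ball 0 r) :=
    Complex.differentiableOn_tsum_of_summable_norm hsum
      (fun m => by fun_prop) Metric.isOpen_ball hbd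
  have han : AnalyticAt ℂ (fun w => ∑' m, c m * w ^ m) 0 :=
    hdiff.analyticAt (Metric.ball_mem_nhds 0 hr)
  have hslit : (p / p) ∈ Complex.slitPlane := by simp [div_self hp0]
  have hfst : AnalyticAt ℂ (fun x : ℂ × ℂ => x.1 / p) (p, 0) :=
    analyticAt_fst.div analyticAt_const hp0
  have hpow : ∀ e : ℂ, AnalyticAt ℂ (fun x : ℂ × ℂ => (x.1 / p) ^ e) (p, 0) := fun e =>
    hfst.cpow analyticAt_const hslit
  have hin : AnalyticAt ℂ (fun x : ℂ × ℂ => (x.1 / p) ^ (-(b : ℂ) / a) * x.2) (p, 0) :=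
    (hpow _).mul analyticAt_snd
  have h0 : (((p, 0) : ℂ × ℂ).1 / p) ^ (-(b : ℂ) / a) * ((p, 0) : ℂ × ℂ).2 = 0 := by simp
  -- By homogeneity the two-variable series is a prefactor in `x₁` times a one-variable power series
  -- evaluated at (x₁/p)^(-b/a) x₂.
  refine ⟨fun x => (x.1 / p) ^ (β / a) * ∑' m, c m * ((x.1 / p) ^ (-(b : ℂ) / a) * x.2) ^ m,
    (hpow _).mul (AnalyticAt.fun_comp (g := fun w => ∑' m, c m * w ^ m) (by rwa [h0]) hin), ?_⟩
  have hball : ∀ᶠ x in 𝓝 ((p, 0) : ℂ × ℂ),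
      (x.1 / p) ^ (-(b : ℂ) / a) * x.2 ∈ Metric.ball (0 : ℂ) r :=
    hin.continuousAt.eventually_mem (by rw [h0]; exact Metric.ball_mem_nhds 0 hr)
  have hne : ∀ᶠ x in 𝓝 ((p, 0) : ℂ × ℂ), x.1 / p ≠ 0 :=
    hfst.continuousAt.eventually_ne (by simp [div_self hp0])
  filter_upwards [hball, hne, (continuous_fst.tendsto ((p, 0) : ℂ × ℂ)).eventually hf]
    with x hx hx0 hfx
  have hs : Summable fun m => c m * ((x.1 / p) ^ (-(b : ℂ) / a) * x.2) ^ m :=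
    Summable.of_norm_bounded hsum fun m => hbd m _ hx
  refine (hs.hasSum.mul_left ((x.1 / p) ^ (β / a))).congr_fun ?_
  intro m
  rw [hfx m, show (β - b * m) / a = β / a + m * (-(b : ℂ) / a) by ring,
    Complex.cpow_add _ _ hx0, Complex.cpow_nat_mul, mul_pow]
  ring

/-- The order comes from the equations alone: F_{bm}(p, 0) grows like (m!)^(b/a), up to a geometric
factor, and dividing by m! leaves the exponent b/a - 1 ≤ s - 1. -/
theorem ShiftFamily.taylorCoeff_isGevreySolution {a b : ℕ} (ha : a ≠ 0) {β : ℂ} {S₁ S₂ : Set ℂ}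
    {F : ℕ → ℂ × ℂ → ℂ} (h : ShiftFamily a b S₁ S₂ F) (hE : EulerRelation a b β S₁ S₂ F)
    (h₁ : IsOpen S₁) {p : ℂ} (hp : p ∈ S₁) (hp0 : p ≠ 0) {s : ℝ} (hs : (b : ℝ) / a ≤ s) :
    IsGevreySolution a b β s p (taylorCoeff b F) := by
  have hS : ∀ᶠ z in 𝓝 p, z ∈ S₁ := h₁.mem_nhds hp
  have hd : ∀ z ∈ S₁, ∀ m, HasDerivAt (taylorCoeff b F m)
      (F (b * m + a) (z, 0) / (m.factorial : ℂ)) z := fun z hz m =>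
    (h.deriv_fst _ z hz 0 (mem_insert 0 S₂)).div_const _
  have hol : ∀ᶠ z in 𝓝 p, ∀ m, DifferentiableAt ℂ (taylorCoeff b F m) z :=
    hS.mono fun z hz m => (hd z hz m).differentiableAt
  have eul : ∀ᶠ z in 𝓝 p, ∀ m : ℕ, (a : ℂ) * z * deriv (taylorCoeff b F m) z +
      (b : ℂ) * (m : ℂ) * taylorCoeff b F m z = β * taylorCoeff b F m z := by
    filter_upwards [hS] with z hz m
    rw [(hd z hz m).deriv, taylorCoeff]
    have e := hE 0 m z hz 0 (mem_insert 0 S₂)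
    simp only [mul_zero, zero_add, zero_mul, add_zero, Nat.cast_mul] at e
    linear_combination e / (m.factorial : ℂ)
  refine ⟨hol, ?_, eul, ?_⟩
  · obtain ⟨D, hD, hD'⟩ := ShiftFamily.norm_shift_le ha hE hp hp0
    obtain ⟨C, E, hC, hE1, hCE⟩ := factorial_rpow_growth ha (v := fun m => F (b * m) (p, 0)) hD hD'
    refine exists_gevrey_sum (C := C) hp0 (eventually_eq_mul_cpow ha hp0 hol eul) hE1 fun m => ?_
    have hm : (1 : ℝ) ≤ m.factorial := by exact_mod_cast m.factorial_pos
    have hm0 : (0 : ℝ) < m.factorial := by linarith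
    rw [taylorCoeff, norm_div, Complex.norm_natCast, div_le_iff₀ hm0]
    refine (hCE m).trans ?_
    rw [mul_assoc _ ((m.factorial : ℝ) ^ (s - 1)), Real.rpow_sub_one hm0.ne',
      div_mul_cancel₀ _ hm0.ne']
    have := Real.rpow_le_rpow_of_exponent_le hm hs
    gcongr
  · filter_upwards [hS] with z hz u v huv m
    rw [h.formalPartial_taylorCoeff h₁ u m hz, h.formalPartial_taylorCoeff h₁ v m hz, huv]

/-! ### Exponential integrals -/

section Integral

open MeasureTheory

theorem aestronglyMeasurable_expIntegrand {α : Type*} [MeasurableSpace α] {μ : Measure α}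
    {g τ : α → ℂ} (hg : AEStronglyMeasurable g μ) (hτ : AEStronglyMeasurable τ μ) (a b k : ℕ)
    (z y : ℂ) : AEStronglyMeasurable
      (fun r => g r * τ r ^ k * Complex.exp (z * τ r ^ a + y * τ r ^ b)) μ :=
  (hg.mul (hτ.pow k)).mul (Complex.continuous_exp.comp_aestronglyMeasurable
    (((hτ.pow a).const_mul z).add ((hτ.pow b).const_mul y)))

/-- Integrals `∫ g τ ^ k exp (x₁ τ ^ a + x₂ τ ^ b)` form a shift family, as soon as they are locally
dominated. -/
theorem shiftFamily_integral {α : Type*} [MeasurableSpace α] {μ : Measure α} {g τ : α → ℂ}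
    (hg : AEStronglyMeasurable g μ) (hτ : AEStronglyMeasurable τ μ) {a b : ℕ} {S₁ S₂ : Set ℂ}
    (h₁ : IsOpen S₁) (h₂ : IsOpen S₂)
    (H : ∀ k : ℕ, ∀ K ⊆ S₁, IsCompact K → ∀ R : ℝ, ∃ bound : α → ℝ, Integrable bound μ ∧
      ∀ᵐ r ∂μ, ∀ z ∈ K, ∀ y ∈ insert 0 S₂, ‖y‖ ≤ R →
        ‖g r * τ r ^ k * Complex.exp (z * τ r ^ a + y * τ r ^ b)‖ ≤ bound r) :
    ShiftFamily a b S₁ S₂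
      (fun k x => ∫ r, g r * τ r ^ k * Complex.exp (x.1 * τ r ^ a + x.2 * τ r ^ b) ∂μ) where
  deriv_fst k z hz y hy := by
    obtain ⟨ρ, hρ, hρS⟩ := Metric.nhds_basis_closedBall.mem_iff.1 (h₁.mem_nhds hz)
    obtain ⟨B₀, hB₀, hb₀⟩ := H k {z} (by simpa using hz) isCompact_singleton ‖y‖
    obtain ⟨B, hB, hb⟩ := H (k + a) _ hρS (isCompact_closedBall z ρ) ‖y‖
    refine (hasDerivAt_integral_of_dominated_loc_of_deriv_le (bound := B)
      (F := fun w r => g r * τ r ^ k * Complex.exp (w * τ r ^ a + y * τ r ^ b))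
      (F' := fun w r => g r * τ r ^ (k + a) * Complex.exp (w * τ r ^ a + y * τ r ^ b))
      (Metric.closedBall_mem_nhds z hρ)
      (Eventually.of_forall fun w => aestronglyMeasurable_expIntegrand hg hτ a b k w y)
      (hB₀.mono' (aestronglyMeasurable_expIntegrand hg hτ a b k z y)
        (hb₀.mono fun r hr => hr z rfl y hy le_rfl))
      (aestronglyMeasurable_expIntegrand hg hτ a b _ z y)
      (hb.mono fun r hr w hw => hr w hw y hy le_rfl) hB
      (Eventually.of_forall fun r w _ => ?_)).2
    have d : HasDerivAt (fun w => w * τ r ^ a + y * τ r ^ b) (τ r ^ a) w := by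
      simpa using ((hasDerivAt_id w).mul_const (τ r ^ a)).add_const (y * τ r ^ b)
    refine (d.cexp.const_mul (g r * τ r ^ k)).congr_deriv ?_
    ring
  deriv_snd k z hz y hy := by
    obtain ⟨ρ, hρ, hρS⟩ := Metric.nhds_basis_closedBall.mem_iff.1 (h₂.mem_nhds hy)
    obtain ⟨B₀, hB₀, hb₀⟩ := H k {z} (by simpa using hz) isCompact_singleton ‖y‖
    obtain ⟨B, hB, hb⟩ := H (k + b) {z} (by simpa using hz) isCompact_singleton (‖y‖ + ρ)
    refine (hasDerivAt_integral_of_dominated_loc_of_deriv_le (bound := B)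
      (F := fun w r => g r * τ r ^ k * Complex.exp (z * τ r ^ a + w * τ r ^ b))
      (F' := fun w r => g r * τ r ^ (k + b) * Complex.exp (z * τ r ^ a + w * τ r ^ b))
      (Metric.closedBall_mem_nhds y hρ)
      (Eventually.of_forall fun w => aestronglyMeasurable_expIntegrand hg hτ a b k z w)
      (hB₀.mono' (aestronglyMeasurable_expIntegrand hg hτ a b k z y)
        (hb₀.mono fun r hr => hr z rfl y (mem_insert_of_mem _ hy) le_rfl))
      (aestronglyMeasurable_expIntegrand hg hτ a b _ z y)
      (hb.mono fun r hr w hw => hr z rfl w (mem_insert_of_mem _ (hρS hw)) ?_) hB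
      (Eventually.of_forall fun r w _ => ?_)).2
    · have h1 := norm_sub_norm_le w y
      have h2 : ‖w - y‖ ≤ ρ := by simpa [dist_eq_norm] using hw
      linarith
    have d : HasDerivAt (fun w => z * τ r ^ a + w * τ r ^ b) (τ r ^ b) w := by
      simpa using ((hasDerivAt_id w).mul_const (τ r ^ b)).const_add (z * τ r ^ a)
    refine (d.cexp.const_mul (g r * τ r ^ k)).congr_deriv ?_
    ring
  tendsto_zero k z hz := by
    obtain ⟨B, hB, hb⟩ := H k {z} (by simpa using hz) isCompact_singleton 1
    refine tendsto_integral_filter_of_dominated_convergence B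
      (Eventually.of_forall fun w => aestronglyMeasurable_expIntegrand hg hτ a b k z w) ?_ hB
      (Eventually.of_forall fun r => ?_)
    · filter_upwards [self_mem_nhdsWithin,
        mem_nhdsWithin_of_mem_nhds (Metric.closedBall_mem_nhds (0 : ℂ) one_pos)] with y hy hy1
      filter_upwards [hb] with r hr
      exact hr z rfl y (mem_insert_of_mem _ hy) (by simpa using hy1)
    · have : Continuous fun y => g r * τ r ^ k * Complex.exp (z * τ r ^ a + y * τ r ^ b) := by
        fun_prop
      exact (this.tendsto 0).mono_left nhdsWithin_le_nhds
  bounded k K hK hc R := by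
    obtain ⟨B, hB, hb⟩ := H k K hK hc R
    refine ⟨∫ r, B r ∂μ, fun z hz y hy hR => norm_integral_le_of_norm_le hB ?_⟩
    filter_upwards [hb] with r hr using hr z hz y hy hR

/-! ### Ray, arc and path integrals: decay estimates and Euler equations by integration by parts. -/

theorem integrand_sub_natCast (a b k : ℕ) (β : ℂ) (x : ℂ × ℂ) (w : ℂ) :
    integrand a b (β - k) x w = Complex.exp ((-β - 1) * w) * Complex.exp w ^ k *
      Complex.exp (x.1 * Complex.exp w ^ a + x.2 * Complex.exp w ^ b) := by
  rw [integrand, ← Complex.exp_nat_mul w k, ← Complex.exp_add ((-β - 1) * w)]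
  congr 2
  ring

/-- In the coordinate w = log t, `integrand a b (β - 1) x` is t^(-β) exp(x₁ t^a + x₂ t^b). Its
derivative is t times the defect of the Euler equation, so the Euler equation of an integral reduces
to boundary terms. -/
theorem hasDerivAt_integrand (a b : ℕ) (β : ℂ) (x : ℂ × ℂ) (w : ℂ) :
    HasDerivAt (integrand a b (β - 1) x)
      (Complex.exp w * (a * x.1 * integrand a b (β - a) x w + b * x.2 * integrand a b (β - b) x w -
        β * integrand a b β x w)) w := by
  have e : ∀ n : ℕ, HasDerivAt (fun w : ℂ => Complex.exp w ^ n) (n * Complex.exp w ^ n) w := by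
    intro n
    have : (fun w : ℂ => Complex.exp w ^ n) = fun w => Complex.exp (n * w) := by
      funext w; rw [Complex.exp_nat_mul]
    rw [this, ← Complex.exp_nat_mul]
    simpa [mul_comm] using ((hasDerivAt_id w).const_mul (n : ℂ)).cexp
  have d1 : HasDerivAt (fun w : ℂ => Complex.exp ((-(β - 1) - 1) * w))
      (-β * Complex.exp ((-(β - 1) - 1) * w)) w := by
    have := ((hasDerivAt_id w).const_mul (-(β - 1) - 1)).cexp
    refine this.congr_deriv ?_
    simp only [id, mul_one]
    ring
  have d2 := (((e a).const_mul x.1).add ((e b).const_mul x.2)).cexp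
  refine (d1.mul d2).congr_deriv ?_
  have h : Complex.exp ((-(β - 1) - 1) * w) = Complex.exp w * Complex.exp ((-β - 1) * w) := by
    rw [← Complex.exp_add]; congr 1; ring
  rw [integrand_sub_natCast, integrand_sub_natCast, integrand, h]
  simp only [Pi.add_apply]
  ring

theorem exp_log_add {r : ℝ} (hr : 0 < r) (θ : ℝ) :
    Complex.exp ((Real.log r : ℂ) + θ * Complex.I) = r * Complex.exp (θ * Complex.I) := by
  rw [Complex.exp_add, ← Complex.ofReal_exp, Real.exp_log hr]

/-- All the decay comes from x₁ t^a; the term in x₂ only has to have nonpositive real part, which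
admits x₂ = 0. For r ≥ 1 the bound r ≤ r^a gives exponential decay in r itself. -/
theorem norm_ray_integrand_le {a b : ℕ} (ha : a ≠ 0) (k : ℕ) (β : ℂ) {θ c r : ℝ} (hc : 0 ≤ c)
    (hr : 1 ≤ r) {z y : ℂ} (hz : (z * Complex.exp (θ * Complex.I) ^ a).re ≤ -c)
    (hy : (y * Complex.exp (θ * Complex.I) ^ b).re ≤ 0) :
    ‖Complex.exp ((-β - 1) * ((Real.log r : ℂ) + θ * Complex.I)) * Complex.exp (θ * Complex.I) *
        Complex.exp ((Real.log r : ℂ) + θ * Complex.I) ^ k *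
        Complex.exp (z * Complex.exp ((Real.log r : ℂ) + θ * Complex.I) ^ a +
          y * Complex.exp ((Real.log r : ℂ) + θ * Complex.I) ^ b)‖ ≤
      Real.exp (β.im * θ) * (r ^ (-β.re - 1 + k) * Real.exp (-c * r)) := by
  have hr0 : 0 < r := by linarith
  rw [exp_log_add hr0]
  set e := Complex.exp (θ * Complex.I) with he
  have he1 : ‖e‖ = 1 := by rw [he, Complex.norm_exp_ofReal_mul_I]
  have h1 : ‖Complex.exp ((-β - 1) * ((Real.log r : ℂ) + θ * Complex.I))‖ =
      Real.exp (β.im * θ) * r ^ (-β.re - 1) := by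
    rw [Complex.norm_exp, Real.rpow_def_of_pos hr0, ← Real.exp_add]
    congr 1
    simp
    ring
  have h2 : ‖Complex.exp (z * (r * e) ^ a + y * (r * e) ^ b)‖ ≤ Real.exp (-c * r) := by
    rw [Complex.norm_exp, Real.exp_le_exp, Complex.add_re]
    have e1 : (z * (r * e) ^ a).re = r ^ a * (z * e ^ a).re := by
      rw [← Complex.re_ofReal_mul]; congr 1; push_cast; ring
    have e2 : (y * (r * e) ^ b).re = r ^ b * (y * e ^ b).re := by
      rw [← Complex.re_ofReal_mul]; congr 1; push_cast; ring
    rw [e1, e2]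
    have h3 : r ≤ r ^ a := le_self_pow₀ hr ha
    have h4 : r ^ b * (y * e ^ b).re ≤ 0 := mul_nonpos_of_nonneg_of_nonpos (by positivity) hy
    have h5 : r ^ a * (z * e ^ a).re ≤ r ^ a * (-c) := by gcongr
    nlinarith
  rw [norm_mul, norm_mul, norm_mul, h1, he1, norm_pow, norm_mul, he1, Complex.norm_real,
    Real.norm_eq_abs, abs_of_pos hr0, mul_one, mul_one, mul_assoc, mul_assoc]
  refine mul_le_mul_of_nonneg_left ?_ (Real.exp_pos _).le
  rw [Real.rpow_add hr0, Real.rpow_natCast, mul_assoc]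
  gcongr

theorem integrableOn_rpow_mul_exp (σ : ℝ) {c : ℝ} (hc : 0 < c) :
    IntegrableOn (fun r : ℝ => r ^ σ * Real.exp (-c * r)) (Ioi 1) := by
  refine integrable_of_isBigO_exp_neg (b := c / 2) (by positivity) ?_ ?_
  · intro r hr
    have : r ≠ 0 := (zero_lt_one.trans_le hr).ne'
    exact (ContinuousAt.mul (Real.continuousAt_rpow_const _ _ (Or.inl this))
      (by fun_prop)).continuousWithinAt
  · have h := (isLittleO_rpow_exp_pos_mul_atTop σ (half_pos hc)).isBigO.mul
      (Asymptotics.isBigO_refl (fun r : ℝ => Real.exp (-c * r)) atTop)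
    refine h.congr_right fun r => ?_
    rw [← Real.exp_add]
    congr 1
    ring

theorem aestronglyMeasurable_log_add (θ : ℝ) (μ : Measure ℝ) :
    AEStronglyMeasurable (fun r : ℝ => (Real.log r : ℂ) + θ * Complex.I) μ :=
  ((Complex.measurable_ofReal.comp Real.measurable_log).add_const _).aestronglyMeasurable

theorem aestronglyMeasurable_ray_weight (β : ℂ) (θ : ℝ) (μ : Measure ℝ) :
    AEStronglyMeasurable (fun r : ℝ =>
      Complex.exp ((-β - 1) * ((Real.log r : ℂ) + θ * Complex.I)) *
        Complex.exp (θ * Complex.I)) μ :=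
  (Complex.continuous_exp.comp_aestronglyMeasurable
    ((aestronglyMeasurable_log_add θ μ).const_mul _)).mul_const _

theorem integrableOn_ray {a b : ℕ} (ha : a ≠ 0) (β : ℂ) {θ : ℝ} {x : ℂ × ℂ}
    (hz : (x.1 * Complex.exp (θ * Complex.I) ^ a).re < 0)
    (hy : (x.2 * Complex.exp (θ * Complex.I) ^ b).re ≤ 0) :
    IntegrableOn (fun r : ℝ => integrand a b β x ((Real.log r : ℂ) + θ * Complex.I) *
      Complex.exp (θ * Complex.I)) (Ioi 1) := by
  have hB := (integrableOn_rpow_mul_exp (-β.re - 1 + (0 : ℕ)) (neg_pos.2 hz)).const_mul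
    (Real.exp (β.im * θ))
  have hm := aestronglyMeasurable_expIntegrand (aestronglyMeasurable_ray_weight β θ
    (volume.restrict (Ioi 1))) (Complex.continuous_exp.comp_aestronglyMeasurable
      (aestronglyMeasurable_log_add θ (volume.restrict (Ioi 1)))) a b 0 x.1 x.2
  refine (hB.mono' hm ?_).congr (Eventually.of_forall fun r => ?_)
  · filter_upwards [ae_restrict_mem measurableSet_Ioi] with r hr
    exact norm_ray_integrand_le ha 0 β (neg_pos.2 hz).le (le_of_lt hr) (neg_neg _).ge hy
  · simp only [integrand, pow_zero, mul_one]
    ring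

/-- The Euler equation for the integral along a half line, with its boundary term. -/
theorem rayIntegral_euler {a b : ℕ} (ha : a ≠ 0) (β : ℂ) {θ : ℝ} {x : ℂ × ℂ}
    (hz : (x.1 * Complex.exp (θ * Complex.I) ^ a).re < 0)
    (hy : (x.2 * Complex.exp (θ * Complex.I) ^ b).re ≤ 0) :
    a * x.1 * rayIntegral a b (β - a) x θ + b * x.2 * rayIntegral a b (β - b) x θ -
      β * rayIntegral a b β x θ = -integrand a b (β - 1) x (θ * Complex.I) := by
  have hint := fun β => integrableOn_ray (b := b) ha β hz hy
  have hd : ∀ r ∈ Ici (1 : ℝ), HasDerivAt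
      (fun r : ℝ => integrand a b (β - 1) x ((Real.log r : ℂ) + θ * Complex.I))
      (a * x.1 * (integrand a b (β - a) x ((Real.log r : ℂ) + θ * Complex.I) *
          Complex.exp (θ * Complex.I)) +
        b * x.2 * (integrand a b (β - b) x ((Real.log r : ℂ) + θ * Complex.I) *
          Complex.exp (θ * Complex.I)) -
        β * (integrand a b β x ((Real.log r : ℂ) + θ * Complex.I) *
          Complex.exp (θ * Complex.I))) r := by
    intro r hr
    have hr0 : 0 < r := zero_lt_one.trans_le hr
    have d1 : HasDerivAt (fun r : ℝ => (Real.log r : ℂ) + θ * Complex.I) ((r⁻¹ : ℝ) : ℂ) r :=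
      ((Real.hasDerivAt_log hr0.ne').ofReal_comp).add_const _
    refine ((hasDerivAt_integrand a b β x _).comp r d1).congr_deriv ?_
    rw [exp_log_add hr0]
    have : (r : ℂ) ≠ 0 := by exact_mod_cast hr0.ne'
    push_cast
    field_simp
  have hi1 : IntegrableOn (fun r : ℝ =>
      a * x.1 * (integrand a b (β - a) x ((Real.log r : ℂ) + θ * Complex.I) *
          Complex.exp (θ * Complex.I)) +
        b * x.2 * (integrand a b (β - b) x ((Real.log r : ℂ) + θ * Complex.I) *
          Complex.exp (θ * Complex.I))) (Ioi 1) :=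
    ((hint (β - a)).const_mul (a * x.1)).add ((hint (β - b)).const_mul (b * x.2))
  have hi2 := (hint β).const_mul β
  have hi := hi1.sub hi2
  have hf : IntegrableOn (fun r : ℝ => integrand a b (β - 1) x
      ((Real.log r : ℂ) + θ * Complex.I)) (Ioi 1) := by
    refine ((hint (β - 1)).mul_const (Complex.exp (θ * Complex.I))⁻¹).congr
      (Eventually.of_forall fun r => ?_)
    simp only []
    rw [mul_assoc, mul_inv_cancel₀ (Complex.exp_ne_zero _), mul_one]
  -- The primitive and its derivative are both integrable, hence no boundary term at infinity.
  have ht := tendsto_zero_of_hasDerivAt_of_integrableOn_Ioi (fun r hr => hd r (mem_Ici.2 (le_of_lt hr))) hi hf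
  have := integral_Ioi_of_hasDerivAt_of_tendsto' hd hi ht
  simp only [Real.log_one, Complex.ofReal_zero, zero_add, zero_sub] at this
  rw [← this, integral_sub hi1 hi2, integral_add ((hint (β - a)).const_mul (a * x.1))
    ((hint (β - b)).const_mul (b * x.2)), integral_const_mul, integral_const_mul,
    integral_const_mul]
  rfl

theorem continuous_integrand (a b : ℕ) (β : ℂ) (x : ℂ × ℂ) : Continuous (integrand a b β x) := by
  unfold integrand
  fun_prop

theorem continuous_arc (a b : ℕ) (β : ℂ) (x : ℂ × ℂ) : Continuous fun θ : ℝ =>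
    integrand a b β x (θ * Complex.I) * (Complex.I * Complex.exp (θ * Complex.I)) := by
  have := continuous_integrand a b β x
  fun_prop

/-- The Euler equation for the integral along an arc, with its boundary terms. -/
theorem arcIntegral_euler (a b : ℕ) (β : ℂ) (x : ℂ × ℂ) (θ₁ θ₂ : ℝ) :
    a * x.1 * arcIntegral a b (β - a) x θ₁ θ₂ + b * x.2 * arcIntegral a b (β - b) x θ₁ θ₂ -
      β * arcIntegral a b β x θ₁ θ₂ =
      integrand a b (β - 1) x (θ₂ * Complex.I) - integrand a b (β - 1) x (θ₁ * Complex.I) := by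
  have hint := fun β => (continuous_arc a b β x).intervalIntegrable (μ := volume) θ₁ θ₂
  have hi1 := ((hint (β - a)).const_mul (a * x.1)).add ((hint (β - b)).const_mul (b * x.2))
  have hi2 := (hint β).const_mul β
  have hi := hi1.sub hi2
  have hd : ∀ θ ∈ uIcc θ₁ θ₂, HasDerivAt
      (fun θ : ℝ => integrand a b (β - 1) x (θ * Complex.I))
      (a * x.1 * (integrand a b (β - a) x (θ * Complex.I) *
          (Complex.I * Complex.exp (θ * Complex.I))) +
        b * x.2 * (integrand a b (β - b) x (θ * Complex.I) *
          (Complex.I * Complex.exp (θ * Complex.I))) -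
        β * (integrand a b β x (θ * Complex.I) *
          (Complex.I * Complex.exp (θ * Complex.I)))) θ := by
    intro θ _
    have d1 : HasDerivAt (fun θ : ℝ => (θ : ℂ) * Complex.I) Complex.I θ := by
      simpa using (hasDerivAt_id θ).ofReal_comp.mul_const Complex.I
    refine ((hasDerivAt_integrand a b β x _).comp θ d1).congr_deriv ?_
    ring
  rw [← intervalIntegral.integral_eq_sub_of_hasDerivAt hd hi,
    intervalIntegral.integral_sub hi1 hi2,
    intervalIntegral.integral_add ((hint (β - a)).const_mul (a * x.1))
      ((hint (β - b)).const_mul (b * x.2)), intervalIntegral.integral_const_mul,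
    intervalIntegral.integral_const_mul, intervalIntegral.integral_const_mul]
  rfl

/-- The boundary terms of the rays and of the arc cancel at the two junctions on the unit circle. -/
theorem pathIntegral_euler {a b : ℕ} (ha : a ≠ 0) (β : ℂ) {γ : ℝ × ℝ} {x : ℂ × ℂ}
    (h₁ : (x.1 * Complex.exp (γ.1 * Complex.I) ^ a).re < 0)
    (h₁' : (x.2 * Complex.exp (γ.1 * Complex.I) ^ b).re ≤ 0)
    (h₂ : (x.1 * Complex.exp (γ.2 * Complex.I) ^ a).re < 0)
    (h₂' : (x.2 * Complex.exp (γ.2 * Complex.I) ^ b).re ≤ 0) :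
    a * x.1 * pathIntegral a b (β - a) x γ + b * x.2 * pathIntegral a b (β - b) x γ =
      β * pathIntegral a b β x γ := by
  unfold pathIntegral
  linear_combination rayIntegral_euler ha β h₂ h₂' - rayIntegral_euler ha β h₁ h₁' +
    arcIntegral_euler a b β x γ.1 γ.2

theorem shiftFamily_rayIntegral {a b : ℕ} (ha : a ≠ 0) (β : ℂ) {θ : ℝ} {S₁ S₂ : Set ℂ}
    (h₁ : IsOpen S₁) (h₂ : IsOpen S₂)
    (hz : ∀ z ∈ S₁, (z * Complex.exp (θ * Complex.I) ^ a).re < 0)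
    (hy : ∀ y ∈ S₂, (y * Complex.exp (θ * Complex.I) ^ b).re ≤ 0) :
    ShiftFamily a b S₁ S₂ (fun k x => rayIntegral a b (β - k) x θ) := by
  have := shiftFamily_integral (a := a) (b := b) (aestronglyMeasurable_ray_weight β θ
    (volume.restrict (Ioi 1))) (Complex.continuous_exp.comp_aestronglyMeasurable
      (aestronglyMeasurable_log_add θ (volume.restrict (Ioi 1)))) h₁ h₂ (fun k K hK hc R => ?_)
  · convert this using 3 with k x
    refine integral_congr_ae (Eventually.of_forall fun r => ?_)
    simp only [integrand_sub_natCast]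
    ring
  -- Compactness of `K` turns pointwise negativity of the real part into a uniform decay rate `c`.
  · obtain ⟨c, hc0, hcK⟩ := hc.exists_forall_le' (a := 0)
      (f := fun z : ℂ => -(z * Complex.exp (θ * Complex.I) ^ a).re)
      (by fun_prop) (fun z hz' => neg_pos.2 (hz z (hK hz')))
    refine ⟨_, (integrableOn_rpow_mul_exp (-β.re - 1 + k) hc0).const_mul
      (Real.exp (β.im * θ)), ?_⟩
    filter_upwards [ae_restrict_mem measurableSet_Ioi] with r hr z hz' y hy' _
    refine norm_ray_integrand_le ha k β hc0.le (le_of_lt hr) (by linarith [hcK z hz']) ?_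
    rcases hy' with rfl | hy'
    · simp
    · exact hy y hy'

theorem shiftFamily_arc_Ioc (a b : ℕ) (β : ℂ) (θ₁ θ₂ : ℝ) {S₁ S₂ : Set ℂ} (h₁ : IsOpen S₁)
    (h₂ : IsOpen S₂) : ShiftFamily a b S₁ S₂ (fun k x => ∫ θ in Ioc θ₁ θ₂,
      integrand a b (β - k) x (θ * Complex.I) * (Complex.I * Complex.exp (θ * Complex.I))) := by
  have hg : Continuous fun θ : ℝ => Complex.exp ((-β - 1) * (θ * Complex.I)) *
    (Complex.I * Complex.exp (θ * Complex.I)) := by fun_prop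
  have hτ : Continuous fun θ : ℝ => Complex.exp (θ * Complex.I) := by fun_prop
  have := shiftFamily_integral (a := a) (b := b) (μ := volume.restrict (Ioc θ₁ θ₂))
    hg.aestronglyMeasurable hτ.aestronglyMeasurable h₁ h₂ (fun k K hK hc R => ?_)
  · convert this using 5 with k x r
    rw [integrand_sub_natCast]
    ring
  · obtain ⟨M, hM⟩ := hc.isBounded.exists_norm_le
    refine ⟨fun θ => ‖Complex.exp ((-β - 1) * (θ * Complex.I)) *
      (Complex.I * Complex.exp (θ * Complex.I))‖ * Real.exp (M + R),
      (hg.norm.mul_const _).integrableOn_Ioc, Eventually.of_forall fun θ z hz y _ hR => ?_⟩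
    have hn : ∀ n : ℕ, ‖Complex.exp (θ * Complex.I) ^ n‖ = 1 := fun n => by
      rw [norm_pow, Complex.norm_exp_ofReal_mul_I, one_pow]
    rw [norm_mul, norm_mul _ (_ ^ k), hn, mul_one]
    refine mul_le_mul_of_nonneg_left ?_ (norm_nonneg _)
    rw [Complex.norm_exp, Real.exp_le_exp]
    refine (Complex.re_le_norm _).trans ((norm_add_le _ _).trans ?_)
    rw [norm_mul, norm_mul, hn, hn, mul_one, mul_one]
    exact add_le_add (hM z hz) hR

theorem shiftFamily_arcIntegral (a b : ℕ) (β : ℂ) (θ₁ θ₂ : ℝ) {S₁ S₂ : Set ℂ} (h₁ : IsOpen S₁)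
    (h₂ : IsOpen S₂) : ShiftFamily a b S₁ S₂ (fun k x => arcIntegral a b (β - k) x θ₁ θ₂) := by
  convert (shiftFamily_arc_Ioc a b β θ₁ θ₂ h₁ h₂).add
    ((shiftFamily_arc_Ioc a b β θ₂ θ₁ h₁ h₂).smul (-1)) using 1
  funext k x
  simp only [arcIntegral, intervalIntegral, Pi.add_apply, Pi.smul_apply, smul_eq_mul]
  ring

theorem shiftFamily_pathIntegral {a b : ℕ} (ha : a ≠ 0) (β : ℂ) {δ₁ δ₂ : ℝ} {γ : ℝ × ℝ}
    (h₁ : IsOpen (negSector δ₁)) (h₂ : IsOpen (negSector δ₂))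
    (hγ : IsDecayDirection a b δ₁ δ₂ γ.1 ∧ IsDecayDirection a b δ₁ δ₂ γ.2) :
    ShiftFamily a b (negSector δ₁) (negSector δ₂) (fun k x => pathIntegral a b (β - k) x γ) := by
  have r₁ := shiftFamily_rayIntegral ha β h₁ h₂ hγ.1.1 (fun y hy => (hγ.1.2 y hy).le)
  have r₂ := shiftFamily_rayIntegral ha β h₁ h₂ hγ.2.1 (fun y hy => (hγ.2.2 y hy).le)
  convert ((r₁.smul (-1)).add (shiftFamily_arcIntegral a b β γ.1 γ.2 h₁ h₂)).add r₂ using 1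
  funext k x
  simp only [pathIntegral, Pi.add_apply, Pi.smul_apply, smul_eq_mul]
  ring

theorem eulerRelation_pathIntegral {a b : ℕ} (ha : a ≠ 0) (β : ℂ) {δ₁ δ₂ : ℝ} {γ : ℝ × ℝ}
    (hγ : IsDecayDirection a b δ₁ δ₂ γ.1 ∧ IsDecayDirection a b δ₁ δ₂ γ.2) :
    EulerRelation a b β (negSector δ₁) (negSector δ₂)
      (fun k x => pathIntegral a b (β - k) x γ) := by
  intro i j z hz y hy
  have hy' : ∀ θ : ℝ, IsDecayDirection a b δ₁ δ₂ θ →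
      (y * Complex.exp (θ * Complex.I) ^ b).re ≤ 0 := by
    intro θ hθ
    rcases hy with rfl | hy
    · simp
    · exact (hθ.2 y hy).le
  have := pathIntegral_euler ha (β - (a * i + b * j : ℕ)) (x := (z, y)) (hγ.1.1 z hz)
    (hy' _ hγ.1) (hγ.2.1 z hz) (hy' _ hγ.2)
  simp only []
  rw [Nat.cast_add _ a, Nat.cast_add _ b, ← sub_sub, ← sub_sub]
  exact this

theorem chainIntegral_shift_eq_sum (a b : ℕ) (β : ℂ) (Γ : Chain) :
    (fun (k : ℕ) x => chainIntegral a b (β - k) Γ x) =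
      ∑ γ ∈ Γ.support, Γ γ • fun (k : ℕ) x => pathIntegral a b (β - k) x γ := by
  funext k x
  simp [chainIntegral, Finsupp.sum]

theorem shiftFamily_chainIntegral {a b : ℕ} (ha : a ≠ 0) (β : ℂ) {δ₁ δ₂ : ℝ} {Γ : Chain}
    (h₁ : IsOpen (negSector δ₁)) (h₂ : IsOpen (negSector δ₂))
    (hΓ : IsRapidDecayCycle a b δ₁ δ₂ Γ) :
    ShiftFamily a b (negSector δ₁) (negSector δ₂) (fun k x => chainIntegral a b (β - k) Γ x) ∧
    EulerRelation a b β (negSector δ₁) (negSector δ₂)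
      (fun k x => chainIntegral a b (β - k) Γ x) := by
  rw [chainIntegral_shift_eq_sum]
  exact Finset.sum_induction _ (fun F => ShiftFamily a b (negSector δ₁) (negSector δ₂) F ∧
    EulerRelation a b β (negSector δ₁) (negSector δ₂) F)
    (fun F G hF hG => ⟨hF.1.add hG.1, hF.2.add hG.2⟩) ⟨ShiftFamily.zero, EulerRelation.zero⟩
    fun γ hγ => ⟨(shiftFamily_pathIntegral ha β h₁ h₂ (hΓ γ hγ)).smul _,
      (eulerRelation_pathIntegral ha β (hΓ γ hγ)).smul _⟩

end Integral

/-! ### Exponential generating series in two variables -/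

/-- The monomial `x₁ ^ i / i! * x₂ ^ j / j!`. -/
def expMonomial (x : ℂ × ℂ) (l : ℕ × ℕ) : ℂ :=
  x.1 ^ l.1 / (l.1.factorial : ℂ) * (x.2 ^ l.2 / (l.2.factorial : ℂ))

/-- The exponential generating series of a sequence of weights. -/
def expSeries (w : ℕ × ℕ → ℂ) (x : ℂ × ℂ) : ℂ := ∑' l, w l * expMonomial x l

theorem norm_expMonomial (x : ℂ × ℂ) (l : ℕ × ℕ) : ‖expMonomial x l‖ =
    ‖x.1‖ ^ l.1 / (l.1.factorial : ℝ) * (‖x.2‖ ^ l.2 / (l.2.factorial : ℝ)) := by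
  simp [expMonomial]

theorem hasSum_norm_expMonomial (x : ℂ × ℂ) :
    HasSum (fun l => ‖expMonomial x l‖) (Real.exp ‖x.1‖ * Real.exp ‖x.2‖) := by
  simp only [norm_expMonomial]
  have h : ∀ t : ℝ, HasSum (fun n : ℕ => t ^ n / (n.factorial : ℝ)) (Real.exp t) := fun t => by
    rw [Real.exp_eq_exp_ℝ]
    exact NormedSpace.expSeries_div_hasSum_exp t
  exact (h ‖x.1‖).mul (h ‖x.2‖) ((h ‖x.1‖).summable.mul_of_nonneg (h ‖x.2‖).summable
    (fun n => by positivity) (fun n => by positivity))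

theorem hasSum_expMonomial (x : ℂ × ℂ) : HasSum (expMonomial x) (Complex.exp (x.1 + x.2)) := by
  have h : ∀ t : ℂ, HasSum (fun n : ℕ => t ^ n / (n.factorial : ℂ)) (Complex.exp t) := fun t => by
    rw [Complex.exp_eq_exp_ℂ]
    exact NormedSpace.expSeries_div_hasSum_exp t
  rw [Complex.exp_add]
  have hs : Summable fun l : ℕ × ℕ =>
      x.1 ^ l.1 / (l.1.factorial : ℂ) * (x.2 ^ l.2 / (l.2.factorial : ℂ)) :=
    (hasSum_norm_expMonomial x).summable.of_norm
  have hm := (h x.1).mul (h x.2) hs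
  exact hm

theorem summable_expSeries {w : ℕ × ℕ → ℂ} {C : ℝ} (hw : ∀ l, ‖w l‖ ≤ C) (x : ℂ × ℂ) :
    Summable fun l => w l * expMonomial x l :=
  Summable.of_norm_bounded ((hasSum_norm_expMonomial x).summable.mul_left C) fun l => by
    rw [norm_mul]
    exact mul_le_mul_of_nonneg_right (hw l) (norm_nonneg _)

theorem norm_expSeries_le {w : ℕ × ℕ → ℂ} {C : ℝ} (hw : ∀ l, ‖w l‖ ≤ C) (x : ℂ × ℂ) :
    ‖expSeries w x‖ ≤ C * (Real.exp ‖x.1‖ * Real.exp ‖x.2‖) :=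
  tsum_of_norm_bounded ((hasSum_norm_expMonomial x).mul_left C) fun l => by
    rw [norm_mul]
    exact mul_le_mul_of_nonneg_right (hw l) (norm_nonneg _)

theorem expSeries_swap (w : ℕ × ℕ → ℂ) (x : ℂ × ℂ) :
    expSeries w x = expSeries (w ∘ Prod.swap) x.swap := by
  rw [expSeries, expSeries, ← (Equiv.prodComm ℕ ℕ).tsum_eq]
  refine tsum_congr fun l => ?_
  simp only [Equiv.prodComm_apply, Function.comp, expMonomial, Prod.fst_swap, Prod.snd_swap]
  ring

/-- Translation of the first index. -/
def shiftFst (l : ℕ × ℕ) : ℕ × ℕ := (l.1 + 1, l.2)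

/-- Translation of the second index. -/
def shiftSnd (l : ℕ × ℕ) : ℕ × ℕ := (l.1, l.2 + 1)

theorem shiftFst_injective : Function.Injective shiftFst := by
  rintro ⟨i, j⟩ ⟨i', j'⟩ h
  simpa [shiftFst] using h

theorem not_mem_range_shiftFst {l : ℕ × ℕ} (h : l ∉ range shiftFst) : l.1 = 0 := by
  by_contra h0
  exact h ⟨(l.1 - 1, l.2), by ext <;> simp [shiftFst]; omega⟩

/-- This is x₁∂₁ read on weights: multiplication by the first exponent. The terms missed by the
shift have exponent zero and contribute nothing. -/
theorem hasSum_mul_expSeries_shiftFst {w : ℕ × ℕ → ℂ} {C : ℝ} (hw : ∀ l, ‖w l‖ ≤ C) (x : ℂ × ℂ) :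
    HasSum (fun l => (l.1 : ℂ) * w l * expMonomial x l) (x.1 * expSeries (w ∘ shiftFst) x) := by
  rw [← shiftFst_injective.hasSum_iff]
  · refine ((summable_expSeries (w := w ∘ shiftFst) (fun l => hw _) x).hasSum.mul_left x.1).congr_fun
      fun l => ?_
    have h1 : ((l.1 : ℂ) + 1) ≠ 0 := by exact_mod_cast l.1.succ_ne_zero
    have h2 : (l.1.factorial : ℂ) ≠ 0 := by exact_mod_cast l.1.factorial_ne_zero
    simp only [Function.comp, shiftFst, expMonomial, Nat.factorial_succ, pow_succ]
    push_cast
    field_simp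
  · intro l hl
    simp [not_mem_range_shiftFst hl]

theorem hasSum_mul_expSeries_shiftSnd {w : ℕ × ℕ → ℂ} {C : ℝ} (hw : ∀ l, ‖w l‖ ≤ C) (x : ℂ × ℂ) :
    HasSum (fun l => (l.2 : ℂ) * w l * expMonomial x l) (x.2 * expSeries (w ∘ shiftSnd) x) := by
  have h := hasSum_mul_expSeries_shiftFst (w := w ∘ Prod.swap) (fun l => hw _) x.swap
  rw [← (Equiv.prodComm ℕ ℕ).hasSum_iff, expSeries_swap]
  refine h.congr_fun fun l => ?_
  simp only [Equiv.prodComm_apply, Function.comp, expMonomial, Prod.fst_swap, Prod.snd_swap]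
  ring

theorem hasDerivAt_expSeries_fst {w : ℕ × ℕ → ℂ} {C : ℝ} (hw : ∀ l, ‖w l‖ ≤ C) (z y : ℂ) :
    HasDerivAt (fun z => expSeries w (z, y)) (expSeries (w ∘ shiftFst) (z, y)) z := by
  set R : ℝ := ‖z‖ + 1
  have hC : 0 ≤ C := (norm_nonneg _).trans (hw 0)
  have hu1 : Summable fun n : ℕ => (n : ℝ) * R ^ (n - 1) / (n.factorial : ℝ) := by
    rw [← summable_nat_add_iff 1]
    refine (Real.summable_pow_div_factorial R).congr fun n => ?_
    have h1 : ((n : ℝ) + 1) ≠ 0 := by exact_mod_cast n.succ_ne_zero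
    have h2 : (n.factorial : ℝ) ≠ 0 := by exact_mod_cast n.factorial_ne_zero
    rw [Nat.factorial_succ, Nat.add_sub_cancel]
    push_cast
    field_simp
  have hu : Summable fun l : ℕ × ℕ => C * ((l.1 : ℝ) * R ^ (l.1 - 1) / (l.1.factorial : ℝ) *
      (‖y‖ ^ l.2 / (l.2.factorial : ℝ))) :=
    (hu1.mul_of_nonneg (Real.summable_pow_div_factorial ‖y‖) (fun n => by positivity)
      (fun n => by positivity)).mul_left C
  have d := hasDerivAt_tsum_of_isPreconnected (t := Metric.ball (0 : ℂ) R) (y₀ := z) (y := z)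
    (g := fun l z => w l * expMonomial (z, y) l)
    (g' := fun l z => w l * ((l.1 : ℂ) * z ^ (l.1 - 1) / (l.1.factorial : ℂ) *
      (y ^ l.2 / (l.2.factorial : ℂ)))) hu Metric.isOpen_ball
    (convex_ball 0 R).isPreconnected (fun l v _ => ?_) (fun l v hv => ?_)
    (by simp [R]) (summable_expSeries hw (z, y)) (by simp [R])
  · refine d.congr_deriv ?_
    rw [expSeries, ← shiftFst_injective.tsum_eq]
    · refine tsum_congr fun l => ?_
      have h1 : ((l.1 : ℂ) + 1) ≠ 0 := by exact_mod_cast l.1.succ_ne_zero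
      have h2 : (l.1.factorial : ℂ) ≠ 0 := by exact_mod_cast l.1.factorial_ne_zero
      simp only [Function.comp, shiftFst, expMonomial, Nat.factorial_succ, Nat.add_sub_cancel]
      push_cast
      field_simp
    · intro l hl
      by_contra h
      exact hl (by simp [not_mem_range_shiftFst h])
  · change HasDerivAt (fun z => w l * (z ^ l.1 / (l.1.factorial : ℂ) *
      (y ^ l.2 / (l.2.factorial : ℂ)))) _ v
    exact (((hasDerivAt_pow l.1 v).div_const _).mul_const _).const_mul _
  · have hv' : ‖v‖ ≤ R := (mem_ball_zero_iff.1 hv).le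
    simp only [norm_mul, norm_div, norm_pow, Complex.norm_natCast]
    gcongr
    exact hw l

theorem hasDerivAt_expSeries_snd {w : ℕ × ℕ → ℂ} {C : ℝ} (hw : ∀ l, ‖w l‖ ≤ C) (z y : ℂ) :
    HasDerivAt (fun y => expSeries w (z, y)) (expSeries (w ∘ shiftSnd) (z, y)) y := by
  have h := hasDerivAt_expSeries_fst (w := w ∘ Prod.swap) (fun l => hw _) y z
  have e : (fun y => expSeries w (z, y)) = fun y => expSeries (w ∘ Prod.swap) (y, z) := by
    funext y; exact expSeries_swap w (z, y)
  rw [e, expSeries_swap]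
  exact h

/-! ### The regularization at the origin -/

/-- The weights `1 / (i a + j b - β)`. -/
def regWeight (a b : ℕ) (β : ℂ) (l : ℕ × ℕ) : ℂ := (((l.1 * a + l.2 * b : ℕ) : ℂ) - β)⁻¹

/-- The entire function `∑ x₁ ^ i x₂ ^ j / (i! j! (i a + j b - β))`, a regularization of the integral
of `t ^ (-β - 1) * exp (x₁ t ^ a + x₂ t ^ b)` along `[0, 1]`. -/
def regSeries (a b : ℕ) (β : ℂ) (x : ℂ × ℂ) : ℂ := expSeries (regWeight a b β) x

/-- Only finitely many values of i a + j b are closer to `β` than 1. A resonant index is harmless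
because its weight is the default value 0 of the inverse. -/
theorem exists_norm_regWeight_le (a b : ℕ) (β : ℂ) : ∃ C : ℝ, ∀ l, ‖regWeight a b β l‖ ≤ C := by
  obtain ⟨N, hN⟩ := exists_nat_ge (‖β‖ + 1)
  refine ⟨1 + ∑ k ∈ Finset.range N, ‖((k : ℂ) - β)⁻¹‖, fun l => ?_⟩
  rw [regWeight]
  set k := l.1 * a + l.2 * b
  have h0 : 0 ≤ ∑ k ∈ Finset.range N, ‖((k : ℂ) - β)⁻¹‖ := by positivity
  rcases lt_or_ge k N with h | h
  · have := Finset.single_le_sum (f := fun k : ℕ => ‖((k : ℂ) - β)⁻¹‖)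
      (fun _ _ => norm_nonneg _) (Finset.mem_range.2 h)
    linarith
  · have h1 : (N : ℝ) ≤ k := by exact_mod_cast h
    have h2 := norm_sub_norm_le (k : ℂ) β
    rw [Complex.norm_natCast] at h2
    rw [norm_inv]
    have h3 : ‖(k : ℂ) - β‖⁻¹ ≤ 1 := inv_le_one_of_one_le₀ (by linarith)
    linarith

theorem regWeight_comp_shiftFst (a b : ℕ) (β : ℂ) :
    regWeight a b β ∘ shiftFst = regWeight a b (β - a) := by
  funext l
  simp only [Function.comp, regWeight, shiftFst]
  congr 1
  push_cast
  ring

theorem regWeight_comp_shiftSnd (a b : ℕ) (β : ℂ) :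
    regWeight a b β ∘ shiftSnd = regWeight a b (β - b) := by
  funext l
  simp only [Function.comp, regWeight, shiftSnd]
  congr 1
  push_cast
  ring

theorem hasDerivAt_regSeries_fst (a b : ℕ) (β z y : ℂ) :
    HasDerivAt (fun z => regSeries a b β (z, y)) (regSeries a b (β - a) (z, y)) z := by
  obtain ⟨C, hC⟩ := exists_norm_regWeight_le a b β
  have := hasDerivAt_expSeries_fst hC z y
  rwa [regWeight_comp_shiftFst] at this

theorem hasDerivAt_regSeries_snd (a b : ℕ) (β z y : ℂ) :
    HasDerivAt (fun y => regSeries a b β (z, y)) (regSeries a b (β - b) (z, y)) y := by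
  obtain ⟨C, hC⟩ := exists_norm_regWeight_le a b β
  have := hasDerivAt_expSeries_snd hC z y
  rwa [regWeight_comp_shiftSnd] at this

/-- The Euler operator cancels the denominators i a + j b - β and leaves the full exponential
series. Resonant indices, of weight 0, must be excluded unless their monomial vanishes at `x`. The
right side is the boundary term at t = 1, opposite to that of the ray integral along the positive
axis. -/
theorem regSeries_euler {a b : ℕ} {β : ℂ} {x : ℂ × ℂ}
    (hβ : ∀ l, expMonomial x l = 0 ∨ β ≠ (l.1 * a + l.2 * b : ℕ)) :
    a * x.1 * regSeries a b (β - a) x + b * x.2 * regSeries a b (β - b) x - β * regSeries a b β x =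
      Complex.exp (x.1 + x.2) := by
  obtain ⟨C, hC⟩ := exists_norm_regWeight_le a b β
  have h1 := (hasSum_mul_expSeries_shiftFst hC x).mul_left (a : ℂ)
  have h2 := (hasSum_mul_expSeries_shiftSnd hC x).mul_left (b : ℂ)
  have h3 := (summable_expSeries hC x).hasSum.mul_left β
  rw [regWeight_comp_shiftFst] at h1
  rw [regWeight_comp_shiftSnd] at h2
  have h := ((h1.add h2).sub h3).unique ((hasSum_expMonomial x).congr_fun fun l => ?_)
  · rw [← h, regSeries, regSeries, regSeries, expSeries, expSeries, expSeries]
    ring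
  · rcases hβ l with h0 | h0
    · simp [h0]
    rw [ne_comm, ← sub_ne_zero] at h0
    have h4 : (((l.1 * a + l.2 * b : ℕ) : ℂ) - β) * regWeight a b β l = 1 := mul_inv_cancel₀ h0
    push_cast at h4
    linear_combination expMonomial x l * h4

theorem shiftFamily_regSeries (a b : ℕ) (β : ℂ) (S₁ S₂ : Set ℂ) :
    ShiftFamily a b S₁ S₂ (fun k x => regSeries a b (β - k) x) where
  deriv_fst k z _ y _ := by
    simp only [Nat.cast_add, ← sub_sub]
    exact hasDerivAt_regSeries_fst a b _ z y
  deriv_snd k z _ y _ := by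
    simp only [Nat.cast_add, ← sub_sub]
    exact hasDerivAt_regSeries_snd a b _ z y
  tendsto_zero k z _ :=
    (hasDerivAt_regSeries_snd a b (β - k) z 0).continuousAt.tendsto.mono_left nhdsWithin_le_nhds
  bounded k K _ hc R := by
    obtain ⟨C, hC⟩ := exists_norm_regWeight_le a b (β - k)
    obtain ⟨M, hM⟩ := hc.isBounded.exists_norm_le
    have hC0 : 0 ≤ C := (norm_nonneg _).trans (hC 0)
    refine ⟨C * (Real.exp M * Real.exp R), fun z hz y _ hy => (norm_expSeries_le hC _).trans ?_⟩
    have := hM z hz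
    gcongr

/-! ### The Taylor-corrected integral as a ray integral plus the regularizing series. -/

section Corrected

open MeasureTheory

theorem expMonomial_scale (a b : ℕ) (x : ℂ × ℂ) (t : ℂ) (l : ℕ × ℕ) :
    expMonomial (x.1 * t ^ a, x.2 * t ^ b) l = expMonomial x l * t ^ (l.1 * a + l.2 * b) := by
  simp only [expMonomial, mul_pow, pow_add, ← pow_mul]
  rw [mul_comm a l.1, mul_comm b l.2]
  ring

theorem integrand_log {r : ℝ} (hr : 0 < r) (a b : ℕ) (β : ℂ) (x : ℂ × ℂ) :
    integrand a b β x ((Real.log r : ℂ) + ((0 : ℝ) : ℂ) * Complex.I) *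
      Complex.exp (((0 : ℝ) : ℂ) * Complex.I) =
      (r : ℂ) ^ (-β - 1) * Complex.exp (x.1 * (r : ℂ) ^ a + x.2 * (r : ℂ) ^ b) := by
  have hr0 : (r : ℂ) ≠ 0 := by exact_mod_cast hr.ne'
  rw [integrand, exp_log_add hr, Complex.cpow_def_of_ne_zero hr0, ← Complex.ofReal_log hr.le]
  simp [mul_comm]

theorem integrableOn_cpow_mul_exp {a b : ℕ} (ha : a ≠ 0) (β : ℂ) {x : ℂ × ℂ} (h₁ : x.1.re < 0)
    (h₂ : x.2.re ≤ 0) : IntegrableOn (fun r : ℝ => (r : ℂ) ^ (-β - 1) *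
      Complex.exp (x.1 * (r : ℂ) ^ a + x.2 * (r : ℂ) ^ b)) (Ioi 1) ∧
    ∫ r in Ioi (1 : ℝ), (r : ℂ) ^ (-β - 1) *
      Complex.exp (x.1 * (r : ℂ) ^ a + x.2 * (r : ℂ) ^ b) = rayIntegral a b β x 0 := by
  have h := integrableOn_ray (a := a) (b := b) (x := x) (θ := 0) ha β (by simpa using h₁)
    (by simpa using h₂)
  have e : ∀ r ∈ Ioi (1 : ℝ), integrand a b β x ((Real.log r : ℂ) + ((0 : ℝ) : ℂ) * Complex.I) *
      Complex.exp (((0 : ℝ) : ℂ) * Complex.I) =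
      (r : ℂ) ^ (-β - 1) * Complex.exp (x.1 * (r : ℂ) ^ a + x.2 * (r : ℂ) ^ b) :=
    fun r hr => integrand_log (zero_lt_one.trans hr) a b β x
  exact ⟨h.congr_fun e measurableSet_Ioi, (setIntegral_congr_fun measurableSet_Ioi e).symm⟩

/-- The integrand of the Taylor-corrected integral, with a complex exponent. -/
def corrected (a b : ℕ) (β : ℂ) (s : Finset (ℕ × ℕ)) (x : ℂ × ℂ) (t : ℝ) : ℂ :=
  (t : ℂ) ^ (-β - 1) * (Complex.exp (x.1 * (t : ℂ) ^ a + x.2 * (t : ℂ) ^ b) -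
    ∑ l ∈ s, expMonomial x l * (t : ℂ) ^ (l.1 * a + l.2 * b))

theorem cpow_mul_pow {t : ℝ} (ht : 0 < t) (c : ℂ) (n : ℕ) :
    (t : ℂ) ^ c * (t : ℂ) ^ n = (t : ℂ) ^ (c + n) := by
  have ht0 : (t : ℂ) ≠ 0 := by exact_mod_cast ht.ne'
  rw [Complex.cpow_add _ _ ht0, Complex.cpow_natCast]

/-- Each subtracted monomial has degree below `β.re`, so it is integrable at infinity, and -∫₁^∞
t^(n-β-1) dt = 1/(n - β) is exactly its regularizing weight. -/
theorem corrected_Ioi {a b : ℕ} (ha : a ≠ 0) {β : ℂ} {s : Finset (ℕ × ℕ)}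
    (hs : ∀ l ∈ s, ((l.1 * a + l.2 * b : ℕ) : ℝ) < β.re) {x : ℂ × ℂ} (h₁ : x.1.re < 0)
    (h₂ : x.2.re ≤ 0) : IntegrableOn (corrected a b β s x) (Ioi 1) ∧
    ∫ t in Ioi (1 : ℝ), corrected a b β s x t = rayIntegral a b β x 0 +
      ∑ l ∈ s, regWeight a b β l * expMonomial x l := by
  obtain ⟨hi, hv⟩ := integrableOn_cpow_mul_exp (b := b) ha β h₁ h₂
  have hre : ∀ l ∈ s, (-β - 1 + ((l.1 * a + l.2 * b : ℕ) : ℂ)).re < -1 := by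
    intro l hl
    have := hs l hl
    simp only [Complex.add_re, Complex.sub_re, Complex.neg_re, Complex.one_re, Complex.natCast_re]
    linarith
  have hl : ∀ l ∈ s, IntegrableOn (fun t : ℝ => expMonomial x l *
      (t : ℂ) ^ (-β - 1 + ((l.1 * a + l.2 * b : ℕ) : ℂ))) (Ioi 1) := fun l hl =>
    (integrableOn_Ioi_cpow_of_lt (hre l hl) one_pos).const_mul _
  have hsum := integrable_finsetSum s hl
  have e : ∀ t ∈ Ioi (1 : ℝ), (t : ℂ) ^ (-β - 1) *
      Complex.exp (x.1 * (t : ℂ) ^ a + x.2 * (t : ℂ) ^ b) -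
      ∑ l ∈ s, expMonomial x l * (t : ℂ) ^ (-β - 1 + ((l.1 * a + l.2 * b : ℕ) : ℂ)) =
      corrected a b β s x t := by
    intro t ht
    rw [corrected, mul_sub, Finset.mul_sum]
    congr 1
    refine Finset.sum_congr rfl fun l _ => ?_
    rw [← cpow_mul_pow (zero_lt_one.trans ht)]
    ring
  refine ⟨(hi.sub hsum).congr_fun e measurableSet_Ioi, ?_⟩
  rw [← setIntegral_congr_fun measurableSet_Ioi e, integral_sub hi hsum, hv,
    integral_finsetSum s hl, sub_eq_add_neg, ← Finset.sum_neg_distrib]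
  congr 1
  refine Finset.sum_congr rfl fun l hl => ?_
  rw [integral_const_mul, integral_Ioi_cpow_of_lt (hre l hl) one_pos, Complex.ofReal_one,
    Complex.one_cpow, regWeight, show -β - 1 + ((l.1 * a + l.2 * b : ℕ) : ℂ) + 1 =
      ((l.1 * a + l.2 * b : ℕ) : ℂ) - β by ring]
  ring

/-- The monomials that are kept are integrated term by term over (0, 1], with value 1/(n - β). The
gap `ε` dominates them all by t^(ε-1), which justifies the exchange of sum and integral. -/
theorem corrected_Ioc {a b : ℕ} {β : ℂ} {s : Finset (ℕ × ℕ)} {ε : ℝ} (hε : 0 < ε)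
    (hs : ∀ l ∉ s, β.re + ε ≤ ((l.1 * a + l.2 * b : ℕ) : ℝ)) (x : ℂ × ℂ) :
    IntegrableOn (corrected a b β s x) (Ioc 0 1) ∧
    (∫ t in Ioc (0 : ℝ) 1, corrected a b β s x t) +
      ∑ l ∈ s, regWeight a b β l * expMonomial x l = regSeries a b β x := by
  classical
  obtain ⟨C, hC⟩ := exists_norm_regWeight_le a b β
  set F : ℕ × ℕ → ℝ → ℂ := fun l t => if l ∈ s then 0 else
    expMonomial x l * (t : ℂ) ^ (-β - 1 + ((l.1 * a + l.2 * b : ℕ) : ℂ)) with hF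
  have hre : ∀ l ∉ s, ε - 1 ≤ (-β - 1 + ((l.1 * a + l.2 * b : ℕ) : ℂ)).re := by
    intro l hl
    have := hs l hl
    simp only [Complex.add_re, Complex.sub_re, Complex.neg_re, Complex.one_re, Complex.natCast_re]
    linarith
  have hre' : ∀ l ∉ s, -1 < (-β - 1 + ((l.1 * a + l.2 * b : ℕ) : ℂ)).re := fun l hl => by
    linarith [hre l hl]
  have hFi : ∀ l, IntegrableOn (F l) (Ioc 0 1) := by
    intro l
    by_cases hl : l ∈ s
    · simp only [hF, if_pos hl]
      exact integrable_zero _ _ _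
    · simp only [hF, if_neg hl]
      refine Integrable.const_mul ?_ _
      exact (intervalIntegrable_iff_integrableOn_Ioc_of_le zero_le_one).1
        (intervalIntegral.intervalIntegrable_cpow' (hre' l hl))
  have hFv : ∀ l, ∫ t in Ioc (0 : ℝ) 1, F l t =
      if l ∈ s then 0 else regWeight a b β l * expMonomial x l := by
    intro l
    by_cases hl : l ∈ s
    · simp [hF, if_pos hl]
    · simp only [hF, if_neg hl]
      rw [integral_const_mul, ← intervalIntegral.integral_of_le zero_le_one,
        integral_cpow (Or.inl (hre' l hl)), regWeight,
        show -β - 1 + ((l.1 * a + l.2 * b : ℕ) : ℂ) + 1 =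
          ((l.1 * a + l.2 * b : ℕ) : ℂ) - β by ring, Complex.ofReal_one, Complex.one_cpow,
        Complex.ofReal_zero, Complex.zero_cpow]
      · ring
      · intro h
        have h1 := congrArg Complex.re h
        have h2 := hs l hl
        simp only [Complex.sub_re, Complex.natCast_re, Complex.zero_re] at h1
        linarith
  have hFn : ∀ l, ∀ t ∈ Ioc (0 : ℝ) 1, ‖F l t‖ ≤ ‖expMonomial x l‖ * t ^ (ε - 1) := by
    intro l t ht
    have h0 : 0 ≤ t ^ (ε - 1) := Real.rpow_nonneg ht.1.le _
    by_cases hl : l ∈ s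
    · simp only [hF, if_pos hl, norm_zero]
      positivity
    · simp only [hF, if_neg hl]
      rw [norm_mul, Complex.norm_cpow_eq_rpow_re_of_pos ht.1]
      refine mul_le_mul_of_nonneg_left ?_ (norm_nonneg _)
      exact Real.rpow_le_rpow_of_exponent_ge ht.1 ht.2 (hre l hl)
  have hε' : IntegrableOn (fun t : ℝ => t ^ (ε - 1)) (Ioc 0 1) :=
    (intervalIntegrable_iff_integrableOn_Ioc_of_le zero_le_one).1
      (intervalIntegral.intervalIntegrable_rpow' (by linarith))
  have hsumF : ∀ t ∈ Ioc (0 : ℝ) 1, HasSum (fun l => F l t) (corrected a b β s x t) := by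
    intro t ht
    have h1 := (hasSum_expMonomial (x.1 * (t : ℂ) ^ a, x.2 * (t : ℂ) ^ b)).mul_left
      ((t : ℂ) ^ (-β - 1))
    have h2 : HasSum (fun l => if l ∈ s then (t : ℂ) ^ (-β - 1) *
        (expMonomial x l * (t : ℂ) ^ (l.1 * a + l.2 * b)) else 0) (∑ l ∈ s, if l ∈ s then
        (t : ℂ) ^ (-β - 1) * (expMonomial x l * (t : ℂ) ^ (l.1 * a + l.2 * b)) else 0) :=
      hasSum_sum_of_ne_finset_zero fun l hl => if_neg hl
    have h3 := h1.sub h2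
    rw [Finset.sum_congr rfl fun l hl => if_pos hl, ← Finset.mul_sum, ← mul_sub] at h3
    refine h3.congr_fun fun l => ?_
    simp only [hF, expMonomial_scale]
    split_ifs
    · ring
    · rw [← cpow_mul_pow ht.1]; ring
  have hmeas : AEStronglyMeasurable (corrected a b β s x) (volume.restrict (Ioc 0 1)) := by
    refine ContinuousOn.aestronglyMeasurable (fun t ht => ContinuousAt.continuousWithinAt ?_)
      measurableSet_Ioc
    have h1 : ContinuousAt (fun t : ℝ => (t : ℂ) ^ (-β - 1)) t :=
      (continuousAt_cpow_const (Or.inl (by simpa using ht.1))).comp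
        Complex.continuous_ofReal.continuousAt
    exact h1.mul (Continuous.continuousAt (by fun_prop))
  have hM := (hasSum_norm_expMonomial x)
  have hint : IntegrableOn (corrected a b β s x) (Ioc 0 1) := by
    refine (hε'.const_mul (Real.exp ‖x.1‖ * Real.exp ‖x.2‖)).mono' hmeas ?_
    filter_upwards [ae_restrict_mem measurableSet_Ioc] with t ht
    rw [← (hsumF t ht).tsum_eq]
    exact tsum_of_norm_bounded (hM.mul_right _) fun l => hFn l t ht
  have hsn : Summable fun l => ∫ t in Ioc (0 : ℝ) 1, ‖F l t‖ := by
    refine Summable.of_nonneg_of_le (fun l => integral_nonneg fun t => norm_nonneg _)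
      (fun l => ?_) (hM.summable.mul_right (∫ t in Ioc (0 : ℝ) 1, t ^ (ε - 1)))
    rw [← integral_const_mul]
    exact setIntegral_mono_on (hFi l).norm (hε'.const_mul _) measurableSet_Ioc
      fun t ht => hFn l t ht
  refine ⟨hint, ?_⟩
  have h1 := hasSum_integral_of_summable_integral_norm hFi hsn
  rw [setIntegral_congr_fun measurableSet_Ioc fun t ht => (hsumF t ht).tsum_eq] at h1
  have h2 : HasSum (fun l => if l ∈ s then regWeight a b β l * expMonomial x l else 0)
      (∑ l ∈ s, if l ∈ s then regWeight a b β l * expMonomial x l else 0) :=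
    hasSum_sum_of_ne_finset_zero fun l hl => if_neg hl
  rw [Finset.sum_congr rfl fun l hl => if_pos hl] at h2
  refine (h1.add h2).unique ((summable_expSeries hC x).hasSum.congr_fun fun l => ?_)
  rw [hFv]
  split_ifs <;> simp

/-- The Taylor-corrected integral along the positive real axis. -/
theorem integral_corrected {a b : ℕ} (ha : a ≠ 0) {β : ℂ} {s : Finset (ℕ × ℕ)} {ε : ℝ}
    (hε : 0 < ε) (hs : ∀ l ∈ s, ((l.1 * a + l.2 * b : ℕ) : ℝ) < β.re)
    (hs' : ∀ l ∉ s, β.re + ε ≤ ((l.1 * a + l.2 * b : ℕ) : ℝ)) {x : ℂ × ℂ} (h₁ : x.1.re < 0)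
    (h₂ : x.2.re ≤ 0) : IntegrableOn (corrected a b β s x) (Ioi 0) ∧
    ∫ t in Ioi (0 : ℝ), corrected a b β s x t = rayIntegral a b β x 0 + regSeries a b β x := by
  obtain ⟨i1, v1⟩ := corrected_Ioc hε hs' x
  obtain ⟨i2, v2⟩ := corrected_Ioi ha hs h₁ h₂
  rw [← Ioc_union_Ioi_eq_Ioi (zero_le_one' ℝ)]
  refine ⟨i1.union i2, ?_⟩
  -- The weights of the subtracted monomials, produced on (1, ∞), complete the partial series
  -- produced on (0, 1].
  rw [setIntegral_union (Ioc_disjoint_Ioi le_rfl) measurableSet_Ioi i1 i2, v2, ← v1]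
  ring

theorem correctedIntegrand_eq_corrected {a b : ℕ} {n : ℤ} (x : ℂ × ℂ) (t : ℝ) :
    correctedIntegrand a b n x t = corrected a b n
      ((Finset.range (n.toNat + 1) ×ˢ Finset.range (n.toNat + 1)).filter
        (fun l : ℕ × ℕ => (l.1 * a + l.2 * b : ℤ) ≤ n)) x t := by
  rw [correctedIntegrand, corrected, taylorPoly, ← Complex.cpow_intCast]
  push_cast
  congr 2
  refine Finset.sum_congr rfl fun l _ => ?_
  rw [expMonomial]
  ring

/-- Since `n` is not of the form i a + j b, the subtracted degrees are strictly below `n` and the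
others are at least n + 1: the gap is 1. The square of indices in `taylorPoly` is large enough
because i ≤ i a and j ≤ j b. -/
theorem correctedIntegral_eq {a b : ℕ} (ha : a ≠ 0) (hb : b ≠ 0) {n : ℤ}
    (hn : n ∈ exceptionalIntegers a b) {x : ℂ × ℂ} (h₁ : x.1.re < 0) (h₂ : x.2.re ≤ 0) :
    IntegrableOn (correctedIntegrand a b n x) (Ioi 0) ∧
    correctedIntegral a b n x = rayIntegral a b n x 0 + regSeries a b n x := by
  rw [correctedIntegral, funext (correctedIntegrand_eq_corrected (a := a) (b := b) (n := n) x)]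
  refine integral_corrected ha one_pos (fun l hl => ?_) (fun l hl => ?_) h₁ h₂
  · have h := (Finset.mem_filter.1 hl).2
    have h' : (l.1 * a + l.2 * b : ℤ) < n := lt_of_le_of_ne h (hn l.1 l.2).symm
    rw [Complex.intCast_re]
    exact_mod_cast h'
  · rw [Complex.intCast_re]
    have h : n + 1 ≤ (l.1 * a + l.2 * b : ℤ) := by
      by_contra hlt
      rw [not_le, Int.lt_add_one_iff] at hlt
      refine hl (Finset.mem_filter.2 ⟨?_, hlt⟩)
      have h1 : (l.1 : ℤ) ≤ l.1 * a := by
        exact_mod_cast Nat.le_mul_of_pos_right l.1 (Nat.pos_of_ne_zero ha)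
      have h2 : (l.2 : ℤ) ≤ l.2 * b := by
        exact_mod_cast Nat.le_mul_of_pos_right l.2 (Nat.pos_of_ne_zero hb)
      rw [Finset.mem_product, Finset.mem_range, Finset.mem_range]
      omega
    exact_mod_cast h

/-- At `x₂ = 0`, and for `β` of negative real part, the integral along the positive real axis is
a value of the Gamma function, hence does not vanish. -/
theorem rayIntegral_add_regSeries_neg_one_ne_zero {a : ℕ} (ha : a ≠ 0) (b : ℕ) {β : ℂ}
    (hβ : β.re < 0) : rayIntegral a b β (-1, 0) 0 + regSeries a b β (-1, 0) ≠ 0 := by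
  have ha' : (0 : ℝ) < a := by exact_mod_cast Nat.pos_of_ne_zero ha
  have haC : (a : ℂ) ≠ 0 := by exact_mod_cast ha
  -- For negative real part nothing is subtracted, and the gap is -Re β.
  have h := (integral_corrected (b := b) (s := ∅) (x := (-1, 0)) ha (neg_pos.2 hβ) (by simp)
    (fun l _ => by rw [add_neg_cancel]; positivity) (by simp) le_rfl).2
  rw [← h]
  have hre : 0 < (-β / a).re := by
    rw [Complex.div_natCast_re]
    exact div_pos (by simpa using hβ) ha'
  -- The substitution u = t^a turns the integral into Euler's integral for Γ(-β/a)/a.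
  have e : ∫ t in Ioi (0 : ℝ), corrected a b β ∅ (-1, 0) t = Complex.Gamma (-β / a) / a := by
    rw [Complex.Gamma_eq_integral hre, Complex.GammaIntegral, ← integral_comp_rpow_Ioi_of_pos
      (g := fun t : ℝ => ((-t).exp : ℂ) * (t : ℂ) ^ (-β / a - 1)) ha', ← integral_div]
    refine setIntegral_congr_fun measurableSet_Ioi fun t ht => ?_
    have ht0 : (t : ℂ) ≠ 0 := by exact_mod_cast (ne_of_gt ht)
    have ht' : (0 : ℝ) < t := ht
    simp only [corrected, Finset.sum_empty, sub_zero, zero_mul, add_zero, Complex.real_smul]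
    rw [Real.rpow_natCast, Complex.ofReal_mul, Complex.ofReal_cpow ht'.le]
    have e1 : ((t ^ a : ℝ) : ℂ) ^ (-β / a - 1) = (t : ℂ) ^ (-β - a) := by
      have hp : ((t ^ a : ℝ) : ℂ) ≠ 0 := by exact_mod_cast (pow_pos ht' a).ne'
      rw [Complex.cpow_def_of_ne_zero hp, Complex.cpow_def_of_ne_zero ht0,
        ← Complex.ofReal_log (pow_pos ht' a).le, ← Complex.ofReal_log ht'.le, Real.log_pow]
      congr 1
      push_cast
      field_simp
    rw [e1]
    have e2 : (t : ℂ) ^ (-β - 1) = (t : ℂ) ^ (((a : ℝ) - 1 : ℝ) : ℂ) * (t : ℂ) ^ (-β - a) := by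
      rw [← Complex.cpow_add _ _ ht0]
      congr 1
      push_cast
      ring
    rw [e2, Complex.ofReal_natCast]
    push_cast
    field_simp
  rw [e]
  exact div_ne_zero (Complex.Gamma_ne_zero_of_re_pos hre) haC

end Corrected

/-! ### Values of the integrals at `x₂ = 0` -/

theorem expMonomial_eq_zero {z : ℂ} {l : ℕ × ℕ} (h : l.2 ≠ 0) : expMonomial (z, 0) l = 0 := by
  simp [expMonomial, h]

/-- At x₂ = 0 only the monomials in x₁ survive, so resonance is with multiples of `a` alone. -/
theorem regSeries_euler_zero {a b : ℕ} {β : ℂ} (hβ : ∀ i : ℕ, β ≠ (i * a : ℕ)) (z : ℂ) :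
    a * z * regSeries a b (β - a) (z, 0) - β * regSeries a b β (z, 0) = Complex.exp z := by
  have h := regSeries_euler (a := a) (b := b) (β := β) (x := (z, 0)) (fun l => by
    rcases eq_or_ne l.2 0 with h | h
    · right; simpa [h] using hβ l.1
    · exact Or.inl (expMonomial_eq_zero h))
  simpa using h

theorem integrand_zero (a b : ℕ) (β : ℂ) (x : ℂ × ℂ) (w : ℂ) :
    integrand a b β x w = Complex.exp (-β * w) * Complex.exp (-w) *
      Complex.exp (x.1 * Complex.exp w ^ a + x.2 * Complex.exp w ^ b) := by
  rw [integrand, ← Complex.exp_add (-β * w)]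
  congr 2
  ring

theorem exp_mul_exp_neg (w : ℂ) : Complex.exp w * Complex.exp (-w) = 1 := by
  rw [← Complex.exp_add, add_neg_cancel, Complex.exp_zero]

theorem rayIntegral_add_regSeries_euler {a : ℕ} (ha : a ≠ 0) (b : ℕ) {β : ℂ}
    (hβ : ∀ i : ℕ, β ≠ (i * a : ℕ)) {z : ℂ} (hz : z.re < 0) :
    a * z * (rayIntegral a b (β - a) (z, 0) 0 + regSeries a b (β - a) (z, 0)) =
      β * (rayIntegral a b β (z, 0) 0 + regSeries a b β (z, 0)) := by
  have h1 := rayIntegral_euler (a := a) (b := b) (θ := 0) (x := (z, 0)) ha β (by simpa using hz)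
    (by simp)
  have h2 := regSeries_euler_zero (b := b) hβ z
  rw [integrand_zero] at h1
  simp only [mul_zero, zero_mul, add_zero, Complex.ofReal_zero, neg_zero, Complex.exp_zero,
    one_pow, mul_one, one_mul] at h1
  linear_combination h1 + h2

/-- On the left half plane the sum solves a z f' = β f, because the boundary terms at t = 1 cancel.
It is therefore a multiple of a power function, and it is nonzero at -1. -/
theorem rayIntegral_add_regSeries_ne_zero {a : ℕ} (ha : a ≠ 0) (b : ℕ) {β : ℂ}
    (hβ : β.re < 0) {p : ℂ} (hp : p.re < 0) :
    rayIntegral a b β (p, 0) 0 + regSeries a b β (p, 0) ≠ 0 := by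
  set U : Set ℂ := {z | z.re < 0}
  have hU : IsOpen U := isOpen_lt Complex.continuous_re continuous_const
  -- Only x₂ = 0 matters here, so the second sector is taken empty.
  have hray := shiftFamily_rayIntegral (a := a) (b := b) (S₂ := ∅) ha β (θ := 0) hU isOpen_empty
    (fun z hz => by simpa using (show z.re < 0 from hz)) (fun y hy => absurd hy (notMem_empty y))
  have hd : ∀ z ∈ U, HasDerivAt
      (fun z => rayIntegral a b β (z, 0) 0 + regSeries a b β (z, 0))
      (rayIntegral a b (β - a) (z, 0) 0 + regSeries a b (β - a) (z, 0)) z := fun z hz => by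
    have := (hray.deriv_fst 0 z hz 0 (mem_insert 0 _)).add (hasDerivAt_regSeries_fst a b β z 0)
    simpa using! this
  have h := eq_mul_cpow_of_euler (p := -1) (c := β) ha hU
    (convex_halfSpace_re_lt 0).isPreconnected (by simp [U]) (by simp)
    (fun z hz => Or.inl (by simpa [U, div_neg] using hz)) (fun z hz => (hd z hz).differentiableAt)
    (fun z hz => by
      rw [(hd z hz).deriv]
      refine rayIntegral_add_regSeries_euler ha b (fun i h => ?_) hz
      have := congrArg Complex.re h
      rw [Complex.natCast_re] at this
      have h0 : (0 : ℝ) ≤ (i * a : ℕ) := Nat.cast_nonneg _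
      linarith) p hp
  rw [h]
  have hp0 : p ≠ 0 := fun h => by simp [h] at hp
  refine mul_ne_zero (rayIntegral_add_regSeries_neg_one_ne_zero ha b hβ) ?_
  simp [Complex.cpow_eq_zero_iff, hp0]

/-- A zero for the parameter `β` would propagate through the Euler equation to `β - a`, and after
finitely many steps to a parameter of negative real part. -/
theorem rayIntegral_add_regSeries_ne_zero_of_ne_mul {a : ℕ} (ha : a ≠ 0) (b : ℕ) {β : ℂ}
    (hβ : ∀ i : ℤ, β ≠ i * a) {p : ℂ} (hp : p.re < 0) :
    rayIntegral a b β (p, 0) 0 + regSeries a b β (p, 0) ≠ 0 := by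
  have ha' : (0 : ℝ) < a := by exact_mod_cast Nat.pos_of_ne_zero ha
  have key : ∀ k : ℕ, ∀ β : ℂ, (∀ i : ℤ, β ≠ i * a) → β.re < k * a →
      rayIntegral a b β (p, 0) 0 + regSeries a b β (p, 0) ≠ 0 := by
    intro k
    induction k with
    | zero =>
      intro β _ hre
      exact rayIntegral_add_regSeries_ne_zero ha b (by simpa using hre) hp
    | succ k ih =>
      intro β hβ hre h0
      have h := rayIntegral_add_regSeries_euler (β := β) ha b (fun i h => by
        refine hβ i ?_
        rw [h]
        push_cast
        rfl) hp
      rw [h0, mul_zero] at h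
      have hp0 : p ≠ 0 := fun h => by simp [h] at hp
      have haC : (a : ℂ) ≠ 0 := by exact_mod_cast ha
      refine ih (β - a) (fun i h => hβ (i + 1) ?_) ?_
        ((mul_eq_zero.1 h).resolve_left (mul_ne_zero haC hp0))
      · push_cast
        linear_combination h
      · rw [Complex.sub_re, Complex.natCast_re]
        push_cast at hre
        linarith
  obtain ⟨k, hk⟩ := exists_nat_gt (β.re / a)
  exact key k β hβ ((div_lt_iff₀ ha').1 hk)

theorem rayIntegral_rotate (a b : ℕ) (β : ℂ) (x : ℂ × ℂ) (θ : ℝ) :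
    rayIntegral a b β x θ = Complex.exp (-β * (θ * Complex.I)) *
      rayIntegral a b β (x.1 * Complex.exp (θ * Complex.I) ^ a,
        x.2 * Complex.exp (θ * Complex.I) ^ b) 0 := by
  rw [rayIntegral, rayIntegral, ← MeasureTheory.integral_const_mul]
  refine MeasureTheory.setIntegral_congr_fun measurableSet_Ioi fun r hr => ?_
  have hr0 : (0 : ℝ) < r := zero_lt_one.trans hr
  rw [integrand_zero, integrand_zero, exp_log_add hr0, exp_log_add hr0, mul_add, neg_add,
    Complex.exp_add, Complex.exp_add]
  simp only [Complex.ofReal_zero, zero_mul, Complex.exp_zero, mul_one, add_zero]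
  have e := exp_mul_exp_neg (θ * Complex.I)
  rw [mul_pow, mul_pow, show x.1 * Complex.exp (θ * Complex.I) ^ a * (r : ℂ) ^ a =
    x.1 * ((r : ℂ) ^ a * Complex.exp (θ * Complex.I) ^ a) by ring,
    show x.2 * Complex.exp (θ * Complex.I) ^ b * (r : ℂ) ^ b =
    x.2 * ((r : ℂ) ^ b * Complex.exp (θ * Complex.I) ^ b) by ring]
  linear_combination (Complex.exp (-β * (Real.log r)) * Complex.exp (-β * (θ * Complex.I)) *
    Complex.exp (-(Real.log r : ℂ)) * Complex.exp (x.1 * ((r : ℂ) ^ a *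
      Complex.exp (θ * Complex.I) ^ a) + x.2 * ((r : ℂ) ^ b * Complex.exp (θ * Complex.I) ^ b))) * e

theorem arc_integrand (a b : ℕ) (β : ℂ) (x : ℂ × ℂ) (w : ℂ) :
    integrand a b β x w * (Complex.I * Complex.exp w) = Complex.I * (Complex.exp (-β * w) *
      Complex.exp (x.1 * Complex.exp w ^ a + x.2 * Complex.exp w ^ b)) := by
  rw [integrand_zero]
  linear_combination Complex.I * (Complex.exp (-β * w) *
      Complex.exp (x.1 * Complex.exp w ^ a + x.2 * Complex.exp w ^ b)) * exp_mul_exp_neg w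

theorem hasDerivAt_exp_mul_I_pow (a : ℕ) (z : ℂ) (θ : ℝ) :
    HasDerivAt (fun θ : ℝ => z * Complex.exp (θ * Complex.I) ^ a)
      (Complex.I * (a * (z * Complex.exp (θ * Complex.I) ^ a))) θ := by
  have e : (fun θ : ℝ => z * Complex.exp (θ * Complex.I) ^ a) =
      fun θ : ℝ => z * Complex.exp (a * (θ * Complex.I)) := by
    funext θ; rw [Complex.exp_nat_mul]
  rw [e, ← Complex.exp_nat_mul]
  have d1 : HasDerivAt (fun θ : ℝ => (θ : ℂ) * Complex.I) Complex.I θ := by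
    simpa using (hasDerivAt_id θ).ofReal_comp.mul_const Complex.I
  refine ((d1.const_mul (a : ℂ)).cexp.const_mul z).congr_deriv ?_
  ring

/-- Rotation of a solution of an inhomogeneous Euler equation. -/
theorem rotate_sub_rotate {a b : ℕ} {β c z : ℂ} {θ₁ θ₂ : ℝ} {f f' : ℂ → ℂ}
    (hf : ∀ θ ∈ uIcc θ₁ θ₂, HasDerivAt f (f' (z * Complex.exp (θ * Complex.I) ^ a))
      (z * Complex.exp (θ * Complex.I) ^ a))
    (he : ∀ θ ∈ uIcc θ₁ θ₂, ∀ v, v = z * Complex.exp (θ * Complex.I) ^ a →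
      a * v * f' v - β * f v = c * Complex.exp v) :
    Complex.exp (-β * (θ₂ * Complex.I)) * f (z * Complex.exp (θ₂ * Complex.I) ^ a) -
      Complex.exp (-β * (θ₁ * Complex.I)) * f (z * Complex.exp (θ₁ * Complex.I) ^ a) =
      c * arcIntegral a b β (z, 0) θ₁ θ₂ := by
  rw [arcIntegral, ← intervalIntegral.integral_const_mul]
  refine (intervalIntegral.integral_eq_sub_of_hasDerivAt (f := fun θ : ℝ =>
    Complex.exp (-β * (θ * Complex.I)) * f (z * Complex.exp (θ * Complex.I) ^ a))
    (fun θ hθ => ?_) ?_).symm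
  · have d1 : HasDerivAt (fun θ : ℝ => Complex.exp (-β * (θ * Complex.I)))
        (-β * Complex.I * Complex.exp (-β * (θ * Complex.I))) θ := by
      have : HasDerivAt (fun θ : ℝ => (θ : ℂ) * Complex.I) Complex.I θ := by
        simpa using (hasDerivAt_id θ).ofReal_comp.mul_const Complex.I
      refine (this.const_mul (-β)).cexp.congr_deriv ?_
      ring
    -- The derivative of e^(-iβθ) f(z e^(iaθ)) contains a v f' - β f, which the equation replaces by
    -- c exp(v): this is `c` times the arc integrand.
    refine (d1.mul ((hf θ hθ).comp θ (hasDerivAt_exp_mul_I_pow a z θ))).congr_deriv ?_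
    have h := he θ hθ _ rfl
    rw [arc_integrand]
    simp only [zero_mul, add_zero, Function.comp]
    linear_combination Complex.I * Complex.exp (-β * (θ * Complex.I)) * h
  · exact ((continuous_arc a b β (z, 0)).const_mul c).intervalIntegrable _ _

/-- `regSeries` plays the role of the integral over [0, 1]: the arc is the difference between two
rotated segments issuing from the origin. -/
theorem arcIntegral_eq_regSeries {a : ℕ} (b : ℕ) {β : ℂ} (hβ : ∀ i : ℕ, β ≠ (i * a : ℕ)) (z : ℂ)
    (θ₁ θ₂ : ℝ) : arcIntegral a b β (z, 0) θ₁ θ₂ =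
      Complex.exp (-β * (θ₂ * Complex.I)) *
        regSeries a b β (z * Complex.exp (θ₂ * Complex.I) ^ a, 0) -
      Complex.exp (-β * (θ₁ * Complex.I)) *
        regSeries a b β (z * Complex.exp (θ₁ * Complex.I) ^ a, 0) := by
  rw [rotate_sub_rotate (b := b) (c := 1) (f := fun v => regSeries a b β (v, 0))
    (f' := fun v => regSeries a b (β - a) (v, 0)) (fun θ _ => hasDerivAt_regSeries_fst a b β _ 0)
    (fun θ _ v _ => by rw [one_mul]; exact regSeries_euler_zero hβ v), one_mul]

/-- The integral along a path vanishes if there is rapid decay in all directions between those of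
its two half lines. -/
theorem pathIntegral_eq_zero {a : ℕ} (ha : a ≠ 0) (b : ℕ) (β : ℂ) {z : ℂ} {γ : ℝ × ℝ}
    (h : ∀ θ ∈ uIcc γ.1 γ.2, (z * Complex.exp (θ * Complex.I) ^ a).re < 0) :
    pathIntegral a b β (z, 0) γ = 0 := by
  set U : Set ℂ := {z | z.re < 0}
  have hU : IsOpen U := isOpen_lt Complex.continuous_re continuous_const
  have hray := shiftFamily_rayIntegral (a := a) (b := b) (S₂ := ∅) ha β (θ := 0) hU isOpen_empty
    (fun z hz => by simpa using (show z.re < 0 from hz)) (fun y hy => absurd hy (notMem_empty y))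
  -- Here c = -1: as its direction turns, the ray integral changes by minus the arc integral. This
  -- takes the place of Cauchy's theorem.
  have key := rotate_sub_rotate (a := a) (b := b) (β := β) (z := z) (θ₁ := γ.1) (θ₂ := γ.2)
    (c := -1) (f := fun v => rayIntegral a b β (v, 0) 0)
    (f' := fun v => rayIntegral a b (β - a) (v, 0) 0)
    (fun θ hθ => by
      have := hray.deriv_fst 0 _ (h θ hθ) 0 (mem_insert 0 _)
      simpa using! this)
    (fun θ hθ v hv => by
      have h1 := rayIntegral_euler (a := a) (b := b) (θ := 0) (x := (v, 0)) ha β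
        (by simpa [hv] using h θ hθ) (by simp)
      rw [integrand_zero] at h1
      simp only [mul_zero, zero_mul, add_zero, Complex.ofReal_zero, neg_zero, Complex.exp_zero,
        one_pow, mul_one, one_mul] at h1
      linear_combination h1)
  rw [pathIntegral, rayIntegral_rotate _ _ _ _ γ.1, rayIntegral_rotate _ _ _ _ γ.2]
  simp only [zero_mul]
  linear_combination key

theorem pathIntegral_add (a b : ℕ) (β : ℂ) (x : ℂ × ℂ) (θ₁ θ₂ θ₃ : ℝ) :
    pathIntegral a b β x (θ₁, θ₂) + pathIntegral a b β x (θ₂, θ₃) =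
      pathIntegral a b β x (θ₁, θ₃) := by
  have h := intervalIntegral.integral_add_adjacent_intervals (μ := MeasureTheory.volume)
    ((continuous_arc a b β x).intervalIntegrable θ₁ θ₂)
    ((continuous_arc a b β x).intervalIntegrable θ₂ θ₃)
  simp only [pathIntegral, arcIntegral]
  linear_combination h

/-! ### Rotation by 2π/a at x₂ = 0 and non-vanishing of the basic path integral. -/

/-- The monodromy factor of the integrand at `x₂ = 0` for the rotation of angle `2 π / a`. -/
def monodromy (a : ℕ) (β : ℂ) : ℂ := Complex.exp (-β * ((2 * Real.pi / a : ℝ) * Complex.I))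

theorem exp_two_pi_div_pow {a : ℕ} (ha : a ≠ 0) :
    Complex.exp ((2 * Real.pi / a : ℝ) * Complex.I) ^ a = 1 := by
  have haC : (a : ℂ) ≠ 0 := by exact_mod_cast ha
  rw [← Complex.exp_nat_mul, ← Complex.exp_two_pi_mul_I]
  congr 1
  push_cast
  field_simp

theorem integrand_rotate {a : ℕ} (ha : a ≠ 0) (b : ℕ) (β z w : ℂ) :
    integrand a b β (z, 0) (w + (2 * Real.pi / a : ℝ) * Complex.I) *
      Complex.exp ((2 * Real.pi / a : ℝ) * Complex.I) =
      monodromy a β * integrand a b β (z, 0) w := by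
  rw [integrand_zero, integrand_zero, monodromy, mul_add, neg_add, Complex.exp_add w,
    Complex.exp_add, Complex.exp_add, mul_pow, exp_two_pi_div_pow ha]
  simp only [zero_mul, add_zero, mul_one]
  linear_combination Complex.exp (-β * w) * Complex.exp (-w) *
    Complex.exp (-β * ((2 * Real.pi / a : ℝ) * Complex.I)) *
    Complex.exp (z * Complex.exp w ^ a) * exp_mul_exp_neg ((2 * Real.pi / a : ℝ) * Complex.I)

theorem pathIntegral_rotate {a : ℕ} (ha : a ≠ 0) (b : ℕ) (β z : ℂ) (θ₁ θ₂ : ℝ) :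
    pathIntegral a b β (z, 0) (θ₁ + 2 * Real.pi / a, θ₂ + 2 * Real.pi / a) =
      monodromy a β * pathIntegral a b β (z, 0) (θ₁, θ₂) := by
  have hw : ∀ θ : ℝ, ((θ + 2 * Real.pi / a : ℝ) : ℂ) * Complex.I =
      θ * Complex.I + (2 * Real.pi / a : ℝ) * Complex.I := fun θ => by push_cast; ring
  have hr : ∀ θ, rayIntegral a b β (z, 0) (θ + 2 * Real.pi / a) =
      monodromy a β * rayIntegral a b β (z, 0) θ := by
    intro θ
    rw [rayIntegral, rayIntegral, ← MeasureTheory.integral_const_mul]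
    congr 1
    funext r
    rw [hw, ← add_assoc, Complex.exp_add]
    linear_combination Complex.exp (θ * Complex.I) *
      integrand_rotate ha b β z ((Real.log r : ℂ) + θ * Complex.I)
  have ha : arcIntegral a b β (z, 0) (θ₁ + 2 * Real.pi / a) (θ₂ + 2 * Real.pi / a) =
      monodromy a β * arcIntegral a b β (z, 0) θ₁ θ₂ := by
    rw [arcIntegral, arcIntegral, ← intervalIntegral.integral_comp_add_right,
      ← intervalIntegral.integral_const_mul]
    congr 1
    funext θ
    rw [hw, Complex.exp_add]
    linear_combination Complex.I * Complex.exp (θ * Complex.I) *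
      integrand_rotate ha b β z (θ * Complex.I)
  simp only [pathIntegral, hr, ha]
  ring

/-- Cut the path at the multiples of 2π/a: every piece is a rotation of the first one, and each
rotation multiplies by the monodromy. -/
theorem pathIntegral_eq_geom_sum {a : ℕ} (ha : a ≠ 0) (b : ℕ) (β z : ℂ) (hz : z.re < 0) (q : ℕ) :
    pathIntegral a b β (z, 0) (0, 2 * Real.pi * q / a) =
      (∑ j ∈ Finset.range q, monodromy a β ^ j) *
        pathIntegral a b β (z, 0) (0, 2 * Real.pi / a) := by
  have step : ∀ q : ℕ, pathIntegral a b β (z, 0)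
      (2 * Real.pi * q / a, 2 * Real.pi * (q + 1 : ℕ) / a) =
      monodromy a β ^ q * pathIntegral a b β (z, 0) (0, 2 * Real.pi / a) := by
    intro q
    induction q with
    | zero => simp
    | succ q ih =>
      rw [pow_succ', mul_assoc (monodromy a β), ← ih, ← pathIntegral_rotate ha]
      congr 2 <;> (push_cast; ring)
  induction q with
  | zero =>
    simp only [Finset.range_zero, Finset.sum_empty, zero_mul]
    exact pathIntegral_eq_zero ha b β (fun θ hθ => by simp at hθ; simpa [hθ] using hz)
  | succ q ih =>
    rw [← pathIntegral_add _ _ _ _ 0 (2 * Real.pi * q / a), ih, step, Finset.sum_range_succ,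
      add_mul]

/-- For β = 0 the two rays cancel, and φ = aθ turns the arc into 1/a of the circle integral of exp(z
v)/v, given by Cauchy's formula. -/
theorem pathIntegral_full_zero {a : ℕ} (ha : a ≠ 0) (b : ℕ) (z : ℂ) :
    pathIntegral a b 0 (z, 0) (0, 2 * Real.pi / a) = 2 * Real.pi * Complex.I / a := by
  have haR : (a : ℝ) ≠ 0 := by exact_mod_cast ha
  have hr : rayIntegral a b 0 (z, 0) (2 * Real.pi / a) = rayIntegral a b 0 (z, 0) 0 := by
    rw [rayIntegral_rotate]
    simp only [exp_two_pi_div_pow ha, neg_zero, zero_mul, Complex.exp_zero, mul_one, one_mul]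
  have hc := Complex.circleIntegral_sub_inv_smul_of_differentiable_on_off_countable (R := 1)
    (c := 0) (w := 0) (f := fun v => Complex.exp (z * v)) countable_empty (by simp)
    (by fun_prop) (fun v _ => by fun_prop)
  have hcirc : ∫ φ in (0 : ℝ)..2 * Real.pi, Complex.I * Complex.exp (z * Complex.exp (φ * Complex.I))
      = 2 * Real.pi * Complex.I := by
    rw [circleIntegral] at hc
    simp only [mul_zero, Complex.exp_zero, smul_eq_mul, mul_one, sub_zero] at hc
    rw [← hc]
    congr 1
    funext φ
    rw [deriv_circleMap]
    have h0 : circleMap 0 1 φ ≠ 0 := circleMap_ne_center one_ne_zero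
    rw [mul_comm (circleMap 0 1 φ), mul_assoc, mul_inv_cancel_left₀ h0]
    simp [circleMap]
  have harc : arcIntegral a b 0 (z, 0) 0 (2 * Real.pi / a) = 2 * Real.pi * Complex.I / a := by
    rw [arcIntegral]
    simp only [arc_integrand, neg_zero, zero_mul, Complex.exp_zero, one_mul, add_zero]
    have hs := intervalIntegral.integral_comp_mul_left (a := 0) (b := 2 * Real.pi / a)
      (fun φ : ℝ => Complex.I * Complex.exp (z * Complex.exp (φ * Complex.I))) haR
    rw [mul_zero, mul_div_cancel₀ _ haR, hcirc] at hs
    rw [Complex.real_smul] at hs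
    refine Eq.trans ?_ (hs.trans ?_)
    · congr 1
      funext φ
      rw [← Complex.exp_nat_mul]
      push_cast
      rw [mul_assoc (a : ℂ)]
    · push_cast
      ring
  rw [pathIntegral, hr, harc]
  ring

theorem monodromy_eq_one_iff {a : ℕ} (ha : a ≠ 0) {β : ℂ} :
    monodromy a β = 1 ↔ ∃ i : ℤ, β = i * a := by
  have haC : (a : ℂ) ≠ 0 := by exact_mod_cast ha
  have hpi : (Real.pi : ℂ) ≠ 0 := by exact_mod_cast Real.pi_ne_zero
  rw [monodromy, Complex.exp_eq_one_iff]
  constructor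
  · rintro ⟨n, hn⟩
    refine ⟨-n, ?_⟩
    push_cast at hn ⊢
    field_simp at hn
    have h2 : (2 : ℂ) * Real.pi * Complex.I ≠ 0 := by simp [hpi]
    linear_combination -hn
  · rintro ⟨i, rfl⟩
    refine ⟨-i, ?_⟩
    push_cast
    field_simp

/-- The integral along the loop of angle `2 π / a` only vanishes for `β ∈ {-a, -2 a, …}`. -/
theorem pathIntegral_full_ne_zero {a : ℕ} (ha : a ≠ 0) (b : ℕ) {β z : ℂ} (hz : z.re < 0)
    (hβ : ∀ k : ℕ, 1 ≤ k → β ≠ -(k * a : ℕ)) :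
    pathIntegral a b β (z, 0) (0, 2 * Real.pi / a) ≠ 0 := by
  have haC : (a : ℂ) ≠ 0 := by exact_mod_cast ha
  have hz0 : z ≠ 0 := fun h => by simp [h] at hz
  by_cases h : ∃ i : ℤ, β = i * a
  -- For β = ka with k ≥ 0, the Euler equation carries a zero at (k + 1)a down to ka, and finally to
  -- 0, where the value is 2πi/a.
  · obtain ⟨i, rfl⟩ := h
    have hi : 0 ≤ i := by
      by_contra hneg
      refine hβ (-i).toNat (by omega) ?_
      have : (((-i).toNat : ℤ) : ℂ) = -i := by
        rw [Int.toNat_of_nonneg (by omega)]; push_cast; rfl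
      rw [Int.cast_natCast] at this
      push_cast
      rw [this]
      ring
    obtain ⟨k, rfl⟩ := Int.eq_ofNat_of_zero_le hi
    clear hβ hi
    induction k with
    | zero =>
      rw [show ((((0 : ℕ) : ℤ) : ℂ)) * a = 0 by simp, pathIntegral_full_zero ha]
      simp [Real.pi_ne_zero, ha]
    | succ k ih =>
      intro h0
      have h := pathIntegral_euler (a := a) (b := b) (x := (z, 0)) (γ := (0, 2 * Real.pi / a)) ha
        (((k + 1 : ℕ) : ℤ) * a) (by simpa using hz) (by simp)
        (by simpa only [exp_two_pi_div_pow ha, mul_one] using hz) (by simp)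
      rw [h0, mul_zero, mul_zero, zero_mul, add_zero] at h
      have h2 := (mul_eq_zero.1 h).resolve_left (mul_ne_zero haC hz0)
      refine ih ?_
      rw [show (((k : ℕ) : ℤ) : ℂ) * a = (((k + 1 : ℕ) : ℤ) : ℂ) * a - a by push_cast; ring]
      exact h2
  · have hβ' : ∀ i : ℤ, β ≠ i * a := fun i hi => h ⟨i, hi⟩
    have hβ'' : ∀ i : ℕ, β ≠ (i * a : ℕ) := fun i hi => h ⟨i, by rw [hi]; push_cast; rfl⟩
    have h1 : monodromy a β - 1 ≠ 0 := sub_ne_zero.2 fun h1 => h ((monodromy_eq_one_iff ha).1 h1)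
    -- Otherwise the path goes in along one ray to the origin and out along a rotated one, giving
    -- the factor monodromy - 1, which is nonzero.
    have key : pathIntegral a b β (z, 0) (0, 2 * Real.pi / a) = (monodromy a β - 1) *
        (rayIntegral a b β (z, 0) 0 + regSeries a b β (z, 0)) := by
      rw [pathIntegral, arcIntegral_eq_regSeries b hβ'', rayIntegral_rotate _ _ _ _
        (2 * Real.pi / a)]
      simp only [exp_two_pi_div_pow ha, monodromy]
      simp
      ring
    rw [key]
    exact mul_ne_zero h1 (rayIntegral_add_regSeries_ne_zero_of_ne_mul ha b hβ' hz)

/-! ### Geometry of the sectors -/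

theorem isOpen_negSector {δ : ℝ} (hδ : δ ≤ Real.pi) : IsOpen (negSector δ) := by
  rw [isOpen_iff_mem_nhds]
  rintro z ⟨hz, harg⟩
  have hs : -z ∈ Complex.slitPlane := by
    rw [Complex.mem_slitPlane_iff_arg]
    exact ⟨fun h => by rw [h, abs_of_pos Real.pi_pos] at harg; linarith, neg_ne_zero.2 hz⟩
  have hc : ContinuousAt (fun w : ℂ => |Complex.arg (-w)|) z :=
    ((Complex.continuousAt_arg hs).comp continuous_neg.continuousAt).abs
  filter_upwards [isOpen_ne.mem_nhds hz, hc.eventually_lt_const harg] with w h1 h2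
  exact ⟨h1, h2⟩

theorem smul_mem_negSector {δ : ℝ} {z : ℂ} (hz : z ∈ negSector δ) {t : ℝ} (ht : 0 < t) :
    (t : ℂ) * z ∈ negSector δ := by
  refine ⟨mul_ne_zero (by exact_mod_cast ht.ne') hz.1, ?_⟩
  rw [← mul_neg, Complex.arg_real_mul _ ht]
  exact hz.2

theorem neg_one_mem_negSector {δ : ℝ} (hδ : 0 < δ) : (-1 : ℂ) ∈ negSector δ :=
  ⟨by simp, by simpa using hδ⟩

theorem re_mul_exp_pow {z : ℂ} (a : ℕ) (θ : ℝ) :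
    (z * Complex.exp (θ * Complex.I) ^ a).re = -(‖z‖ * Real.cos (Complex.arg (-z) + a * θ)) := by
  have h := Complex.norm_mul_exp_arg_mul_I (-z)
  rw [norm_neg] at h
  have e : z * Complex.exp (θ * Complex.I) ^ a =
      -((‖z‖ : ℂ) * Complex.exp ((Complex.arg (-z) + a * θ : ℝ) * Complex.I)) := by
    rw [← Complex.exp_nat_mul]
    push_cast
    rw [add_mul, Complex.exp_add, ← mul_assoc (‖z‖ : ℂ), h, neg_mul, neg_neg, mul_assoc (a : ℂ)]
  rw [e, Complex.neg_re, Complex.re_ofReal_mul, Complex.exp_ofReal_mul_I_re]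

theorem re_mul_exp_pow_neg {δ : ℝ} {z : ℂ} (hz : z ∈ negSector δ) {a : ℕ} {θ : ℝ} {q : ℤ}
    (h : |a * θ - q * (2 * Real.pi)| ≤ Real.pi / 2 - δ) :
    (z * Complex.exp (θ * Complex.I) ^ a).re < 0 := by
  rw [re_mul_exp_pow, neg_lt_zero]
  refine mul_pos (norm_pos_iff.2 hz.1) ?_
  rw [← Real.cos_sub_int_mul_two_pi _ q]
  have h1 := abs_lt.1 hz.2
  have h2 := abs_le.1 h
  exact Real.cos_pos_of_mem_Ioo ⟨by linarith [h1.1, h2.1], by linarith [h1.2, h2.2]⟩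

theorem re_neg_of_mem_negSector {δ : ℝ} (hδ : δ ≤ Real.pi / 2) {z : ℂ} (hz : z ∈ negSector δ) :
    z.re < 0 := by
  have := re_mul_exp_pow_neg (a := 1) (θ := 0) (q := 0) hz (by simpa using hδ)
  simpa using this

theorem isDecayDirection_of_abs_le {a b : ℕ} {δ θ : ℝ} {q r : ℤ}
    (h₁ : |a * θ - q * (2 * Real.pi)| ≤ Real.pi / 2 - δ)
    (h₂ : |b * θ - r * (2 * Real.pi)| ≤ Real.pi / 2 - δ) : IsDecayDirection a b δ δ θ :=
  ⟨fun _ hz => re_mul_exp_pow_neg hz h₁, fun _ hy => re_mul_exp_pow_neg hy h₂⟩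

theorem abs_mul_sub_le_of_mem_uIcc {a c B x y θ : ℝ} (ha : 0 ≤ a) (hx : |a * x - c| ≤ B)
    (hy : |a * y - c| ≤ B) (hθ : θ ∈ uIcc x y) : |a * θ - c| ≤ B := by
  rw [abs_le] at *
  rcases mem_uIcc.1 hθ with h | h
  · have h1 := mul_le_mul_of_nonneg_left h.1 ha
    have h2 := mul_le_mul_of_nonneg_left h.2 ha
    constructor <;> linarith [hx.1, hx.2, hy.1, hy.2]
  · have h1 := mul_le_mul_of_nonneg_left h.1 ha
    have h2 := mul_le_mul_of_nonneg_left h.2 ha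
    constructor <;> linarith [hx.1, hx.2, hy.1, hy.2]

/-- A rotated cycle `exp (i θ) C_r` whose half lines lie in the sectors of rapid decay of
`exp (x₁ t ^ a)` around the arguments `0` and `2 π q / a`. -/
theorem exists_rotated_cycle {a b : ℕ} (ha : 1 ≤ a) (hab : a < b) {q : ℕ} (hq : 1 ≤ q)
    (hqa : q ≤ a) : ∃ (θ : ℝ) (r : ℕ), 1 ≤ r ∧ r ≤ b ∧ |θ| < Real.pi / (2 * b) ∧
      |b * θ| ≤ Real.pi / 2 - Real.pi / (4 * b) ∧
      |a * (θ + 2 * Real.pi * r / b) - q * (2 * Real.pi)| ≤ Real.pi / 2 - Real.pi / (4 * b) := by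
  -- This is qb/a rounded to the nearest integer, so that |a r - q b| ≤ a/2.
  set r := (2 * q * b + a) / (2 * a) with hr
  have h1 : r * (2 * a) ≤ 2 * q * b + a := Nat.div_mul_le_self _ _
  have h2 : 2 * q * b + a < (r + 1) * (2 * a) := by
    have := Nat.lt_div_mul_add (a := 2 * q * b + a) (b := 2 * a) (by omega)
    rw [← hr] at this
    linarith
  have hr1 : 1 ≤ r := by
    rw [hr, Nat.le_div_iff_mul_le (by omega)]
    nlinarith
  have hrb : r ≤ b := by
    rw [← Nat.lt_succ_iff, hr, Nat.div_lt_iff_lt_mul (by omega)]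
    nlinarith
  have haR : (1 : ℝ) ≤ a := by exact_mod_cast ha
  have habR : (a : ℝ) + 1 ≤ b := by exact_mod_cast hab
  have hb0 : (0 : ℝ) < b := by linarith
  have ha0 : (0 : ℝ) < a := by linarith
  have hpi := Real.pi_pos
  set e : ℝ := a * r - q * b with he
  have he1 : |e| ≤ a / 2 := by
    have h1' : (r : ℝ) * (2 * a) ≤ 2 * q * b + a := by exact_mod_cast h1
    have h2' : (2 : ℝ) * q * b + a < (r + 1) * (2 * a) := by exact_mod_cast h2
    rw [abs_le, he]
    constructor <;> linarith
  -- The discrepancy d = 2πr/b - 2πq/a is shared between the two ends: the fraction τ at the start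
  -- and 1 - τ at the end. This τ is the largest one compatible with the condition on `b * θ` when
  -- |d| = π/b.
  set τ : ℝ := 1 / 2 - 1 / (4 * b) with hτ
  have hτ1 : 0 ≤ τ := by
    rw [hτ, sub_nonneg, div_le_div_iff₀ (by positivity) (by positivity)]
    linarith
  have hd : |2 * Real.pi * e / (a * b)| ≤ Real.pi / b := by
    rw [abs_div, abs_mul, abs_of_pos (by positivity : 0 < 2 * Real.pi),
      abs_of_pos (by positivity : 0 < (a : ℝ) * b), div_le_div_iff₀ (by positivity) hb0]
    calc 2 * Real.pi * |e| * b ≤ 2 * Real.pi * (a / 2) * b := by gcongr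
      _ = Real.pi * (a * b) := by ring
  set d : ℝ := 2 * Real.pi * e / (a * b) with hd'
  refine ⟨-(τ * d), r, hr1, hrb, ?_, ?_, ?_⟩
  · rw [abs_neg, abs_mul, abs_of_nonneg hτ1]
    calc τ * |d| ≤ τ * (Real.pi / b) := by gcongr
      _ < (1 / 2) * (Real.pi / b) := by
        have : τ < 1 / 2 := by
          rw [hτ]
          have : (0 : ℝ) < 1 / (4 * b) := by positivity
          linarith
        gcongr
      _ = Real.pi / (2 * b) := by ring
  · rw [abs_mul, abs_neg, abs_mul, abs_of_nonneg hτ1, abs_of_pos hb0]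
    calc b * (τ * |d|) ≤ b * (τ * (Real.pi / b)) := by gcongr
      _ = Real.pi / 2 - Real.pi / (4 * b) := by rw [hτ]; field_simp
  · have e1 : a * (-(τ * d) + 2 * Real.pi * r / b) - q * (2 * Real.pi) = a * ((1 - τ) * d) := by
      have : 2 * Real.pi * r / b = d + 2 * Real.pi * q / a := by
        rw [hd', he]; field_simp; ring
      rw [this]
      field_simp
      ring
    have hτ2 : 0 ≤ 1 - τ := by
      rw [hτ]
      have : (0 : ℝ) < 1 / (4 * b) := by positivity
      linarith
    rw [e1, abs_mul, abs_mul, abs_of_nonneg hτ2, abs_of_pos ha0]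
    -- The strict inequality a ≤ b - 1 is what leaves room here; the slack is π/(4b²).
    calc a * ((1 - τ) * |d|) ≤ (b - 1) * ((1 - τ) * (Real.pi / b)) := by
          have h1 : (a : ℝ) ≤ b - 1 := by linarith
          have h2 : (0 : ℝ) ≤ b - 1 := by linarith
          gcongr
      _ ≤ Real.pi / 2 - Real.pi / (4 * b) := by
        rw [← sub_nonneg]
        have : Real.pi / 2 - Real.pi / (4 * b) - (b - 1) * ((1 - τ) * (Real.pi / b)) =
            Real.pi / (4 * b ^ 2) := by
          rw [hτ]; field_simp; ring
        rw [this]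
        positivity

/-! ### Solutions given by chains -/

theorem chainIntegral_sum_single {ι : Type*} (a b : ℕ) (β : ℂ) (x : ℂ × ℂ) (s : Finset ι)
    (γ : ι → ℝ × ℝ) (c : ι → ℂ) : chainIntegral a b β (∑ j ∈ s, Finsupp.single (γ j) (c j)) x =
      ∑ j ∈ s, c j * pathIntegral a b β x (γ j) := by
  rw [chainIntegral, ← Finsupp.sum_finsetSum_index (by simp) (by intros; ring)]
  exact Finset.sum_congr rfl fun j _ => Finsupp.sum_single_index (by simp)

theorem support_sum_single {ι : Type*} {s : Finset ι} {γ : ι → ℝ × ℝ} {c : ι → ℂ} {x : ℝ × ℝ}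
    (hx : x ∈ (∑ j ∈ s, Finsupp.single (γ j) (c j)).support) : ∃ j ∈ s, x = γ j := by
  classical
  obtain ⟨j, hj, hx'⟩ := Finset.mem_biUnion.1 (Finsupp.support_finsetSum hx)
  exact ⟨j, hj, Finset.mem_singleton.1 (Finsupp.support_single_subset hx')⟩

theorem monodromy_sub_mul (a : ℕ) (β β' : ℂ) :
    monodromy a (β - β') * monodromy a β' = monodromy a β := by
  rw [monodromy, monodromy, monodromy, ← Complex.exp_add]
  congr 1
  ring

theorem eq_of_mul_sub_mul_eq {a b : ℕ} (hcop : Nat.Coprime a b) {m m' : ℕ} (hm : m < a)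
    (hm' : m' < a) {i : ℤ} (h : (b : ℤ) * m - b * m' = i * a) : m = m' := by
  have h1 : (a : ℤ) ∣ b * (m - m') := ⟨i, by linear_combination h⟩
  have h2 : (a : ℤ) ∣ m - m' :=
    Int.dvd_of_dvd_mul_right_of_gcd_one h1 (by simpa [Int.gcd_natCast_natCast] using hcop)
  have h3 := Int.eq_zero_of_abs_lt_dvd h2 (by rw [abs_lt]; constructor <;> omega)
  omega

/-- Equal factors mean that `a` divides b(m - m'), hence m - m' by coprimality. -/
theorem monodromy_injOn {a b : ℕ} (ha : a ≠ 0) (hcop : Nat.Coprime a b) (β : ℂ) :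
    Function.Injective fun m : Fin a => monodromy a (β - (b * (m : ℕ) : ℕ)) := by
  intro m m' h
  have h1 := monodromy_sub_mul a (β - (b * (m : ℕ) : ℕ)) (β - (b * (m' : ℕ) : ℕ))
  have hne : monodromy a (β - (b * (m' : ℕ) : ℕ)) ≠ 0 := Complex.exp_ne_zero _
  rw [show monodromy a (β - (b * (m : ℕ) : ℕ)) = monodromy a (β - (b * (m' : ℕ) : ℕ)) from h,
    mul_eq_right₀ hne, monodromy_eq_one_iff ha] at h1
  obtain ⟨i, hi⟩ := h1
  refine Fin.ext (eq_of_mul_sub_mul_eq hcop m.2 m'.2 (i := -i) ?_)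
  have : ((b * (m : ℕ) : ℕ) : ℂ) - (b * (m' : ℕ) : ℕ) = ((-i : ℤ) : ℂ) * a := by
    push_cast at hi ⊢
    linear_combination -hi
  exact_mod_cast this

/-- The polynomials 1 + X + ⋯ + X^j are monic of degree j, so their matrix of values at distinct
points has the Vandermonde determinant. -/
theorem exists_geom_sum_solution {n : ℕ} {ζ : Fin n → ℂ} (hζ : Function.Injective ζ)
    (y : Fin n → ℂ) : ∃ c : Fin n → ℂ, ∀ m,
      ∑ j, c j * ∑ i ∈ Finset.range (j + 1), ζ m ^ i = y m := by
  set P : Fin n → Polynomial ℂ := fun j => ∑ i ∈ Finset.range (j + 1), Polynomial.X ^ i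
  have hP : ∀ j, (P j).natDegree = j ∧ (P j).Monic := by
    intro j
    have hd : (∑ i ∈ Finset.range j, (Polynomial.X : Polynomial ℂ) ^ i).degree <
        ((Polynomial.X : Polynomial ℂ) ^ (j : ℕ)).degree := by
      rw [Polynomial.degree_X_pow]
      refine (Polynomial.degree_sum_le _ _).trans_lt ?_
      rw [Finset.sup_lt_iff (WithBot.bot_lt_coe _)]
      intro i hi
      rw [Polynomial.degree_X_pow]
      exact_mod_cast Finset.mem_range.1 hi
    constructor
    · simp only [P, Finset.sum_range_succ]
      rw [Polynomial.natDegree_add_eq_right_of_degree_lt hd, Polynomial.natDegree_X_pow]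
    · simp only [P, Finset.sum_range_succ]
      exact (Polynomial.monic_X_pow _).add_of_right hd
  have hdet := Matrix.det_eval_matrixOfPolynomials_eq_det_vandermonde ζ P (fun j => (hP j).1)
    (fun j => (hP j).2)
  set M : Matrix (Fin n) (Fin n) ℂ := Matrix.of fun i j => Polynomial.eval (ζ i) (P j) with hM
  have hu : IsUnit M.det := by
    rw [← hdet]
    exact (Matrix.det_vandermonde_ne_zero_iff.2 hζ).isUnit
  refine ⟨M⁻¹.mulVec y, fun m => ?_⟩
  have h : M.mulVec (M⁻¹.mulVec y) m = y m := by
    rw [Matrix.mulVec_mulVec, Matrix.mul_nonsing_inv _ hu, Matrix.one_mulVec]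
  rw [← h, Matrix.mulVec, dotProduct]
  refine Finset.sum_congr rfl fun j _ => ?_
  simp only [hM, Matrix.of_apply, P, Polynomial.eval_finsetSum, Polynomial.eval_pow,
    Polynomial.eval_X]
  rw [mul_comm]

/-- Chains of rotated cycles realize all the values that are not excluded by the vanishing of the
integral along the loop of angle `2 π / a`. -/
theorem exists_chain_values {a b : ℕ} (ha : 1 ≤ a) (hab : a < b) (hcop : Nat.Coprime a b) (β : ℂ)
    {p : ℂ} (hp : p ∈ negSector (Real.pi / (4 * b))) (v : ℕ → ℂ)
    (hv : ∀ m < a, pathIntegral a b (β - (b * m : ℕ)) (p, 0) (0, 2 * Real.pi / a) = 0 → v m = 0) :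
    ∃ Γ : Chain, IsCombinationOfC b Γ ∧
      IsRapidDecayCycle a b (Real.pi / (4 * b)) (Real.pi / (4 * b)) Γ ∧
      ∀ m < a, chainIntegral a b (β - (b * m : ℕ)) Γ (p, 0) = v m := by
  have ha' : a ≠ 0 := by omega
  have haR : (0 : ℝ) < a := by exact_mod_cast ha
  have habR : (a : ℝ) ≤ b := by exact_mod_cast hab.le
  have hbR : (0 : ℝ) < b := by linarith
  have h0 := fun j : Fin a => exists_rotated_cycle ha hab (q := j + 1) (by omega) (by omega)
  choose θ r hr1 hrb hθ hbθ haθ using h0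
  have haθ' : ∀ j, |a * θ j - (0 : ℤ) * (2 * Real.pi)| ≤ Real.pi / 2 - Real.pi / (4 * b) := by
    intro j
    rw [Int.cast_zero, zero_mul, sub_zero]
    refine le_trans ?_ (hbθ j)
    rw [abs_mul, abs_mul, abs_of_pos haR, abs_of_pos hbR]
    gcongr
  set γ : Fin a → ℝ × ℝ := fun j => (θ j, θ j + 2 * Real.pi * r j / b) with hγ
  set K : ℕ → ℂ := fun m => pathIntegral a b (β - (b * m : ℕ)) (p, 0) (0, 2 * Real.pi / a)
  have hre : p.re < 0 := by
    refine re_neg_of_mem_negSector ?_ hp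
    rw [div_le_div_iff₀ (by positivity) (by positivity)]
    have : (1 : ℝ) ≤ b := by exact_mod_cast (ha.trans hab.le)
    nlinarith [Real.pi_pos]
  have hpath : ∀ (j : Fin a) (β : ℂ), pathIntegral a b β (p, 0) (γ j) =
      (∑ i ∈ Finset.range (j + 1), monodromy a β ^ i) *
        pathIntegral a b β (p, 0) (0, 2 * Real.pi / a) := by
    intro j β
    -- The rotated cycle is cut at the directions 0 and 2π(j + 1)/a. The two outer pieces stay
    -- within one decay sector of exp(x₁ t^a) and contribute nothing.
    rw [← pathIntegral_eq_geom_sum ha' b β p hre (j + 1), hγ,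
      ← pathIntegral_add a b β (p, 0) (θ j) 0 (θ j + 2 * Real.pi * r j / b),
      ← pathIntegral_add a b β (p, 0) 0 (2 * Real.pi * (j + 1 : ℕ) / a)
        (θ j + 2 * Real.pi * r j / b), pathIntegral_eq_zero ha' b β (γ := (θ j, 0)),
      pathIntegral_eq_zero ha' b β (γ := (2 * Real.pi * (j + 1 : ℕ) / a, _)), zero_add, add_zero]
    · intro φ hφ
      refine re_mul_exp_pow_neg (q := ((j + 1 : ℕ) : ℤ)) hp
        (abs_mul_sub_le_of_mem_uIcc haR.le ?_ ?_ hφ)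
      · have : (a : ℝ) * (2 * Real.pi * (j + 1 : ℕ) / a) - ((j + 1 : ℕ) : ℤ) * (2 * Real.pi) = 0 := by
          push_cast
          field_simp
          ring
        simp only [this, abs_zero]
        exact (abs_nonneg _).trans (hbθ j)
      · exact_mod_cast haθ j
    · intro φ hφ
      refine re_mul_exp_pow_neg (q := 0) hp (abs_mul_sub_le_of_mem_uIcc haR.le (haθ' j) ?_ hφ)
      simpa using (abs_nonneg _).trans (hbθ j)
  -- Where `K m` vanishes the quotient is 0 by convention; this is consistent, since `v m` vanishes
  -- there too.
  obtain ⟨c, hc⟩ := exists_geom_sum_solution (monodromy_injOn ha' hcop β)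
    (fun m => v m / K m)
  refine ⟨∑ j, Finsupp.single (γ j) (c j), fun x hx => ?_, fun x hx => ?_, fun m hm => ?_⟩
  · obtain ⟨j, -, rfl⟩ := support_sum_single hx
    exact ⟨hθ j, r j, hr1 j, hrb j, rfl⟩
  · obtain ⟨j, -, rfl⟩ := support_sum_single hx
    refine ⟨isDecayDirection_of_abs_le (haθ' j) (r := 0) (by simpa using hbθ j),
      isDecayDirection_of_abs_le (q := ((j + 1 : ℕ) : ℤ)) (r := (r j : ℤ))
        (by exact_mod_cast haθ j) ?_⟩
    have e : (b : ℝ) * (θ j + 2 * Real.pi * r j / b) - (r j : ℤ) * (2 * Real.pi) = b * θ j := by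
      push_cast
      field_simp
      ring
    simpa only [hγ, e] using hbθ j
  · rw [chainIntegral_sum_single]
    have h := hc ⟨m, hm⟩
    simp only [hpath]
    have e : ∑ j, c j * ((∑ i ∈ Finset.range (j + 1), monodromy a (β - (b * m : ℕ)) ^ i) * K m) =
        v m / K m * K m := by
      rw [← h, Finset.sum_mul]
      simp only [mul_assoc]
    refine e.trans ?_
    rcases eq_or_ne (K m) 0 with hK | hK
    · rw [hv m hm hK, zero_div, zero_mul]
    · rw [div_mul_cancel₀ _ hK]

/-! ### Germs realized by chains, exceptional parameters, and the missing direction. -/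

section Final

variable {a b : ℕ} {β : ℂ} {δ : ℝ} {p : ℂ} {F : ℕ → ℂ × ℂ → ℂ}

theorem ShiftFamily.isSolutionWithExpansion
    (h : ShiftFamily a b (negSector δ) (negSector δ) F)
    (hE : EulerRelation a b β (negSector δ) (negSector δ) F) (hδ : δ ≤ Real.pi)
    {G : ℂ × ℂ → ℂ} (hG : EqOn G (F 0) (negSector δ ×ˢ negSector δ)) (p : ℂ) :
    IsSolutionWithExpansion a b β δ δ p G (germAt p (taylorCoeff b F)) :=
  ⟨h.isHolomorphicSolution hE (isOpen_negSector hδ) (isOpen_negSector hδ) hG, taylorCoeff b F,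
    h.hasAsymptoticExpansion (fun _ hy _ ht => smul_mem_negSector hy ht) hG, rfl⟩

theorem ShiftFamily.germAt_mem (ha : a ≠ 0) (h : ShiftFamily a b (negSector δ) (negSector δ) F)
    (hE : EulerRelation a b β (negSector δ) (negSector δ) F) (hδ : δ ≤ Real.pi)
    (hp : p ∈ negSector δ) {s : ℝ} (hs : (b : ℝ) / a ≤ s) :
    germAt p (taylorCoeff b F) ∈ gevreySolutions a b β s p :=
  ⟨_, rfl, h.taylorCoeff_isGevreySolution ha hE (isOpen_negSector hδ) hp hp.1 hs⟩

theorem germAt_taylorCoeff_value (m : ℕ) :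
    (germAt p (taylorCoeff b F) m).value = F (b * m) (p, 0) / (m.factorial : ℂ) := rfl

/-- The family of the integrals along a chain, for all the parameters `β - k`. -/
def chainFamily (a b : ℕ) (β : ℂ) (Γ : Chain) (k : ℕ) (x : ℂ × ℂ) : ℂ :=
  chainIntegral a b (β - k) Γ x

theorem chainFamily_zero (a b : ℕ) (β : ℂ) (Γ : Chain) (S : Set (ℂ × ℂ)) :
    EqOn (chainIntegral a b β Γ) (chainFamily a b β Γ 0) S := fun x _ => by
  simp [chainFamily]

/-- The family of the corrected integrals along the positive real axis, for all the parameters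
`β - k`. -/
def correctedFamily (a b : ℕ) (β : ℂ) (k : ℕ) (x : ℂ × ℂ) : ℂ :=
  rayIntegral a b (β - k) x 0 + regSeries a b (β - k) x

theorem shiftFamily_correctedFamily (ha : a ≠ 0) (b : ℕ) (β : ℂ) (hδ : δ ≤ Real.pi / 2) :
    ShiftFamily a b (negSector δ) (negSector δ) (correctedFamily a b β) := by
  have hδ' : δ ≤ Real.pi := by linarith [Real.pi_pos]
  exact (shiftFamily_rayIntegral ha β (isOpen_negSector hδ') (isOpen_negSector hδ')
    (fun z hz => by simpa using re_neg_of_mem_negSector hδ hz)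
    (fun z hz => by simpa using (re_neg_of_mem_negSector hδ hz).le)).add
    (shiftFamily_regSeries a b β _ _)

/-- Subtracting an element of the semigroup ℕa + ℕb from an exceptional integer leaves it outside
the semigroup, so no resonance occurs at any stage, and the boundary terms at t = 1 cancel. -/
theorem eulerRelation_correctedFamily (ha : a ≠ 0) {n : ℤ} (hn : n ∈ exceptionalIntegers a b)
    (hδ : δ ≤ Real.pi / 2) :
    EulerRelation a b n (negSector δ) (negSector δ) (correctedFamily a b n) := by
  intro i j z hz y hy
  have hy' : y.re ≤ 0 := by
    rcases hy with rfl | hy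
    · simp
    · exact (re_neg_of_mem_negSector hδ hy).le
  have h1 := rayIntegral_euler (a := a) (b := b) (θ := 0) (x := (z, y)) ha
    ((n : ℂ) - (a * i + b * j : ℕ)) (by simpa using re_neg_of_mem_negSector hδ hz)
    (by simpa using hy')
  have h2 := regSeries_euler (a := a) (b := b) (β := (n : ℂ) - (a * i + b * j : ℕ)) (x := (z, y))
    (fun l => by
      refine Or.inr fun h => hn (l.1 + i) (l.2 + j) ?_
      have : (n : ℂ) = (((l.1 + i : ℕ) * a + (l.2 + j : ℕ) * b : ℤ) : ℂ) := by
        push_cast at h ⊢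
        linear_combination h
      exact_mod_cast this)
  rw [integrand_zero] at h1
  simp only [mul_zero, zero_mul, Complex.ofReal_zero, neg_zero, Complex.exp_zero,
    one_pow, mul_one] at h1
  simp only [correctedFamily]
  rw [Nat.cast_add _ a, Nat.cast_add _ b, ← sub_sub, ← sub_sub]
  linear_combination h1 + h2

/-- Each coefficient is its value at `p` times a power function, so the hyperplane `φ m = 0` is
detected by one number. -/
theorem value_eq_zero_iff {s : ℝ} (ha : a ≠ 0) (hp0 : p ≠ 0) {φ : ℕ → Germ (𝓝 p) ℂ}
    (hφ : φ ∈ gevreySolutions a b β s p) {m : ℕ} : (φ m).value = 0 ↔ φ m = 0 := by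
  obtain ⟨f, rfl, hf⟩ := hφ
  refine ⟨fun h => ?_, fun h => by rw [h]; rfl⟩
  have h' : f m p = 0 := h
  refine Germ.coe_eq.2 ?_
  filter_upwards [eventually_eq_mul_cpow ha hp0 hf.holomorphic hf.euler] with z hz
  rw [hz m, h', zero_mul]

theorem germ_value_sub_smul (f g : Germ (𝓝 p) ℂ) (c : ℂ) :
    (f - c • g).value = f.value - c * g.value := by
  induction f, g using Germ.inductionOn₂ with
  | _ f g => rfl

/-- Chains of rotated cycles realize all the Gevrey solutions that are not excluded by the
vanishing of the integral along the loop of angle `2 π / a`. -/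
theorem exists_chain_of_mem {s : ℝ} (ha : 1 ≤ a) (hab : a < b) (hcop : Nat.Coprime a b)
    (hs : (b : ℝ) / a ≤ s) (hp : p ∈ negSector (Real.pi / (4 * b))) {φ : ℕ → Germ (𝓝 p) ℂ}
    (hφ : φ ∈ gevreySolutions a b β s p)
    (hv : ∀ m < a, pathIntegral a b (β - (b * m : ℕ)) (p, 0) (0, 2 * Real.pi / a) = 0 →
      (φ m).value = 0) (hδ : Real.pi / (4 * b) ≤ Real.pi) :
    ∃ Γ : Chain, IsCombinationOfC b Γ ∧
      IsRapidDecayCycle a b (Real.pi / (4 * b)) (Real.pi / (4 * b)) Γ ∧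
      germAt p (taylorCoeff b (chainFamily a b β Γ)) = φ := by
  have ha' : a ≠ 0 := by omega
  obtain ⟨Γ, h1, h2, h3⟩ := exists_chain_values ha hab hcop β hp
    (fun m => (φ m).value * (m.factorial : ℂ)) (fun m hm h => by rw [hv m hm h, zero_mul])
  refine ⟨Γ, h1, h2, eq_of_value_eq ha' hp.1 ?_ hφ fun m hm => ?_⟩
  · obtain ⟨hF, hE⟩ := shiftFamily_chainIntegral ha' β (isOpen_negSector hδ)
      (isOpen_negSector hδ) h2
    exact ShiftFamily.germAt_mem ha' hF hE hδ hp hs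
  · have hm0 : (m.factorial : ℂ) ≠ 0 := by exact_mod_cast m.factorial_ne_zero
    rw [germAt_taylorCoeff_value, chainFamily, h3 m hm, mul_div_cancel_right₀ _ hm0]

/-- If b m - k a = i a + j b, then `a` divides m - j, which is positive and at most m < a. -/
theorem mul_sub_mul_mem_exceptionalIntegers (hcop : Nat.Coprime a b) {m k : ℕ} (hm : m < a)
    (hk : 1 ≤ k) : (b * m - k * a : ℤ) ∈ exceptionalIntegers a b := by
  intro i j h
  have ha : 0 < a := by omega
  have h1 : (b : ℤ) * (m - j) = (i + k) * a := by linear_combination h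
  have h1' : (a : ℤ) ∣ b * (m - j) := ⟨i + k, by linear_combination h1⟩
  have h2 : (a : ℤ) ∣ m - j :=
    Int.dvd_of_dvd_mul_right_of_gcd_one h1' (by simpa [Int.gcd_natCast_natCast] using hcop)
  have h3 : 0 < (b : ℤ) * (m - j) := by rw [h1]; positivity
  have h4 : 0 < (m : ℤ) - j := pos_of_mul_pos_right h3 (by positivity)
  have h5 := Int.le_of_dvd h4 h2
  omega

/-- Take m to be the residue of n b⁻¹ modulo `a`, obtained from a Bézout relation; then k ≤ 0 would
put `n` in the semigroup. -/
theorem exists_eq_of_mem_exceptionalIntegers (ha : 1 ≤ a) (hcop : Nat.Coprime a b) {n : ℤ}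
    (hn : n ∈ exceptionalIntegers a b) : ∃ m k : ℕ, m < a ∧ 1 ≤ k ∧ n = b * m - k * a := by
  have ha' : (0 : ℤ) < a := by exact_mod_cast ha
  have hg : (a : ℤ) * a.gcdA b + b * a.gcdB b = 1 := by
    rw [← Nat.gcd_eq_gcd_ab, hcop.gcd_eq_one]; rfl
  set u := n * a.gcdB b
  have hm : (((u % a).toNat : ℕ) : ℤ) = u % a := Int.toNat_of_nonneg (Int.emod_nonneg _ ha'.ne')
  set m := (u % a).toNat
  have hlt : m < a := by
    have := Int.emod_lt_of_pos u ha'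
    omega
  obtain ⟨k, hk⟩ : ∃ k : ℤ, n = b * m - k * a := by
    refine ⟨-(n * a.gcdA b + b * (u / a)), ?_⟩
    have h1 : u = a * (u / a) + m := by rw [hm]; exact (Int.mul_ediv_add_emod u a).symm
    have h2 : (m : ℤ) = u - a * (u / a) := by linarith
    rw [h2]
    linear_combination (-n) * hg
  have hk1 : 1 ≤ k := by
    by_contra hneg
    refine hn (-k).toNat m ?_
    rw [Int.toNat_of_nonneg (by omega), hk]
    ring
  have hk2 : ((k.toNat : ℕ) : ℤ) = k := Int.toNat_of_nonneg (by omega)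
  exact ⟨m, k.toNat, hlt, by omega, by rw [hk2]; exact hk⟩

/-- At x₂ = 0 the Euler equation for β = 0 has right side zero, so the integral vanishes for the
parameter -a; the equation then carries the zero down to -2a, -3a, …. -/
theorem pathIntegral_eq_zero_of_neg_mul (ha : a ≠ 0) {z : ℂ} (hz0 : z ≠ 0) {γ : ℝ × ℝ}
    (h₁ : (z * Complex.exp (γ.1 * Complex.I) ^ a).re < 0)
    (h₂ : (z * Complex.exp (γ.2 * Complex.I) ^ a).re < 0) (k : ℕ) :
    pathIntegral a b (-((k + 1 : ℕ) * a : ℕ)) (z, 0) γ = 0 := by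
  have haC : (a : ℂ) ≠ 0 := by exact_mod_cast ha
  have step : ∀ β : ℂ, β * pathIntegral a b β (z, 0) γ = 0 →
      pathIntegral a b (β - a) (z, 0) γ = 0 := by
    intro β hβ
    have h := pathIntegral_euler (a := a) (b := b) (x := (z, 0)) ha β h₁ (by simp) h₂ (by simp)
    rw [hβ, mul_zero, zero_mul, add_zero] at h
    exact (mul_eq_zero.1 h).resolve_left (mul_ne_zero haC hz0)
  induction k with
  | zero => simpa using step 0 (zero_mul _)
  | succ k ih =>
    rw [show (-((k + 1 + 1 : ℕ) * a : ℕ) : ℂ) = -((k + 1 : ℕ) * a : ℕ) - a by push_cast; ring]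
    exact step _ (by rw [ih, mul_zero])

theorem pi_div_le {b : ℕ} (hb : 1 ≤ b) : Real.pi / (4 * b) ≤ Real.pi / 2 := by
  have hb' : (1 : ℝ) ≤ b := by exact_mod_cast hb
  have := Real.pi_pos
  rw [div_le_div_iff₀ (by positivity) (by positivity)]
  nlinarith

/-- A vanishing basic integral for β - bm would give β = bm - ka with k ≥ 1, an exceptional integer;
hence no value is obstructed. -/
theorem exists_chain_of_nonexceptional {s : ℝ} (ha : 1 ≤ a) (hab : a < b)
    (hcop : Nat.Coprime a b) (hs : (b : ℝ) / a ≤ s) (hp : p ∈ negSector (Real.pi / (4 * b)))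
    (hβ : ∀ n ∈ exceptionalIntegers a b, β ≠ (n : ℂ)) {φ : ℕ → Germ (𝓝 p) ℂ}
    (hφ : φ ∈ gevreySolutions a b β s p) :
    ∃ Γ : Chain, IsCombinationOfC b Γ ∧
      IsRapidDecayCycle a b (Real.pi / (4 * b)) (Real.pi / (4 * b)) Γ ∧
      IsSolutionWithExpansion a b β (Real.pi / (4 * b)) (Real.pi / (4 * b)) p
        (chainIntegral a b β Γ) φ := by
  have hδ₂ := pi_div_le (ha.trans hab.le)
  have hδ : Real.pi / (4 * b) ≤ Real.pi := hδ₂.trans (by linarith [Real.pi_pos])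
  obtain ⟨Γ, h1, h2, rfl⟩ := exists_chain_of_mem ha hab hcop hs hp hφ (fun m hm h => by
    refine absurd h (pathIntegral_full_ne_zero (by omega) b (re_neg_of_mem_negSector hδ₂ hp)
      fun k hk hk' => hβ _ (mul_sub_mul_mem_exceptionalIntegers hcop hm hk) ?_)
    push_cast at hk' ⊢
    linear_combination hk') hδ
  obtain ⟨hF, hE⟩ := shiftFamily_chainIntegral (by omega) β (isOpen_negSector hδ)
    (isOpen_negSector hδ) h2
  exact ⟨Γ, h1, h2, ShiftFamily.isSolutionWithExpansion hF hE hδ (chainFamily_zero a b β Γ _) p⟩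

/-- The germs of Gevrey solutions whose coefficient of index `m` vanishes. -/
def vanishingSolutions (a b : ℕ) (β : ℂ) (s : ℝ) (p : ℂ) (m : ℕ) :
    Submodule ℂ (ℕ → Germ (𝓝 p) ℂ) :=
  gevreySolutions a b β s p ⊓ LinearMap.ker (LinearMap.proj m : (ℕ → Germ (𝓝 p) ℂ) →ₗ[ℂ] _)

theorem mem_vanishingSolutions {s : ℝ} {m : ℕ} {φ : ℕ → Germ (𝓝 p) ℂ} :
    φ ∈ vanishingSolutions a b β s p m ↔ φ ∈ gevreySolutions a b β s p ∧ φ m = 0 := by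
  simp [vanishingSolutions]

/-- The index of a vanishing basic integral is unique modulo `a`, so `m₀` is the only possible
obstruction, and there the required value is zero. -/
theorem exists_chain_of_mem_vanishingSolutions {s : ℝ} (ha : 1 ≤ a) (hab : a < b)
    (hcop : Nat.Coprime a b) (hs : (b : ℝ) / a ≤ s) (hp : p ∈ negSector (Real.pi / (4 * b)))
    {m₀ k : ℕ} (hm₀ : m₀ < a) {n : ℤ} (hn : n = b * m₀ - k * a) {φ : ℕ → Germ (𝓝 p) ℂ}
    (hφ : φ ∈ vanishingSolutions a b n s p m₀) :
    ∃ Γ : Chain, IsCombinationOfC b Γ ∧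
      IsRapidDecayCycle a b (Real.pi / (4 * b)) (Real.pi / (4 * b)) Γ ∧
      germAt p (taylorCoeff b (chainFamily a b n Γ)) = φ := by
  obtain ⟨hφG, hφ0⟩ := mem_vanishingSolutions.1 hφ
  have hδ₂ := pi_div_le (ha.trans hab.le)
  refine exists_chain_of_mem ha hab hcop hs hp hφG (fun m hm h => ?_)
    (hδ₂.trans (by linarith [Real.pi_pos]))
  have h1 : ∃ k' : ℕ, ((n : ℂ) - (b * m : ℕ)) = -(k' * a : ℕ) := by
    by_contra hne
    push Not at hne
    exact pathIntegral_full_ne_zero (by omega) b (re_neg_of_mem_negSector hδ₂ hp)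
      (fun k _ => hne k) h
  obtain ⟨k', hk'⟩ := h1
  have h2 : (n : ℤ) - b * m = -(k' * a) := by exact_mod_cast hk'
  have h3 : m = m₀ := eq_of_mul_sub_mul_eq (b := b) hcop hm hm₀ (i := k' - k) (by
    rw [hn] at h2
    linear_combination -h2)
  rw [h3, hφ0]
  rfl

/-- The expansions of the integrals along rapid decay cycles have a vanishing coefficient for
exceptional parameters. -/
theorem mem_vanishingSolutions_of_chain {s : ℝ} (ha : 1 ≤ a) (hδ0 : 0 < δ) (hδ : δ ≤ Real.pi)
    (hs : (b : ℝ) / a ≤ s) (hp : p ∈ negSector δ) {m₀ k : ℕ} (hk : 1 ≤ k) {n : ℤ}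
    (hn : n = b * m₀ - k * a) {Γ : Chain} (hΓ : IsRapidDecayCycle a b δ δ Γ)
    {φ : ℕ → Germ (𝓝 p) ℂ}
    (hφ : IsSolutionWithExpansion a b n δ δ p (chainIntegral a b n Γ) φ) :
    φ ∈ vanishingSolutions a b n s p m₀ := by
  have ha' : a ≠ 0 := by omega
  obtain ⟨hF, hE⟩ := shiftFamily_chainIntegral ha' n (isOpen_negSector hδ)
    (isOpen_negSector hδ) hΓ
  have hsc : ∀ y ∈ negSector δ, ∀ t : ℝ, 0 < t → (t : ℂ) * y ∈ negSector δ :=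
    fun y hy t ht => smul_mem_negSector hy ht
  obtain ⟨-, c, hc, rfl⟩ := hφ
  have hc' := hF.hasAsymptoticExpansion hsc (chainFamily_zero a b n Γ _)
  have hS : ∀ᶠ z in 𝓝 p, z ∈ negSector δ := (isOpen_negSector hδ).mem_nhds hp
  -- By uniqueness of expansions, the given one is the Taylor expansion of the shift family.
  have e : germAt p c = germAt p (taylorCoeff b (chainFamily a b n Γ)) := by
    funext m
    refine Germ.coe_eq.2 (hS.mono fun z hz => ?_)
    exact hc.unique hsc (neg_one_mem_negSector hδ0) (by simp) hc' hz m
  rw [e]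
  refine mem_vanishingSolutions.2 ⟨ShiftFamily.germAt_mem ha' hF hE hδ hp hs,
    Germ.coe_eq.2 (hS.mono fun z hz => ?_)⟩
  have hzero : ∀ γ ∈ Γ.support, pathIntegral a b ((n : ℂ) - (b * m₀ : ℕ)) (z, 0) γ = 0 := by
    intro γ hγ
    have h := pathIntegral_eq_zero_of_neg_mul (b := b) ha' hz.1 ((hΓ γ hγ).1.1 z hz)
      ((hΓ γ hγ).2.1 z hz) (k - 1)
    rw [Nat.sub_add_cancel hk] at h
    refine Eq.trans ?_ h
    congr 1
    rw [hn]
    push_cast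
    ring
  have : chainFamily a b n Γ (b * m₀) (z, 0) = 0 := by
    rw [chainFamily, chainIntegral, Finsupp.sum]
    exact Finset.sum_eq_zero fun γ hγ => by rw [hzero γ hγ, mul_zero]
  rw [taylorCoeff, this, zero_div]

/-- The coefficient of index m₀ belongs to the parameter n - b m₀ = -ka, of negative real part,
where the value is of Gamma type. -/
theorem correctedFamily_value_ne_zero (ha : 1 ≤ a) (hδ : δ ≤ Real.pi / 2) (hp : p ∈ negSector δ)
    {m₀ k : ℕ} (hk : 1 ≤ k) {n : ℤ} (hn : n = b * m₀ - k * a) :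
    (germAt p (taylorCoeff b (correctedFamily a b n)) m₀).value ≠ 0 := by
  rw [germAt_taylorCoeff_value, correctedFamily]
  refine div_ne_zero (rayIntegral_add_regSeries_ne_zero (by omega) b ?_
    (re_neg_of_mem_negSector hδ hp)) (by exact_mod_cast m₀.factorial_ne_zero)
  have e : (n : ℂ) - (b * m₀ : ℕ) = ((-(k * a : ℕ) : ℝ) : ℂ) := by
    rw [hn]; push_cast; ring
  rw [e, Complex.ofReal_re, neg_lt_zero]
  exact_mod_cast Nat.mul_pos hk ha

theorem sub_smul_mem_vanishingSolutions {s : ℝ} (ha : a ≠ 0) (hp0 : p ≠ 0) {m₀ : ℕ}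
    {φ ψ : ℕ → Germ (𝓝 p) ℂ} (hφ : φ ∈ gevreySolutions a b β s p)
    (hψ : ψ ∈ gevreySolutions a b β s p) (h0 : (ψ m₀).value ≠ 0) :
    φ - ((φ m₀).value / (ψ m₀).value) • ψ ∈ vanishingSolutions a b β s p m₀ := by
  have hmem := Submodule.sub_mem _ hφ (Submodule.smul_mem _ ((φ m₀).value / (ψ m₀).value) hψ)
  refine mem_vanishingSolutions.2 ⟨hmem, (value_eq_zero_iff ha hp0 hmem).1 ?_⟩
  rw [Pi.sub_apply, Pi.smul_apply, germ_value_sub_smul, div_mul_cancel₀ _ h0, sub_self]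

theorem germAt_taylorCoeff_add_smul (F G : ℕ → ℂ × ℂ → ℂ) (c : ℂ) :
    germAt p (taylorCoeff b (F + c • G)) =
      germAt p (taylorCoeff b F) + c • germAt p (taylorCoeff b G) := by
  have e : taylorCoeff b (F + c • G) = taylorCoeff b F + c • taylorCoeff b G := by
    funext m z
    simp only [taylorCoeff, Pi.add_apply, Pi.smul_apply, smul_eq_mul]
    ring
  rw [e]
  rfl

end Final

end GevreyHyp

end

/-! ### Assembly of the three statements, with both sectors of half-opening π/(4b). -/

theorem mainTheorem2 (a b : ℕ) (ha : 1 ≤ a) (hab : a < b) (hcop : Nat.Coprime a b) (β : ℂ) :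
    ∃ δ₁ : ℝ, 0 < δ₁ ∧ ∃ δ₂ : ℝ, 0 < δ₂ ∧
      ∀ s : ℝ, (b : ℝ) / a ≤ s → ∀ p ∈ GevreyHyp.negSector δ₁,
        -- every Gevrey solution is the asymptotic expansion of a holomorphic solution
        (∀ φ ∈ GevreyHyp.gevreySolutions a b β s p, ∃ F : ℂ × ℂ → ℂ,
          GevreyHyp.IsSolutionWithExpansion a b β δ₁ δ₂ p F φ) ∧
        -- the non-exceptional parameters: all of them come from rapid decay cycles
        ((∀ n ∈ GevreyHyp.exceptionalIntegers a b, β ≠ (n : ℂ)) →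
          ∀ φ ∈ GevreyHyp.gevreySolutions a b β s p, ∃ Γ : GevreyHyp.Chain,
            GevreyHyp.IsCombinationOfC b Γ ∧ GevreyHyp.IsRapidDecayCycle a b δ₁ δ₂ Γ ∧
            GevreyHyp.IsSolutionWithExpansion a b β δ₁ δ₂ p
              (GevreyHyp.chainIntegral a b β Γ) φ) ∧
        -- the exceptional parameters
        (∀ n ∈ GevreyHyp.exceptionalIntegers a b, β = (n : ℂ) →
          ∃ W : Submodule ℂ (ℕ → Filter.Germ (nhds p) ℂ),
            (∀ φ, φ ∈ W ↔ ∃ Γ : GevreyHyp.Chain,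
              GevreyHyp.IsRapidDecayCycle a b δ₁ δ₂ Γ ∧
              GevreyHyp.IsSolutionWithExpansion a b β δ₁ δ₂ p
                (GevreyHyp.chainIntegral a b β Γ) φ) ∧
            (∀ φ ∈ W, ∃ Γ : GevreyHyp.Chain,
              GevreyHyp.IsCombinationOfC b Γ ∧ GevreyHyp.IsRapidDecayCycle a b δ₁ δ₂ Γ ∧
              GevreyHyp.IsSolutionWithExpansion a b β δ₁ δ₂ p
                (GevreyHyp.chainIntegral a b β Γ) φ) ∧
            W ≤ GevreyHyp.gevreySolutions a b β s p ∧
            Module.finrank ℂ (GevreyHyp.gevreySolutions a b β s p ⧸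
              W.submoduleOf (GevreyHyp.gevreySolutions a b β s p)) = 1 ∧
            (∀ x ∈ GevreyHyp.negSector δ₁ ×ˢ GevreyHyp.negSector δ₂,
              MeasureTheory.IntegrableOn (GevreyHyp.correctedIntegrand a b n x)
                (Set.Ioi (0 : ℝ))) ∧
            ∃ ψ : ℕ → Filter.Germ (nhds p) ℂ,
              GevreyHyp.IsSolutionWithExpansion a b β δ₁ δ₂ p
                (GevreyHyp.correctedIntegral a b n) ψ ∧
              ψ ≠ 0 ∧ Disjoint W (Submodule.span ℂ {ψ}) ∧
              W ⊔ Submodule.span ℂ {ψ} = GevreyHyp.gevreySolutions a b β s p) := by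
  open GevreyHyp in
  have hbR : (0 : ℝ) < b := by exact_mod_cast (by omega : 0 < b)
  have ha' : a ≠ 0 := by omega
  have hδ0 : 0 < Real.pi / (4 * b) := by positivity
  have hδ₂ := pi_div_le (ha.trans hab.le)
  have hδ : Real.pi / (4 * b) ≤ Real.pi := hδ₂.trans (by linarith [Real.pi_pos])
  refine ⟨Real.pi / (4 * b), hδ0, Real.pi / (4 * b), hδ0, fun s hs p hp => ⟨?_, ?_, ?_⟩⟩
  · intro φ hφ
    by_cases hβ : ∀ n ∈ exceptionalIntegers a b, β ≠ (n : ℂ)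
    · obtain ⟨Γ, -, -, h⟩ := exists_chain_of_nonexceptional ha hab hcop hs hp hβ hφ
      exact ⟨_, h⟩
    · push Not at hβ
      obtain ⟨n, hn, rfl⟩ := hβ
      obtain ⟨m₀, k, hm₀, hk, hnk⟩ := exists_eq_of_mem_exceptionalIntegers ha hcop hn
      have hJ := shiftFamily_correctedFamily ha' b n hδ₂
      have hJE := eulerRelation_correctedFamily ha' hn hδ₂
      -- Removing the right multiple of the corrected expansion kills the coefficient of index m₀;
      -- chains realize the rest.
      have hw := sub_smul_mem_vanishingSolutions ha' hp.1 hφ (hJ.germAt_mem ha' hJE hδ hp hs)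
        (correctedFamily_value_ne_zero ha hδ₂ hp hk hnk)
      set c := (φ m₀).value / (germAt p (taylorCoeff b (correctedFamily a b n)) m₀).value
      obtain ⟨Γ, -, hΓ, e⟩ := exists_chain_of_mem_vanishingSolutions ha hab hcop hs hp hm₀ hnk hw
      obtain ⟨hF, hE⟩ := shiftFamily_chainIntegral ha' n (isOpen_negSector hδ)
        (isOpen_negSector hδ) hΓ
      have h := ShiftFamily.isSolutionWithExpansion (hF.add (hJ.smul c)) (hE.add (hJE.smul c)) hδ
        (fun x _ => rfl) p
      refine ⟨_, (?_ : germAt p (taylorCoeff b (chainFamily a b n Γ +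
        c • correctedFamily a b n)) = φ) ▸ h⟩
      rw [germAt_taylorCoeff_add_smul, e, sub_add_cancel]
  · intro hβ φ hφ
    exact exists_chain_of_nonexceptional ha hab hcop hs hp hβ hφ
  · rintro n hn rfl
    obtain ⟨m₀, k, hm₀, hk, hnk⟩ := exists_eq_of_mem_exceptionalIntegers ha hcop hn
    have hJ := shiftFamily_correctedFamily ha' b n hδ₂
    have hJE := eulerRelation_correctedFamily ha' hn hδ₂
    have hψG := hJ.germAt_mem ha' hJE hδ hp hs
    have hψ0 := correctedFamily_value_ne_zero ha hδ₂ hp hk hnk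
    have hred := fun φ (hφ : φ ∈ gevreySolutions a b n s p) =>
      sub_smul_mem_vanishingSolutions ha' hp.1 hφ hψG hψ0
    have hψsol : IsSolutionWithExpansion a b n (Real.pi / (4 * b)) (Real.pi / (4 * b)) p
        (correctedIntegral a b n) (germAt p (taylorCoeff b (correctedFamily a b n))) :=
      hJ.isSolutionWithExpansion hJE hδ (fun x hx => by
        rw [(correctedIntegral_eq ha' (by omega) hn (re_neg_of_mem_negSector hδ₂ hx.1)
          (re_neg_of_mem_negSector hδ₂ hx.2).le).2]
        simp [correctedFamily]) p
    set ψ := germAt p (taylorCoeff b (correctedFamily a b n))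
    have hψW : ψ ∉ vanishingSolutions a b n s p m₀ := fun h =>
      hψ0 (by rw [(mem_vanishingSolutions.1 h).2]; rfl)
    have hψne : ψ ≠ 0 := fun h => hψ0 (by rw [h]; rfl)
    have hchain : ∀ φ ∈ vanishingSolutions a b n s p m₀, ∃ Γ : Chain, IsCombinationOfC b Γ ∧
        IsRapidDecayCycle a b (Real.pi / (4 * b)) (Real.pi / (4 * b)) Γ ∧
        IsSolutionWithExpansion a b n (Real.pi / (4 * b)) (Real.pi / (4 * b)) p
          (chainIntegral a b n Γ) φ := by
      intro φ hφ
      obtain ⟨Γ, h1, h2, rfl⟩ := exists_chain_of_mem_vanishingSolutions ha hab hcop hs hp hm₀ hnk hφ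
      obtain ⟨hF, hE⟩ := shiftFamily_chainIntegral ha' n (isOpen_negSector hδ)
        (isOpen_negSector hδ) h2
      exact ⟨Γ, h1, h2, ShiftFamily.isSolutionWithExpansion hF hE hδ (chainFamily_zero a b n Γ _) p⟩
    refine ⟨vanishingSolutions a b n s p m₀, fun φ => ⟨fun hφ => ?_, ?_⟩, hchain, inf_le_left, ?_,
      fun x hx => (correctedIntegral_eq ha' (by omega) hn (re_neg_of_mem_negSector hδ₂ hx.1)
        (re_neg_of_mem_negSector hδ₂ hx.2).le).1, ψ, hψsol, hψne,
      (Submodule.disjoint_span_singleton' hψne).2 hψW, le_antisymm ?_ fun φ hφ => ?_⟩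
    · obtain ⟨Γ, -, h2, h3⟩ := hchain φ hφ
      exact ⟨Γ, h2, h3⟩
    · rintro ⟨Γ, h2, h3⟩
      exact mem_vanishingSolutions_of_chain ha hδ0 hδ hs hp hk hnk h2 h3
    -- The class of ψ spans the quotient: modulo W, each φ is the multiple of ψ with the same
    -- coefficient of index m₀.
    · refine finrank_eq_one (Submodule.Quotient.mk ⟨ψ, hψG⟩) (fun h => ?_) fun w => ?_
      · rw [Submodule.Quotient.mk_eq_zero] at h
        exact hψW h
      · induction w using Submodule.Quotient.induction_on with
        | H φ =>
          refine ⟨(φ.1 m₀).value / (ψ m₀).value, ?_⟩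
          rw [← Submodule.Quotient.mk_smul, eq_comm, Submodule.Quotient.eq]
          exact hred φ.1 φ.2
    · exact sup_le inf_le_left ((Submodule.span_singleton_le_iff_mem _ _).2 hψG)
    · exact Submodule.mem_sup.2 ⟨_, hred φ hφ, _, Submodule.smul_mem _ _
        (Submodule.mem_span_singleton_self ψ), sub_add_cancel _ _⟩
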